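/- Let $\mathcal O$ be the complex octonion algebra with basis $e_0=1,e_1,\dots,e_7$, $e_i^2=-1$ and $e_ie_j=-e_je_i=e_k$ for $(i,j,k)$ (up to cyclic permutation) in $$\{(1,2,5),(5,6,7),(7,4,1),(1,3,6),(6,4,2),(2,7,3),(3,4,5)\},$$ with norm $n(\sum x_ie_i)=\sum x_i^2$. Let $\mathfrak d_4=\mathfrak{so}(\mathcal O,n)$ and $\mathfrak b_3=\{f\in\mathfrak d_4: f(1)=0\}$. Let $G=\mathbb Z_2^3$ with neutral element $e=g_0$ and let $\deg e_i=g_i$, where $g_0=(0,0,0)$, $g_1=(1,0,0)$, $g_2=(0,1,0)$, $g_3=(0,0,1)$, $g_4=(1,1,1)$, $g_5=(1,1,0)$, $g_6=(1,0,1)$, $g_7=(0,1,1)$. For $L\in\{\mathfrak b_3,\mathfrak d_4\}$ let $\Gamma_L$ be the grading $L=\bigoplus_{g\in G}L_g$ with $L_g=\{f\in L: f(\mathcal O_h)\subseteq\mathcal O_{g+h}\ \forall h\in G\}$. A map $\varepsilon:G\times G\to\mathbb C$ is a graded contraction of $\Gamma_L$ if the bilinear product $[x,y]^\varepsilon=\varepsilon(g,h)[x,y]$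 ($x\in L_g$, $y\in L_h$) makes the vector space $L$ a Lie algebra, denoted $L^\varepsilon$; it is admissible if $\varepsilon(g,g)=\varepsilon(e,g)=\varepsilon(g,e)=0$ for all $g$. Its support is $\{\{i,j\}:1\le i<j\le 7,\ \varepsilon(g_i,g_j)\neq0\}$, a subset of the set $X$ of all 2-element subsets of $\{1,\dots,7\}$. For $i\ne j$ in $\{1,\dots,7\}$ let $i*j$ be the index with $g_{i*j}=g_i+g_j$, i.e. the third point of the line $\ell_{ij}=\{i,j,i*j\}$ of the Fano plane. For $k\notin\ell_{ij}$ put $P_{\{i,j,k\}}=\{\{i,j\},\{j,k\},\{k,i\},\{i,j*k\},\{j,k*i\},\{k,i*j\}\}$. A set $T\subseteq X$ is nice if $\{i,j\},\{i*j,k\}\in T$ implies $P_{\{i,j,k\}}\subseteq T$ whenever $i\neq j$, $k\notin\ell_{ij}$. A collineation is a bijection $\sigma$ of $\{1,\dots,7\}$ with $\sigma(i*j)=\sigma(i)*\sigma(j)$ for $i\ne j$; two subsets of $X$ are collinear if a collineation maps one onto the other. **Theorem.** Let $L\in\{\mathfrak b_3,\mathfrak d_4\}$, let $r$ be the rank of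 $L$, and let $\varepsilon$ be an admissible graded contraction of $\Gamma_L$ with support $T$. Then $r=3$ if $L=\mathfrak b_3$ and $r=4$ if $L=\mathfrak d_4$, and $T$ is collinear to one and only one of the following nice sets $T_1,\dots,T_{24}$ (writing $ij$ for $\{i,j\}$). In each case $L^\varepsilon$ has the stated properties, where $L'$ stands for the derived algebra $[L^\varepsilon,L^\varepsilon]^\varepsilon$, $\mathfrak z$ for the center and $\mathfrak r$ for the radical of $L^\varepsilon$, "$k$-step nilpotent" (resp. "$k$-step solvable") means that the lower central (resp. derived) series vanishes after exactly $k$ steps, and "reductive" means $\mathfrak r=\mathfrak z$. - $T_1=\emptyset$: $L^\varepsilon$ is abelian. - $T_2=\{12\}$: 2-step nilpotent, $\dim L'=r$, $\dim\mathfrak z=5r$. - $T_3=\{12,13\}$: 2-step nilpotent, $\dim L'=2r$, $\dim\mathfrak z=4r$. - $T_4=\{12,15\}$: 2-step solvable, not nilpotent, $\dim L'=2r$, $\dim\mathfrak z=4r$. - $T_5=\{12,67\}$: 2-step nilpotent, $\dim L'=r$, $\dim\mathfrak z=3r$. - $T_6=\{12,15,25\}$: reductive, neither nilpotent nor solvable,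 $L^\varepsilon=\mathfrak z\oplus L'$, $\dim\mathfrak z=4r$. - $T_7=\{25,36,47\}$: 2-step nilpotent, $\mathfrak z=L'$ of dimension $r$. - $T_8=\{12,13,14\}$: 2-step nilpotent, $\mathfrak z=L'$ of dimension $3r$. - $T_9=\{12,13,15\}$: 2-step solvable, not nilpotent, $\dim L'=\dim\mathfrak z=3r$. - $T_{10}=\{12,13,17\}$: 2-step nilpotent, $\dim L'=\dim\mathfrak z=3r$. - $T_{11}=\{12,16,26\}$: 2-step nilpotent, $\dim L'=3r$, $\dim\mathfrak z=4r$. - $T_{12}=\{12,16,67\}$: 2-step nilpotent, $\dim L'=2r$, $\dim\mathfrak z=3r$. - $T_{13}=\{12,13,14,15\}$ or $T_{14}=\{12,13,15,16\}$: 2-step solvable, not nilpotent, $\dim\mathfrak z=2r$, $\dim L'=4r$. - $T_{15}=\{12,16,17,26\}$: 2-step nilpotent, $\dim L'=\dim\mathfrak z=3r$. - $T_{16}=\{12,16,27,67\}$: 2-step nilpotent, $\dim L'=2r$, $\dim\mathfrak z=3r$. - $T_{17}=\{12,13,14,15,16\}$: 2-step solvable, not nilpotent, $\dim L'=5r$,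 $\dim\mathfrak z=r$. - $T_{18}=\{12,16,17,26,27\}$ or $T_{19}=\{34,36,37,46,47,67\}$: 2-step nilpotent, $\dim L'=\dim\mathfrak z=3r$. - $T_{20}=\{12,13,14,15,16,17\}$: 2-step solvable, not nilpotent, $\dim L'=6r$, $\mathfrak z=0$. - $T_{21}=P_{\{1,2,3\}}=\{12,13,17,23,26,35\}$: 2-step solvable, 3-step nilpotent, $\dim L'=4r$, $\dim\mathfrak z=r$. - $T_{22}=T_{21}\cup\{15,16,56,14\}$: 3-step solvable, not nilpotent, $\dim L'=6r$, $\mathfrak z=0$. - $T_{23}=X\setminus T_{19}$: neither nilpotent nor solvable nor reductive, $\dim\mathfrak r=4r$, and Levi subalgebras of $L^\varepsilon$ exist and are isomorphic to the direct sum of $r$ copies of $\mathfrak{sl}(2,\mathbb C)$. - $T_{24}=X$: $L^\varepsilon$ is simple. Moreover, every $L^\varepsilon$ is $\mathbb Z_2^3$-graded by the same homogeneous components $L_g$, and every homogeneous element $x\in L_g$ is a semisimple element of the Lie algebra $L\subset\mathfrak{gl}(\mathcal O)$: both $\operatorname{ad}_L x$ and $x$ itself, as an endomorphism of $\mathcal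 O$, are semisimple. -/

import Mathlib

attribute [local instance] LieRing.ofAssociativeRing

noncomputable section

namespace OctGrading

/-! ### The group `ℤ₂³`, the labels of the octonion basis and the Fano plane -/

/-- The grading group `ℤ₂³`; its neutral element is `0`. -/
abbrev G := Fin 3 → ZMod 2

/-- `deg i` is the element `g_i` of `ℤ₂³`: the degree of the octonion unit `e_i`. -/
def deg : Fin 8 → G :=
  ![![0, 0, 0], ![1, 0, 0], ![0, 1, 0], ![0, 0, 1],
    ![1, 1, 1], ![1, 1, 0], ![1, 0, 1], ![0, 1, 1]]

/-- The seven lines of the Fano plane on the points `1, …, 7`. -/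
def fanoLines : Finset (Finset (Fin 8)) :=
  {{1, 2, 5}, {5, 6, 7}, {7, 4, 1}, {1, 3, 6}, {6, 4, 2}, {2, 7, 3}, {3, 4, 5}}

/-- For distinct points `i, j ∈ {1, …, 7}`, `star i j` is the third point `i * j` of the line
through `i` and `j` (see `star_line`); the values at `i = j` or at the label `0` follow the rule
`g_i + g_j = g_(i * j)` (see `deg_star`). -/
def star : Fin 8 → Fin 8 → Fin 8 :=
  ![![0, 1, 2, 3, 4, 5, 6, 7],
    ![1, 0, 5, 6, 7, 2, 3, 4],
    ![2, 5, 0, 7, 6, 1, 4, 3],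
    ![3, 6, 7, 0, 5, 4, 1, 2],
    ![4, 7, 6, 5, 0, 3, 2, 1],
    ![5, 2, 1, 4, 3, 0, 7, 6],
    ![6, 3, 4, 1, 2, 7, 0, 5],
    ![7, 4, 3, 2, 1, 6, 5, 0]]

theorem star_line : ∀ i j : Fin 8, i ≠ 0 → j ≠ 0 → i ≠ j →
    ({i, j, star i j} : Finset (Fin 8)) ∈ fanoLines := by decide

theorem star_ne : ∀ i j : Fin 8, i ≠ 0 → j ≠ 0 → i ≠ j →
    star i j ≠ 0 ∧ star i j ≠ i ∧ star i j ≠ j := by decide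

theorem deg_star : ∀ i j : Fin 8, deg (star i j) = deg i + deg j := by decide

/-- The line `ℓ_ij` through two distinct points. -/
def line (i j : Fin 8) : Finset (Fin 8) := {i, j, star i j}

/-! ### Edges, nice sets, collineations -/

/-- The set `X` of the 21 edges `{i, j}`, `1 ≤ i < j ≤ 7`. -/
def X : Finset (Sym2 (Fin 8)) := Finset.univ.filter fun e => ¬ e.IsDiag ∧ (0 : Fin 8) ∉ e

/-- `P_{i,j,k}`. -/
def P (i j k : Fin 8) : Finset (Sym2 (Fin 8)) :=
  {s(i, j), s(j, k), s(k, i), s(i, star j k), s(j, star k i), s(k, star i j)}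

/-- `T_{ijk}`. -/
def Tset (i j k : Fin 8) : Finset (Sym2 (Fin 8)) :=
  P i j k ∪ {s(i, star i j), s(i, star i k), s(star i j, star i k), s(i, star (star i j) k)}

/-- `X_ℓ`: the edges contained in `ℓ`. -/
def edgesIn (l : Finset (Fin 8)) : Finset (Sym2 (Fin 8)) := X.filter fun e => ∀ i ∈ e, i ∈ l

/-- `X_{ℓ^C}`: the edges disjoint from `ℓ`. -/
def edgesOff (l : Finset (Fin 8)) : Finset (Sym2 (Fin 8)) := X.filter fun e => ∀ i ∈ e, i ∉ l

/-- `X_(i)`: the edges through `i`. -/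
def edgesThrough (i : Fin 8) : Finset (Sym2 (Fin 8)) := X.filter fun e => i ∈ e

/-- `X^(i)`: the edges `{j, k}` with `j * k = i`. -/
def edgesOver (i : Fin 8) : Finset (Sym2 (Fin 8)) :=
  X.filter fun e => ∃ j k, e = s(j, k) ∧ star j k = i

/-- Nice sets of edges. -/
def IsNice (T : Set (Sym2 (Fin 8))) : Prop :=
  T ⊆ (X : Set (Sym2 (Fin 8))) ∧
    ∀ i j k : Fin 8, i ≠ 0 → j ≠ 0 → k ≠ 0 → i ≠ j → k ∉ line i j →
      s(i, j) ∈ T → s(star i j, k) ∈ T → (P i j k : Set (Sym2 (Fin 8))) ⊆ T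

/-- A collineation of the Fano plane, as a permutation of the labels that fixes the label `0`
(which is not a point of the plane). -/
def IsCollineation (σ : Equiv.Perm (Fin 8)) : Prop :=
  σ 0 = 0 ∧ ∀ i j : Fin 8, i ≠ 0 → j ≠ 0 → i ≠ j → σ (star i j) = star (σ i) (σ j)

/-- `T ∼_c T'`: some collineation maps `T` onto `T'`. -/
def CollinearSets (T T' : Set (Sym2 (Fin 8))) : Prop :=
  ∃ σ : Equiv.Perm (Fin 8), IsCollineation σ ∧ Sym2.map σ '' T = T'

/-- The list `T_1, …, T_24` (the value at any other number is irrelevant). -/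
def niceSet : ℕ → Finset (Sym2 (Fin 8))
  | 1 => ∅
  | 2 => {s(1, 2)}
  | 3 => {s(1, 2), s(1, 3)}
  | 4 => {s(1, 2), s(1, 5)}
  | 5 => {s(1, 2), s(6, 7)}
  | 6 => edgesIn (line 1 2)
  | 7 => edgesOver 1
  | 8 => {s(1, 2), s(1, 3), s(1, 4)}
  | 9 => {s(1, 2), s(1, 3), s(1, 5)}
  | 10 => {s(1, 2), s(1, 3), s(1, 7)}
  | 11 => {s(1, 2), s(1, 6), s(2, 6)}
  | 12 => {s(1, 2), s(1, 6), s(6, 7)}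
  | 13 => {s(1, 2), s(1, 3), s(1, 4), s(1, 5)}
  | 14 => {s(1, 2), s(1, 3), s(1, 5), s(1, 6)}
  | 15 => {s(1, 2), s(1, 6), s(1, 7), s(2, 6)}
  | 16 => {s(1, 2), s(1, 6), s(2, 7), s(6, 7)}
  | 17 => {s(1, 2), s(1, 3), s(1, 4), s(1, 5), s(1, 6)}
  | 18 => {s(1, 2), s(1, 6), s(1, 7), s(2, 6), s(2, 7)}
  | 19 => edgesOff (line 1 2)
  | 20 => edgesThrough 1
  | 21 => P 1 2 3
  | 22 => Tset 1 2 3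
  | 23 => X \ edgesOff (line 1 2)
  | 24 => X
  | _ => ∅

/-! ### Graded contractions of a `ℤ₂³`-graded complex Lie algebra -/

section Contraction

variable {L : Type} [LieRing L] [LieAlgebra ℂ L]
variable (A : G → Submodule ℂ L) [DirectSum.Decomposition A]

/-- The homogeneous component of degree `g` of an element, as a linear map. -/
def proj (g : G) : L →ₗ[ℂ] L :=
  (A g).subtype ∘ₗ DirectSum.component ℂ G (fun g => A g) g ∘ₗ
    (DirectSum.decomposeLinearEquiv A).toLinearMap

/-- The bilinear product `[·,·]^ε` with `[x, y]^ε = ε(g, h) [x, y]` for `x` of degree `g` and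
`y` of degree `h` (see `contractedBracket_of_mem`). -/
def contractedBracket (ε : G → G → ℂ) (x y : L) : L :=
  ∑ g : G, ∑ h : G, ε g h • ⁅proj A g x, proj A h y⁆

theorem proj_of_mem {g : G} {x : L} (hx : x ∈ A g) (h : G) :
    proj A h x = if g = h then x else 0 := by
  have : proj A h x = (DirectSum.decompose A x h : L) := rfl
  rw [this]
  split_ifs with e
  · subst e; exact DirectSum.decompose_of_mem_same A hx
  · exact DirectSum.decompose_of_mem_ne A hx e

theorem contractedBracket_of_mem (ε : G → G → ℂ) {g h : G} {x y : L} (hx : x ∈ A g)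
    (hy : y ∈ A h) : contractedBracket A ε x y = ε g h • ⁅x, y⁆ := by
  unfold contractedBracket
  rw [Finset.sum_eq_single g, Finset.sum_eq_single h]
  · simp [proj_of_mem A hx, proj_of_mem A hy]
  · intro k _ hk; simp [proj_of_mem A hy, hk.symm]
  · simp
  · intro k _ hk; simp [proj_of_mem A hx, hk.symm]
  · simp

/-- `ε` is a graded contraction: `(L, [·,·]^ε)` is a Lie algebra. -/
structure IsGradedContraction (ε : G → G → ℂ) : Prop where
  alternating : ∀ x : L, contractedBracket A ε x x = 0
  jacobi : ∀ x y z : L, contractedBracket A ε x (contractedBracket A ε y z) +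
    contractedBracket A ε y (contractedBracket A ε z x) +
    contractedBracket A ε z (contractedBracket A ε x y) = 0

variable {A} in
/-- The contracted Lie algebra `L^ε`: the vector space `L` with the bracket `[·,·]^ε`. -/
@[nolint unusedArguments]
def Contracted {ε : G → G → ℂ} (_hε : IsGradedContraction A ε) : Type := L

variable {A} {ε : G → G → ℂ} (hε : IsGradedContraction A ε)

instance : AddCommGroup (Contracted hε) := inferInstanceAs (AddCommGroup L)

instance : Module ℂ (Contracted hε) := inferInstanceAs (Module ℂ L)

/-- The identity map, from `L` to `L^ε`. -/
def toContracted : L ≃ₗ[ℂ] Contracted hε := LinearEquiv.refl ℂ L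

theorem contractedBracket_add_left (x y z : L) : contractedBracket A ε (x + y) z =
    contractedBracket A ε x z + contractedBracket A ε y z := by
  simp [contractedBracket, Finset.sum_add_distrib]

theorem contractedBracket_add_right (x y z : L) : contractedBracket A ε x (y + z) =
    contractedBracket A ε x y + contractedBracket A ε x z := by
  simp [contractedBracket, Finset.sum_add_distrib]

theorem contractedBracket_smul_right (c : ℂ) (x y : L) : contractedBracket A ε x (c • y) =
    c • contractedBracket A ε x y := by
  simp [contractedBracket, Finset.smul_sum, smul_comm c]

theorem contractedBracket_neg_right (x y : L) : contractedBracket A ε x (-y) =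
    -contractedBracket A ε x y := by
  rw [← neg_one_smul ℂ y, contractedBracket_smul_right, neg_one_smul]

theorem contractedBracket_skew (h : IsGradedContraction A ε) (x y : L) :
    contractedBracket A ε x y = - contractedBracket A ε y x := by
  have e := h.alternating (x + y)
  rw [contractedBracket_add_left, contractedBracket_add_right, contractedBracket_add_right,
    h.alternating, h.alternating, zero_add, add_zero] at e
  exact eq_neg_of_add_eq_zero_left e

theorem contractedBracket_leibniz (h : IsGradedContraction A ε) (x y z : L) :
    contractedBracket A ε x (contractedBracket A ε y z) =
      contractedBracket A ε (contractedBracket A ε x y) z +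
        contractedBracket A ε y (contractedBracket A ε x z) := by
  have e := h.jacobi x y z
  rw [contractedBracket_skew h z (contractedBracket A ε x y),
    contractedBracket_skew h z x, contractedBracket_neg_right] at e
  rw [← sub_eq_zero, ← e]
  abel

instance : LieRing (Contracted hε) where
  bracket x y := toContracted hε
    (contractedBracket A ε ((toContracted hε).symm x) ((toContracted hε).symm y))
  add_lie x y z := contractedBracket_add_left (A := A) (ε := ε) x y z
  lie_add x y z := contractedBracket_add_right (A := A) (ε := ε) x y z
  lie_self x := hε.alternating x
  leibniz_lie x y z := by
    exact contractedBracket_leibniz hε x y z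

instance : LieAlgebra ℂ (Contracted hε) where
  lie_smul c x y := contractedBracket_smul_right (A := A) (ε := ε) c x y

end Contraction

/-- Admissible maps. -/
def IsAdmissible (ε : G → G → ℂ) : Prop := ∀ g : G, ε g g = 0 ∧ ε 0 g = 0 ∧ ε g 0 = 0

/-- The support: the set of the edges `{i, j}` with `ε_ij = ε(g_i, g_j) ≠ 0`. -/
def supp (ε : G → G → ℂ) : Set (Sym2 (Fin 8)) :=
  {e | ∃ i j : Fin 8, i ≠ 0 ∧ j ≠ 0 ∧ i ≠ j ∧ e = s(i, j) ∧ ε (deg i) (deg j) ≠ 0}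

/-! ### The gradings `Γ_{𝔟₃}` and `Γ_{𝔡₄}` -/

/-- The vector space of the complex octonions, in coordinates with respect to the basis
`e_0 = 1, e_1, …, e_7`. -/
abbrev Oct := Fin 8 → ℂ

/-- The unit `e_0 = 1` of the octonions. -/
def octOne : Oct := Pi.single 0 1

/-- The bilinear form of the octonion norm `n(∑ x_i e_i) = ∑ x_i ^ 2`. -/
def octForm (x y : Oct) : ℂ := ∑ i, x i * y i

/-- The homogeneous component of degree `g` of the octonions: the span of the `e_i` of
degree `g`. -/
def octComp (g : G) : Submodule ℂ Oct where
  carrier := {x | ∀ i, deg i ≠ g → x i = 0}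
  add_mem' hx hy i hi := by simp [hx i hi, hy i hi]
  zero_mem' i _ := rfl
  smul_mem' c x hx i hi := by simp [hx i hi]

theorem octForm_add_left (x y z : Oct) : octForm (x + y) z = octForm x z + octForm y z := by
  simp [octForm, add_mul, Finset.sum_add_distrib]

theorem octForm_add_right (x y z : Oct) : octForm x (y + z) = octForm x y + octForm x z := by
  simp [octForm, mul_add, Finset.sum_add_distrib]

theorem octForm_smul_left (c : ℂ) (x y : Oct) : octForm (c • x) y = c * octForm x y := by
  simp [octForm, Finset.mul_sum, mul_assoc]

theorem octForm_smul_right (c : ℂ) (x y : Oct) : octForm x (c • y) = c * octForm x y := by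
  simp [octForm, Finset.mul_sum, mul_left_comm]

theorem octForm_sub_left (x y z : Oct) : octForm (x - y) z = octForm x z - octForm y z := by
  simp [octForm, sub_mul, Finset.sum_sub_distrib]

theorem octForm_sub_right (x y z : Oct) : octForm x (y - z) = octForm x y - octForm x z := by
  simp [octForm, mul_sub, Finset.sum_sub_distrib]

/-- `𝔡₄ = 𝔰𝔬(𝒪, n)`. -/
def d4 : LieSubalgebra ℂ (Module.End ℂ Oct) where
  carrier := {f | ∀ x y : Oct, octForm (f x) y + octForm x (f y) = 0}
  add_mem' {f k} hf hk x y := by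
    have h1 := hf x y
    have h2 := hk x y
    simp only [LinearMap.add_apply, octForm_add_left, octForm_add_right]
    linear_combination h1 + h2
  zero_mem' x y := by simp [octForm]
  smul_mem' c f hf x y := by
    have h1 := hf x y
    simp only [LinearMap.smul_apply, octForm_smul_left, octForm_smul_right]
    linear_combination c * h1
  lie_mem' {f k} hf hk x y := by
    have h1 := hf (k x) y
    have h2 := hk (f x) y
    have h3 := hf x (k y)
    have h4 := hk x (f y)
    simp only [LieRing.of_associative_ring_bracket, LinearMap.sub_apply, Module.End.mul_apply,
      octForm_sub_left, octForm_sub_right]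
    linear_combination h1 - h2 + h3 - h4

/-- `𝔟₃ = {f ∈ 𝔰𝔬(𝒪, n) : f(1) = 0}`. -/
def b3 : LieSubalgebra ℂ (Module.End ℂ Oct) where
  carrier := {f | f ∈ d4 ∧ f octOne = 0}
  add_mem' {f k} hf hk := ⟨add_mem hf.1 hk.1, by simp [hf.2, hk.2]⟩
  zero_mem' := ⟨zero_mem _, rfl⟩
  smul_mem' c f hf := ⟨d4.smul_mem c hf.1, by simp [hf.2]⟩
  lie_mem' {f k} hf hk := ⟨d4.lie_mem hf.1 hk.1, by
    simp [LieRing.of_associative_ring_bracket, hf.2, hk.2]⟩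

/-- The two types of simple Lie algebras under consideration. -/
inductive OrthType
  | b3
  | d4

/-- The Lie algebra `𝔟₃` or `𝔡₄`. -/
def OrthType.alg : OrthType → LieSubalgebra ℂ (Module.End ℂ Oct)
  | .b3 => OctGrading.b3
  | .d4 => OctGrading.d4

/-- The number `3` for `𝔟₃`, `4` for `𝔡₄`. -/
def OrthType.r : OrthType → ℕ
  | .b3 => 3
  | .d4 => 4

/-- `L_g = 𝔤𝔩(𝒪)_g ∩ L`: the `f ∈ L` with `f(𝒪_h) ⊆ 𝒪_{g+h}` for all `h`. -/
def component (L : LieSubalgebra ℂ (Module.End ℂ Oct)) (g : G) : Submodule ℂ L where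
  carrier := {f | ∀ h : G, ∀ x ∈ octComp h, (f : Module.End ℂ Oct) x ∈ octComp (g + h)}
  add_mem' hf hk h x hx := add_mem (hf h x hx) (hk h x hx)
  zero_mem' _ _ _ := zero_mem _
  smul_mem' c _ hf h x hx := (octComp (g + h)).smul_mem c (hf h x hx)

/-- The part of degree `g` of an endomorphism. -/
def endPart (g : G) (f : Module.End ℂ Oct) : Module.End ℂ Oct :=
  Matrix.toLin' (Matrix.of fun i j : Fin 8 =>
    if deg i = g + deg j then f (Pi.single j 1) i else 0)

theorem apply_eq (f : Module.End ℂ Oct) (x : Oct) (i : Fin 8) :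
    f x i = ∑ j, f (Pi.single j 1) i * x j := by
  conv_lhs => rw [LinearMap.pi_apply_eq_sum_univ f x]
  rw [Finset.sum_apply]
  refine Finset.sum_congr rfl fun j _ => ?_
  rw [Pi.smul_apply, smul_eq_mul, mul_comm]
  have e : (fun k => if j = k then (1 : ℂ) else 0) = Pi.single j 1 := by
    ext k
    simp [Pi.single_apply, eq_comm]
  rw [e]

theorem end_ext {f k : Module.End ℂ Oct}
    (h : ∀ i j, f (Pi.single j 1) i = k (Pi.single j 1) i) : f = k := by
  ext x i
  simp [h]

theorem deg_injective : Function.Injective deg := by decide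

theorem deg_comm (g : G) (i j : Fin 8) : deg i = g + deg j ↔ deg j = g + deg i := by
  have key : ∀ a b g : G, a = g + b → b = g + a := by
    intro a b g h
    rw [h, ← add_assoc, CharTwo.add_self_eq_zero, zero_add]
  exact ⟨key _ _ _, key _ _ _⟩

theorem endPart_apply (g : G) (f : Module.End ℂ Oct) (x : Oct) (i : Fin 8) :
    endPart g f x i = ∑ j, (if deg i = g + deg j then f (Pi.single j 1) i else 0) * x j := by
  simp [endPart, Matrix.toLin'_apply, Matrix.mulVec, dotProduct]

theorem endPart_single (g : G) (f : Module.End ℂ Oct) (i j : Fin 8) :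
    endPart g f (Pi.single j 1) i = if deg i = g + deg j then f (Pi.single j 1) i else 0 := by
  rw [endPart_apply, Finset.sum_eq_single j] <;> simp +contextual

theorem endPart_add (g : G) (f k : Module.End ℂ Oct) :
    endPart g (f + k) = endPart g f + endPart g k := by
  apply end_ext
  intro i j
  rw [LinearMap.add_apply, Pi.add_apply, endPart_single, endPart_single, endPart_single]
  split_ifs <;> simp

theorem endPart_zero (g : G) : endPart g 0 = 0 := by
  apply end_ext
  intro i j
  rw [endPart_single]
  simp

theorem mem_d4_iff (f : Module.End ℂ Oct) :
    f ∈ d4 ↔ ∀ i j, f (Pi.single j 1) i + f (Pi.single i 1) j = 0 := by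
  constructor
  · intro h i j
    have := h (Pi.single j 1) (Pi.single i 1)
    simpa [octForm, Pi.single_apply] using this
  · intro h x y
    change ∑ i, f x i * y i + ∑ i, x i * f y i = 0
    simp only [apply_eq f x, apply_eq f y, Finset.sum_mul, Finset.mul_sum]
    rw [Finset.sum_comm, ← Finset.sum_add_distrib]
    refine Finset.sum_eq_zero fun i _ => ?_
    rw [← Finset.sum_add_distrib]
    refine Finset.sum_eq_zero fun j _ => ?_
    linear_combination (x i * y j) * h i j

theorem endPart_mem (t : OrthType) (g : G) {f : Module.End ℂ Oct} (hf : f ∈ t.alg) :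
    endPart g f ∈ t.alg := by
  have key : ∀ f ∈ d4, endPart g f ∈ d4 := by
    intro f hf
    rw [mem_d4_iff] at hf ⊢
    intro i j
    rw [endPart_single, endPart_single]
    simp only [deg_comm g i j]
    split_ifs
    · exact hf i j
    · exact add_zero 0
  cases t with
  | d4 => exact key f hf
  | b3 =>
    refine ⟨key f hf.1, ?_⟩
    ext i
    have h0 : f (Pi.single 0 1) i = 0 := congrFun hf.2 i
    change endPart g f (Pi.single 0 1) i = 0
    rw [endPart_single, h0, ite_self]

theorem endPart_mem_component (t : OrthType) (g : G) (f : t.alg) :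
    (⟨endPart g f, endPart_mem t g f.2⟩ : t.alg) ∈ component t.alg g := by
  intro h x hx i hi
  change endPart g f x i = 0
  rw [endPart_apply]
  refine Finset.sum_eq_zero fun j _ => ?_
  by_cases hj : deg j = h
  · rw [if_neg (by rw [hj]; exact hi), zero_mul]
  · rw [hx j hj, mul_zero]

theorem endPart_of_mem (t : OrthType) {g : G} {f : t.alg} (hf : f ∈ component t.alg g) (h : G) :
    endPart h f = if h = g then (f : Module.End ℂ Oct) else 0 := by
  have hs : ∀ i j, deg i ≠ g + deg j → (f : Module.End ℂ Oct) (Pi.single j 1) i = 0 := by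
    intro i j hij
    refine hf (deg j) (Pi.single j 1) (fun k hk => ?_) i hij
    exact Pi.single_eq_of_ne (fun e => hk (by rw [e])) 1
  apply end_ext
  intro i j
  rw [endPart_single]
  split_ifs with h1 h2 h2
  · rfl
  · refine hs i j fun e => h2 ?_
    exact add_right_cancel (h1.symm.trans e)
  · refine (hs i j fun e => h1 ?_).symm
    rw [h2, e]
  · rfl

theorem sum_endPart (f : Module.End ℂ Oct) : ∑ g : G, endPart g f = f := by
  apply end_ext
  intro i j
  rw [LinearMap.sum_apply, Finset.sum_apply]
  simp only [endPart_single]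
  rw [Finset.sum_eq_single (deg i + deg j)]
  · rw [if_pos]
    rw [add_assoc, CharTwo.add_self_eq_zero, add_zero]
  · intro g _ hg
    rw [if_neg]
    intro e
    apply hg
    rw [e, add_assoc, CharTwo.add_self_eq_zero, add_zero]
  · simp

/-- The homogeneous parts of an element of `𝔟₃` or `𝔡₄`. -/
def parts (t : OrthType) (f : t.alg) : DirectSum G fun g => component t.alg g :=
  ∑ g : G, DirectSum.of (fun g => component t.alg g) g
    ⟨⟨endPart g f, endPart_mem t g f.2⟩, endPart_mem_component t g f⟩

theorem parts_zero (t : OrthType) : parts t 0 = 0 := by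
  refine Finset.sum_eq_zero fun g _ => ?_
  exact (congrArg _ (Subtype.ext (Subtype.ext (endPart_zero g)))).trans (map_zero _)

theorem parts_add (t : OrthType) (f k : t.alg) : parts t (f + k) = parts t f + parts t k := by
  unfold parts
  rw [← Finset.sum_add_distrib]
  refine Finset.sum_congr rfl fun g _ => ?_
  rw [← map_add]
  refine congrArg _ (Subtype.ext (Subtype.ext ?_))
  exact endPart_add g (f : Module.End ℂ Oct) (k : Module.End ℂ Oct)

theorem parts_of_mem (t : OrthType) (g : G) (y : component t.alg g) :
    parts t y = DirectSum.of (fun g => component t.alg g) g y := by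
  unfold parts
  rw [Finset.sum_eq_single g]
  · refine congrArg _ (Subtype.ext (Subtype.ext ?_))
    exact (endPart_of_mem t y.2 g).trans (if_pos rfl)
  · intro h _ hh
    refine (congrArg _ (Subtype.ext (Subtype.ext ?_))).trans (map_zero _)
    exact (endPart_of_mem t y.2 h).trans (if_neg hh)
  · simp

/-- The grading `Γ_L` of `L = 𝔟₃` or `𝔡₄`: `L` is the direct sum of the components `L_g`. -/
instance (t : OrthType) : DirectSum.Decomposition (component t.alg) where
  decompose' := parts t
  left_inv f := by
    unfold parts
    rw [map_sum]
    apply Subtype.ext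
    simp only [DirectSum.coeAddMonoidHom_of, AddSubmonoidClass.coe_finsetSum]
    exact sum_endPart f
  right_inv x := by
    induction x using DirectSum.induction_on with
    | zero => rw [map_zero, parts_zero]
    | of g y => rw [DirectSum.coeAddMonoidHom_of, parts_of_mem]
    | add x y hx hy => rw [map_add, parts_add, hx, hy]

theorem lie_mem_component (L : LieSubalgebra ℂ (Module.End ℂ Oct)) {g h : G} {x y : L}
    (hx : x ∈ component L g) (hy : y ∈ component L h) : ⁅x, y⁆ ∈ component L (g + h) := by
  intro k v hv
  have h1 := hx _ _ (hy _ _ hv)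
  have h2 := hy _ _ (hx _ _ hv)
  rw [← add_assoc] at h1 h2
  rw [add_comm h g] at h2
  exact sub_mem h1 h2

/-! ### Vocabulary on Lie algebras -/

section Vocabulary

variable (L : Type) [LieRing L] [LieAlgebra ℂ L]

/-- The derived algebra `L' = [L, L]`. -/
abbrev derivedAlg : LieIdeal ℂ L := LieAlgebra.derivedSeries ℂ L 1

/-- `L` is nilpotent of index exactly `k`. -/
def IsStepNilpotent (k : ℕ) : Prop :=
  LieModule.lowerCentralSeries ℂ L L k = ⊥ ∧
    ∀ m < k, LieModule.lowerCentralSeries ℂ L L m ≠ ⊥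

/-- `L` is solvable of derived length exactly `k`. -/
def IsStepSolvable (k : ℕ) : Prop :=
  LieAlgebra.derivedSeries ℂ L k = ⊥ ∧ ∀ m < k, LieAlgebra.derivedSeries ℂ L m ≠ ⊥

/-- `L` is reductive: its radical is its center. -/
def IsReductive : Prop := LieAlgebra.radical ℂ L = LieAlgebra.center ℂ L

variable {L} in
/-- `S` is a Levi subalgebra: a subalgebra that complements the radical (so that
`S ≅ L / rad L` is semisimple). -/
def IsLevi (S : LieSubalgebra ℂ L) : Prop :=
  IsCompl S.toSubmodule (LieAlgebra.radical ℂ L).toSubmodule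

end Vocabulary

/-- The direct sum of `r` copies of `𝔰𝔩(2, ℂ)`. -/
abbrev sl2Sum (r : ℕ) : Type :=
  DirectSum (Fin r) fun _ => LieAlgebra.SpecialLinear.sl (Fin 2) ℂ

end OctGrading

end

open OctGrading

/-!
An element of `𝔡₄` or `𝔟₃` is a skew-symmetric `8 × 8` matrix (for `𝔟₃` with vanishing row and
column `0`), and the component of degree `g_i` consists of the matrices supported on the positions
`(a, b)` with `star a b = i`. There are `r` such pairs `{a, b}`, and the matrices `elem t a b`
multiply along paths: `⁅elem a b, elem b c⁆ = elem a c`. Hence `[·,·]^ε` is computed by the formula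
`cent_lie` for matrix entries, in which `ε` enters only through its values at the degrees of the two
steps of a path. Evaluating skew-symmetry and the Jacobi identity on paths of length two and three
gives `ε_ij = ε_ji` (`coef_comm`) and `ε_jk ε_(i,j*k) = ε_ij ε_(i*j,k)` for `k` off the line of `i`
and `j` (`coef_mul_coef`), so the support of `ε` is nice (`isNice_supp`).

The nice sets are classified up to collineation by a computation in the kernel on bit masks: a
search tree decides the 21 edges one after the other, closing the set under the defining rule, and
checks that each set found lies in one of the 24 orbits (`IsNice.exists_collinearSets`). That the
orbits are distinct is checked in the same way (`eq_of_collinearSets`).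

The bracket of two sums of components is the sum of the components with degrees in `step T S S'`,
a set that depends only on the support `T` (`toSubmodule_lie`). So all terms of the lower central
and derived series, and the center, are sums of components, each of dimension `r`, and the claims on
nilpotency, solvability, `L'` and the center become finite computations with the sets of the list.

For `T_6` and `T_23` the components off the line `{1, 2, 5}` form an abelian ideal of dimension
`4 r`. The components on this line are the sum of `r` commuting triples: `𝔰𝔬(4)` acting on the
coordinates of a coset of `{0, 1, 2, 5}` is a sum of two ideals `𝔰𝔬(3)`, and the only missing
coordinate, `0` in the case of `𝔟₃`, reduces one copy of `𝔰𝔬(4)` to `𝔰𝔬(3)`. After a rescaling each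
triple is an `𝔰𝔩(2)`-triple (`exists_isTripleFamily`), so the ideal is the radical and the triples
span a Levi subalgebra (`IsTripleFamily.radical_eq`). Any other complement of the radical is
isomorphic to this one by projection along the radical (`IsLevi.nonempty_equiv`). For `T_24`, four
brackets with suitable matrices `celem hε a b` reduce a nonzero element of an ideal to a multiple of
one such matrix, which generates everything (`isSimple_of_coef_ne_zero`).

A homogeneous `x` has a square that is diagonal in the basis `e_0, …, e_7`, and `x` vanishes on the
`e_b` with `x ^ 2 e_b = 0`; so `x` is semisimple, and `ad x` is the restriction of a difference of
commuting semisimple maps. Finally, the rank is the least dimension of an Engel subalgebra. The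
Engel subalgebra of `cartanElem t` is its centralizer, which lies in one component, so the rank is at
most `r`. Conversely, for generic `x` the odd powers `x, x ^ 3, …, x ^ (2 r - 1)` are linearly
independent elements of the centralizer of `x`, so the rank is at least `r` (`rank_eq`).
-/

noncomputable section

namespace OctGrading

section

/-! ### Collineations and products of sets of degrees -/

/-- The points `1, …, 7` of the Fano plane. -/
def points : Finset (Fin 8) := Finset.univ.erase 0

theorem mem_points {i : Fin 8} : i ∈ points ↔ i ≠ 0 := by simp [points]

theorem star_comm : ∀ i j : Fin 8, star i j = star j i := by decide

theorem star_assoc : ∀ i j k : Fin 8, star (star i j) k = star i (star j k) := by decide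

theorem star_self : ∀ i : Fin 8, star i i = 0 := by decide

theorem star_zero : ∀ i : Fin 8, star i 0 = i := by decide

theorem zero_star : ∀ i : Fin 8, star 0 i = i := by decide

theorem star_eq_zero : ∀ {i j : Fin 8}, star i j = 0 ↔ i = j := by decide

theorem star_star_cancel : ∀ i j : Fin 8, star i (star i j) = j := by decide

theorem IsCollineation.ne_zero {σ : Equiv.Perm (Fin 8)} (hσ : IsCollineation σ) {i : Fin 8} :
    σ i ≠ 0 ↔ i ≠ 0 := by
  rw [← hσ.1, Ne, σ.injective.eq_iff, hσ.1]

theorem IsCollineation.map_star {σ : Equiv.Perm (Fin 8)} (hσ : IsCollineation σ) (i j : Fin 8) :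
    σ (star i j) = star (σ i) (σ j) := by
  rcases eq_or_ne i 0 with rfl | hi
  · rw [zero_star, hσ.1, zero_star]
  rcases eq_or_ne j 0 with rfl | hj
  · rw [star_zero, hσ.1, star_zero]
  rcases eq_or_ne i j with rfl | hij
  · rw [star_self, star_self, hσ.1]
  · exact hσ.2 i j hi hj hij

theorem IsCollineation.symm {σ : Equiv.Perm (Fin 8)} (hσ : IsCollineation σ) :
    IsCollineation σ.symm := by
  refine ⟨by rw [Equiv.symm_apply_eq, hσ.1], fun i j _ _ _ => ?_⟩
  rw [Equiv.symm_apply_eq, hσ.map_star, Equiv.apply_symm_apply, Equiv.apply_symm_apply]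

theorem IsCollineation.trans {σ τ : Equiv.Perm (Fin 8)} (hσ : IsCollineation σ)
    (hτ : IsCollineation τ) : IsCollineation (σ.trans τ) := by
  refine ⟨by simp [hσ.1, hτ.1], fun i j _ _ _ => ?_⟩
  simp [hσ.map_star, hτ.map_star]

theorem IsCollineation.image_points {σ : Equiv.Perm (Fin 8)} (hσ : IsCollineation σ) :
    points.image σ = points := by
  ext i
  simp only [Finset.mem_image, mem_points]
  exact ⟨fun ⟨j, hj, e⟩ => e ▸ hσ.ne_zero.2 hj,
    fun hi => ⟨σ.symm i, hσ.symm.ne_zero.2 hi, σ.apply_symm_apply i⟩⟩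

theorem image_map_symm (σ : Equiv.Perm (Fin 8)) (T : Set (Sym2 (Fin 8))) :
    Sym2.map σ.symm '' (Sym2.map σ '' T) = T := by
  rw [← Set.image_comp, ← Sym2.map_comp]
  simp

theorem mk_mem_image (σ : Equiv.Perm (Fin 8)) (T : Finset (Sym2 (Fin 8))) (i j : Fin 8) :
    s(σ i, σ j) ∈ T.image (Sym2.map σ) ↔ s(i, j) ∈ T := by
  rw [← Sym2.map_mk]
  exact (Sym2.map.injective σ.injective).mem_finset_image

theorem CollinearSets.exists_image {T : Set (Sym2 (Fin 8))} {N : Finset (Sym2 (Fin 8))}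
    (h : CollinearSets T N) :
    ∃ τ : Equiv.Perm (Fin 8), IsCollineation τ ∧ T = (N.image (Sym2.map τ) : Finset _) := by
  obtain ⟨σ, hσ, e⟩ := h
  refine ⟨σ.symm, hσ.symm, ?_⟩
  rw [Finset.coe_image, ← e, image_map_symm]

/-- The degrees `i * j` with `i ∈ S`, `j ∈ S'` and `{i, j} ∈ T`. For a graded contraction with
support `T`, these are the degrees that occur in the bracket of the sums of the components with
degrees in `S` and in `S'`. -/
def step (T : Finset (Sym2 (Fin 8))) (S S' : Finset (Fin 8)) : Finset (Fin 8) :=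
  ((S ×ˢ S').filter fun p => s(p.1, p.2) ∈ T).image fun p => star p.1 p.2

theorem mem_step {T : Finset (Sym2 (Fin 8))} {S S' : Finset (Fin 8)} {k : Fin 8} :
    k ∈ step T S S' ↔ ∃ i ∈ S, ∃ j ∈ S', s(i, j) ∈ T ∧ star i j = k := by
  simp only [step, Finset.mem_image, Finset.mem_filter, Finset.mem_product, Prod.exists]
  constructor
  · rintro ⟨i, j, ⟨⟨hi, hj⟩, h⟩, e⟩
    exact ⟨i, hi, j, hj, h, e⟩
  · rintro ⟨i, hi, j, hj, h, e⟩
    exact ⟨i, j, ⟨⟨hi, hj⟩, h⟩, e⟩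

/-- The points that lie on no edge of `T`. -/
def isolated (T : Finset (Sym2 (Fin 8))) : Finset (Fin 8) :=
  points.filter fun i => ∀ j, s(i, j) ∉ T

/-- The degrees that occur in the `m`-th term of the lower central series. -/
def lowerSet (T : Finset (Sym2 (Fin 8))) : ℕ → Finset (Fin 8)
  | 0 => points
  | m + 1 => step T points (lowerSet T m)

/-- The degrees that occur in the `m`-th term of the derived series. -/
def derivedSet (T : Finset (Sym2 (Fin 8))) : ℕ → Finset (Fin 8)
  | 0 => points
  | m + 1 => step T (derivedSet T m) (derivedSet T m)

section Image

variable {τ : Equiv.Perm (Fin 8)} (hτ : IsCollineation τ) (T : Finset (Sym2 (Fin 8)))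
include hτ

theorem IsCollineation.step_image (S S' : Finset (Fin 8)) :
    step (T.image (Sym2.map τ)) (S.image τ) (S'.image τ) = (step T S S').image τ := by
  ext k
  simp only [mem_step, Finset.mem_image]
  constructor
  · rintro ⟨_, ⟨i, hi, rfl⟩, _, ⟨j, hj, rfl⟩, h, rfl⟩
    rw [← Finset.mem_image, mk_mem_image] at h
    exact ⟨star i j, ⟨i, hi, j, hj, h, rfl⟩, hτ.map_star i j⟩
  · rintro ⟨_, ⟨i, hi, j, hj, h, rfl⟩, rfl⟩
    refine ⟨τ i, ⟨i, hi, rfl⟩, τ j, ⟨j, hj, rfl⟩, ?_, (hτ.map_star i j).symm⟩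
    rwa [← Finset.mem_image, mk_mem_image]

theorem IsCollineation.isolated_image :
    isolated (T.image (Sym2.map τ)) = (isolated T).image τ := by
  ext k
  obtain ⟨i, rfl⟩ := τ.surjective k
  rw [τ.injective.mem_finset_image]
  simp only [isolated, Finset.mem_filter, mem_points, hτ.ne_zero,
    ← τ.forall_congr_right (q := fun j => s(τ i, j) ∉ _), mk_mem_image]

theorem IsCollineation.lowerSet_image (m : ℕ) :
    lowerSet (T.image (Sym2.map τ)) m = (lowerSet T m).image τ := by
  induction m with
  | zero => exact hτ.image_points.symm
  | succ m ih =>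
    have e := hτ.step_image T points (lowerSet T m)
    rw [hτ.image_points, ← ih] at e
    exact e

theorem IsCollineation.derivedSet_image (m : ℕ) :
    derivedSet (T.image (Sym2.map τ)) m = (derivedSet T m).image τ := by
  induction m with
  | zero => exact hτ.image_points.symm
  | succ m ih =>
    have e := hτ.step_image T (derivedSet T m) (derivedSet T m)
    rw [← ih] at e
    exact e

end Image

theorem zero_notMem_step {T : Finset (Sym2 (Fin 8))} (hT : T ⊆ X) (S S' : Finset (Fin 8)) :
    0 ∉ step T S S' := by
  rw [mem_step]
  rintro ⟨i, _, j, _, h, e⟩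
  have := hT h
  rw [star_eq_zero] at e
  subst e
  simp [X] at this

theorem niceSet_subset : ∀ n ∈ Finset.Icc 1 24, niceSet n ⊆ X := by decide +kernel

theorem isNice_niceSet : ∀ n ∈ Finset.Icc 1 24, IsNice (niceSet n : Set (Sym2 (Fin 8))) := by
  have key : ∀ n ∈ Finset.Icc 1 24, ∀ i j k : Fin 8, i ≠ 0 → j ≠ 0 → k ≠ 0 → i ≠ j → k ∉ line i j →
      s(i, j) ∈ niceSet n → s(star i j, k) ∈ niceSet n → P i j k ⊆ niceSet n := by decide +kernel
  intro n hn
  refine ⟨Finset.coe_subset.2 (niceSet_subset n hn), fun i j k hi hj hk hij hl h1 h2 => ?_⟩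
  exact Finset.coe_subset.2 (key n hn i j k hi hj hk hij hl h1 h2)

end

section

/-! ### The classification of nice sets -/

/-- A kernel-friendly evaluation device: `force m f = f m`, but reducing the left-hand side
evaluates `m` to a numeral before it is substituted. -/
def force {α : Type} (m : ℕ) (f : ℕ → α) : α := Nat.rec (f 0) (fun n _ => f (n + 1)) m

@[simp]
theorem force_eq {α : Type} (m : ℕ) (f : ℕ → α) : force m f = f m := by
  cases m <;> rfl

/-- The values of `star`, read off from a number whose octal digit number `8 * i + j` is
`star i j`. -/
def starCode (i j : ℕ) : ℕ :=
  (565960644981575248033125594037721904444733896121407686280 >>> (24 * i + 3 * j)) % 8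

theorem starCode_eq : ∀ i j : Fin 8, starCode i j = (star i j).val := by decide +kernel

/-- The bit mask of the edge `{i, j}`: the bits number `8 * i + j` and `8 * j + i`. -/
def edgeBit (i j : ℕ) : ℕ := 2 ^ (8 * i + j) ||| 2 ^ (8 * j + i)

/-- The number `m` is the bit mask of the set of edges `T`. -/
def IsMask (m : ℕ) (T : Set (Sym2 (Fin 8))) : Prop :=
  ∀ n, m.testBit n = true ↔ ∃ i j : Fin 8, n = 8 * i + j ∧ s(i, j) ∈ T

theorem IsMask.testBit {m : ℕ} {T : Set (Sym2 (Fin 8))} (h : IsMask m T) (i j : Fin 8) :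
    m.testBit (8 * i + j) = true ↔ s(i, j) ∈ T := by
  rw [h]
  constructor
  · rintro ⟨i', j', e, hT⟩
    obtain ⟨rfl, rfl⟩ : i = i' ∧ j = j' := by omega
    exact hT
  · exact fun hT => ⟨i, j, rfl, hT⟩

theorem IsMask.edge (a b : Fin 8) : IsMask (edgeBit a b) {s(a, b)} := by
  intro n
  simp only [edgeBit, Nat.testBit_or, Nat.testBit_two_pow, Bool.or_eq_true, decide_eq_true_eq,
    Set.mem_singleton_iff, Sym2.eq_iff]
  constructor
  · rintro (rfl | rfl)
    · exact ⟨a, b, rfl, Or.inl ⟨rfl, rfl⟩⟩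
    · exact ⟨b, a, rfl, Or.inr ⟨rfl, rfl⟩⟩
  · rintro ⟨i, j, rfl, ⟨rfl, rfl⟩ | ⟨rfl, rfl⟩⟩
    · exact Or.inl rfl
    · exact Or.inr rfl

theorem IsMask.union {m n : ℕ} {S T : Set (Sym2 (Fin 8))} (hm : IsMask m S) (hn : IsMask n T) :
    IsMask (m ||| n) (S ∪ T) := by
  intro k
  rw [Nat.testBit_or, Bool.or_eq_true, hm, hn, ← exists_or]
  simp only [← exists_or, ← and_or_left, Set.mem_union]

theorem IsMask.eq {m : ℕ} {S T : Set (Sym2 (Fin 8))} (hS : IsMask m S) (hT : IsMask m T) :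
    S = T := by
  ext e
  induction e with
  | _ i j => rw [← hS.testBit, hT.testBit]

theorem IsMask.unique {m n : ℕ} {T : Set (Sym2 (Fin 8))} (hm : IsMask m T) (hn : IsMask n T) :
    m = n :=
  Nat.eq_of_testBit_eq fun k => Bool.eq_iff_iff.2 ((hm k).trans (hn k).symm)

/-- All edges `{i, j}`, as pairs with `i < j`. -/
def edgePairs : List (ℕ × ℕ) :=
  [1, 2, 3, 4, 5, 6].flatMap fun i => ([2, 3, 4, 5, 6, 7].filter (Nat.blt i)).map fun j => (i, j)

theorem mem_edgePairs : ∀ i j : Fin 8, s(i, j) ∈ X → i < j → (i.val, j.val) ∈ edgePairs := by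
  decide +kernel

theorem lt_of_mem_edgePairs : ∀ p ∈ edgePairs, p.1 < 8 ∧ p.2 < 8 := by decide +kernel

/-- The edges in `niceSet n`. -/
def niceList (n : ℕ) : List (ℕ × ℕ) :=
  edgePairs.filter fun p => s((Fin.ofNat 8 p.1), Fin.ofNat 8 p.2) ∈ niceSet n

/-- The triple `(a, b, c)` is a basis of `ℤ₂³`, for points `a`, `b`, `c`. -/
def frameTest (a b c : ℕ) : Bool :=
  !(a.beq b || c.beq a || c.beq b || c.beq (starCode a b))

/-- The bases of `ℤ₂³`; they correspond to the collineations. -/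
def frames : List (ℕ × ℕ × ℕ) :=
  ([1, 2, 3, 4, 5, 6, 7] ×ˢ [1, 2, 3, 4, 5, 6, 7] ×ˢ [1, 2, 3, 4, 5, 6, 7]).filter fun p =>
    frameTest p.1 p.2.1 p.2.2

/-- The map with `1 ↦ a`, `2 ↦ b`, `3 ↦ c` that is compatible with `star`. -/
def frameMap (a b c : Fin 8) : Fin 8 → Fin 8 :=
  ![0, a, b, c, star (star a b) c, star a b, star a c, star b c]

theorem beq_eq_false {m n : ℕ} : m.beq n = false ↔ m ≠ n := by
  rw [← Bool.not_eq_true, Nat.beq_eq]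

theorem mem_frames {p : ℕ × ℕ × ℕ} : p ∈ frames ↔ ∃ a b c : Fin 8,
    p = (a.val, b.val, c.val) ∧ a ≠ 0 ∧ b ≠ 0 ∧ c ≠ 0 ∧ a ≠ b ∧ c ≠ a ∧ c ≠ b ∧ c ≠ star a b := by
  have hm : ∀ x : ℕ, x ∈ [1, 2, 3, 4, 5, 6, 7] ↔ ∃ a : Fin 8, a ≠ 0 ∧ x = a.val := by
    intro x
    constructor
    · intro h
      have h8 : x < 8 ∧ x ≠ 0 := by
        simp only [List.mem_cons, List.not_mem_nil, or_false] at h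
        omega
      exact ⟨⟨x, h8.1⟩, fun e => h8.2 (congrArg Fin.val e), rfl⟩
    · rintro ⟨a, ha, rfl⟩
      revert a
      decide
  obtain ⟨x, y, z⟩ := p
  simp only [frames, List.mem_filter, List.mem_product, hm, frameTest, Prod.mk.injEq]
  constructor
  · rintro ⟨⟨⟨a, ha, rfl⟩, ⟨b, hb, rfl⟩, ⟨c, hc, rfl⟩⟩, h⟩
    simp only [starCode_eq, Bool.not_eq_true', Bool.or_eq_false_iff, beq_eq_false, ne_eq,
      Fin.val_inj] at h
    exact ⟨a, b, c, ⟨rfl, rfl, rfl⟩, ha, hb, hc, h.1.1.1, h.1.1.2, h.1.2, h.2⟩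
  · rintro ⟨a, b, c, ⟨rfl, rfl, rfl⟩, ha, hb, hc, h1, h2, h3, h4⟩
    refine ⟨⟨⟨a, ha, rfl⟩, ⟨b, hb, rfl⟩, ⟨c, hc, rfl⟩⟩, ?_⟩
    simp only [starCode_eq, Bool.not_eq_true', Bool.or_eq_false_iff, beq_eq_false, ne_eq,
      Fin.val_inj]
    exact ⟨⟨⟨h1, h2⟩, h3⟩, h4⟩

/-- The map `frameMap a b c`, as a list of octal digits. -/
def frameCode (a b c : ℕ) : ℕ :=
  8 * (a + 8 * (b + 8 * (c + 8 * (starCode (starCode a b) c +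
    8 * (starCode a b + 8 * (starCode a c + 8 * starCode b c))))))

/-- The value at `i` of a map given by octal digits. -/
def digit (F i : ℕ) : ℕ := (F >>> (3 * i)) % 8

theorem digit_frameCode (a b c i : Fin 8) :
    digit (frameCode a b c) i = (frameMap a b c i).val := by
  have h1 := starCode_eq a b
  rw [digit, frameCode, h1, starCode_eq, starCode_eq, starCode_eq, Nat.shiftRight_eq_div_pow]
  have h4 := (star (star a b) c).isLt
  have h5 := (star a b).isLt
  have h6 := (star a c).isLt
  have h7 := (star b c).isLt
  have ha := a.isLt
  have hb := b.isLt
  have hc := c.isLt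
  fin_cases i <;> simp [frameMap] <;> omega

/-- The bit mask of the image of a list of edges. -/
def encode (F : ℕ) : List (ℕ × ℕ) → ℕ
  | [] => 0
  | p :: l => edgeBit (digit F p.1) (digit F p.2) ||| encode F l

theorem isMask_encode (a b c : Fin 8) (l : List (ℕ × ℕ)) (hl : ∀ p ∈ l, p.1 < 8 ∧ p.2 < 8) :
    IsMask (encode (frameCode a b c) l)
      {e | ∃ i j : Fin 8, (i.val, j.val) ∈ l ∧ e = s(frameMap a b c i, frameMap a b c j)} := by
  induction l with
  | nil => intro n; simp [encode]
  | cons p l ih =>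
    obtain ⟨x, y⟩ := p
    obtain ⟨hx, hy⟩ := hl (x, y) (by simp)
    have h1 := IsMask.edge (frameMap a b c ⟨x, hx⟩) (frameMap a b c ⟨y, hy⟩)
    rw [← digit_frameCode, ← digit_frameCode] at h1
    have h2 := h1.union (ih fun p hp => hl p (by simp [hp]))
    refine (congrArg (IsMask _) (Set.ext fun e => ?_)).mpr h2
    simp only [Set.mem_ofPred_eq, Set.mem_union, Set.mem_singleton_iff, List.mem_cons,
      Prod.mk.injEq]
    constructor
    · rintro ⟨i, j, ⟨rfl, rfl⟩ | h, rfl⟩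
      · exact Or.inl rfl
      · exact Or.inr ⟨i, j, h, rfl⟩
    · rintro (rfl | ⟨i, j, h, rfl⟩)
      · exact ⟨_, _, Or.inl ⟨rfl, rfl⟩, rfl⟩
      · exact ⟨i, j, Or.inr h, rfl⟩

theorem isMask_encode_niceList {n : ℕ} (hn : n ∈ Finset.Icc 1 24) (a b c : Fin 8) :
    IsMask (encode (frameCode a b c) (niceList n))
      (Sym2.map (frameMap a b c) '' (niceSet n : Set (Sym2 (Fin 8)))) := by
  refine (congrArg (IsMask _) (Set.ext fun e => ?_)).mpr (isMask_encode a b c (niceList n)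
    (fun p hp => lt_of_mem_edgePairs p (List.mem_filter.1 hp).1))
  simp only [Set.mem_image, Set.mem_ofPred_eq, niceList, List.mem_filter, decide_eq_true_eq]
  constructor
  · rintro ⟨e, he, rfl⟩
    induction e with
    | _ i j =>
      have hX := niceSet_subset n hn he
      rcases lt_trichotomy i j with h | h | h
      · exact ⟨i, j, ⟨mem_edgePairs i j hX h, by simpa using he⟩, rfl⟩
      · simp [X, h] at hX
      · rw [Finset.mem_coe, Sym2.eq_swap] at he
        rw [Sym2.eq_swap] at hX
        exact ⟨j, i, ⟨mem_edgePairs j i hX h, by simpa using he⟩, by simp [Sym2.eq_swap]⟩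
  · rintro ⟨i, j, ⟨_, h⟩, rfl⟩
    exact ⟨s(i, j), by simpa using h, rfl⟩

theorem frameMap_spec : ∀ a b c : Fin 8, a ≠ 0 → b ≠ 0 → c ≠ 0 → a ≠ b → c ≠ a → c ≠ b →
    c ≠ star a b → Function.Injective (frameMap a b c) ∧
      ∀ i j, frameMap a b c (star i j) = star (frameMap a b c i) (frameMap a b c j) := by
  decide +kernel

theorem exists_collineation {a b c : Fin 8} (h : (a.val, b.val, c.val) ∈ frames) :
    ∃ σ : Equiv.Perm (Fin 8), IsCollineation σ ∧ ⇑σ = frameMap a b c := by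
  obtain ⟨a', b', c', e, ha, hb, hc, h1, h2, h3, h4⟩ := mem_frames.1 h
  simp only [Prod.mk.injEq, Fin.val_inj] at e
  obtain ⟨rfl, rfl, rfl⟩ := e
  obtain ⟨hi, hs⟩ := frameMap_spec a b c ha hb hc h1 h2 h3 h4
  exact ⟨Equiv.ofBijective _ (Finite.injective_iff_bijective.1 hi), ⟨rfl, fun i j _ _ _ => hs i j⟩,
    rfl⟩

theorem IsCollineation.exists_frame {σ : Equiv.Perm (Fin 8)} (hσ : IsCollineation σ) :
    ((σ 1).val, (σ 2).val, (σ 3).val) ∈ frames ∧ ⇑σ = frameMap (σ 1) (σ 2) (σ 3) := by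
  constructor
  · refine mem_frames.2 ⟨σ 1, σ 2, σ 3, rfl, ?_⟩
    rw [← hσ.map_star, hσ.ne_zero, hσ.ne_zero, hσ.ne_zero]
    simp only [ne_eq, σ.injective.eq_iff]
    decide
  · have h := hσ.map_star
    funext i
    fin_cases i
    · exact hσ.1
    · rfl
    · rfl
    · rfl
    · exact (h (star 1 2) 3).trans (congrArg (star · (σ 3)) (h 1 2))
    · exact h 1 2
    · exact h 1 3
    · exact h 2 3

/-! ### The members of the list are pairwise not collinear -/

/-- No image of the set number `n` under a collineation is the set number `m`. -/
def distinct (n m : ℕ) : Bool :=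
  bif (niceSet n).card.beq (niceSet m).card then
    force (encode (frameCode 1 2 3) (niceList m)) fun x =>
      frames.all fun p => force (frameCode p.1 p.2.1 p.2.2) fun F =>
        !(encode F (niceList n)).beq x
  else true

set_option maxRecDepth 100000 in
theorem distinct_of_lt : ∀ n ∈ Finset.Icc 1 24, ∀ m ∈ Finset.Icc 1 24, n < m →
    distinct n m = true := by
  decide +kernel

theorem eq_of_collinearSets {n m : ℕ} (hn : n ∈ Finset.Icc 1 24) (hm : m ∈ Finset.Icc 1 24)
    (h : CollinearSets (niceSet n) (niceSet m)) : n = m := by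
  have key : ∀ n ∈ Finset.Icc 1 24, ∀ m ∈ Finset.Icc 1 24, n < m →
      ¬ CollinearSets (niceSet n) (niceSet m) := by
    rintro n hn m hm hlt ⟨σ, hσ, e⟩
    have hd := distinct_of_lt n hn m hm hlt
    obtain ⟨hf, hσ'⟩ := hσ.exists_frame
    have h1 := isMask_encode_niceList hn (σ 1) (σ 2) (σ 3)
    rw [← hσ', e] at h1
    have h2 := isMask_encode_niceList hm 1 2 3
    have hid : frameMap 1 2 3 = id := by decide
    rw [hid, Sym2.map_id, Set.image_id] at h2
    have e1 := h1.unique h2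
    have hcard : (niceSet n).card.beq (niceSet m).card = true := by
      rw [← Finset.coe_image, Finset.coe_inj] at e
      rw [Nat.beq_eq, ← e, Finset.card_image_of_injective _ (Sym2.map.injective σ.injective)]
    rw [distinct, hcard, cond_true, force_eq, List.all_eq_true] at hd
    have := hd _ hf
    rw [force_eq, Bool.not_eq_true', beq_eq_false] at this
    exact this e1
  rcases lt_trichotomy n m with hlt | h0 | hlt
  · exact absurd h (key n hn m hm hlt)
  · exact h0
  · obtain ⟨σ, hσ, e⟩ := h
    exact absurd ⟨σ.symm, hσ.symm, by rw [← e, image_map_symm]⟩ (key m hm n hn hlt)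

end

section

/-! ### Every nice set is collinear to a member of the list -/

/-- Membership in a list of numbers. -/
def contains (x : ℕ) : List ℕ → Bool
  | [] => false
  | y :: l => bif x.beq y then true else contains x l

theorem mem_of_contains {x : ℕ} {l : List ℕ} (h : contains x l = true) : x ∈ l := by
  induction l with
  | nil => exact absurd h (by simp [contains])
  | cons y l ih =>
    rw [contains] at h
    cases hb : x.beq y with
    | true => exact Nat.beq_eq.mp hb ▸ List.mem_cons_self
    | false => rw [hb] at h; exact List.mem_cons_of_mem _ (ih h)

/-- Pass to `k` the masks of the images of the list of edges `l`, without repetitions. -/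
def orbit {α : Type} (l : List (ℕ × ℕ)) (k : List ℕ → α) : List (ℕ × ℕ × ℕ) → List ℕ → α
  | [], acc => k acc
  | p :: ps, acc => force (frameCode p.1 p.2.1 p.2.2) fun F => force (encode F l) fun x =>
      bif contains x acc then orbit l k ps acc else orbit l k ps (x :: acc)

theorem orbit_spec {α : Type} (l : List (ℕ × ℕ)) (k : List ℕ → α) (ps : List (ℕ × ℕ × ℕ))
    (acc : List ℕ) : ∃ o, orbit l k ps acc = k o ∧
      ∀ x ∈ o, x ∈ acc ∨ ∃ p ∈ ps, x = encode (frameCode p.1 p.2.1 p.2.2) l := by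
  induction ps generalizing acc with
  | nil => exact ⟨acc, rfl, fun x => Or.inl⟩
  | cons p ps ih =>
    rw [orbit, force_eq, force_eq]
    cases contains (encode (frameCode p.1 p.2.1 p.2.2) l) acc with
    | true =>
      obtain ⟨o, ho, h⟩ := ih acc
      refine ⟨o, ho, fun x hx => (h x hx).imp_right ?_⟩
      rintro ⟨q, hq, e⟩
      exact ⟨q, List.mem_cons_of_mem _ hq, e⟩
    | false =>
      obtain ⟨o, ho, h⟩ := ih (encode (frameCode p.1 p.2.1 p.2.2) l :: acc)
      refine ⟨o, ho, fun x hx => ?_⟩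
      rcases h x hx with hx | ⟨q, hq, e⟩
      · rcases List.mem_cons.1 hx with e | hx
        · exact Or.inr ⟨p, List.mem_cons_self, e⟩
        · exact Or.inl hx
      · exact Or.inr ⟨q, List.mem_cons_of_mem _ hq, e⟩

/-- Pass to `k` the orbits of the sets `niceSet n`, each with the number of its edges. -/
def orbits {α : Type} (k : List (ℕ × List ℕ) → α) : List ℕ → List (ℕ × List ℕ) → α
  | [], acc => k acc
  | n :: ns, acc => force (niceList n).length fun c =>
      orbit (niceList n) (fun o => orbits k ns ((c, o) :: acc)) frames []

theorem orbits_spec {α : Type} (k : List (ℕ × List ℕ) → α) (ns : List ℕ)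
    (acc : List (ℕ × List ℕ)) : ∃ t, orbits k ns acc = k t ∧
      ∀ o ∈ t, o ∈ acc ∨ ∃ n ∈ ns, ∀ x ∈ o.2, ∃ p ∈ frames,
        x = encode (frameCode p.1 p.2.1 p.2.2) (niceList n) := by
  induction ns generalizing acc with
  | nil => exact ⟨acc, rfl, fun x => Or.inl⟩
  | cons n ns ih =>
    rw [orbits, force_eq]
    obtain ⟨o, ho, h⟩ := orbit_spec (niceList n)
      (fun o => orbits k ns (((niceList n).length, o) :: acc)) frames []
    obtain ⟨t, ht, h'⟩ := ih (((niceList n).length, o) :: acc)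
    refine ⟨t, ho.trans ht, fun q hq => ?_⟩
    rcases h' q hq with hq | ⟨m, hm, e⟩
    · rcases List.mem_cons.1 hq with rfl | hq
      · exact Or.inr ⟨n, List.mem_cons_self, fun x hx => (h x hx).resolve_left (by simp)⟩
      · exact Or.inl hq
    · exact Or.inr ⟨m, List.mem_cons_of_mem _ hm, e⟩

/-- The mask of the pair of edges `{a, b}`, `{a * b, c}`. -/
def pairMask (a b c : ℕ) : ℕ := edgeBit a b ||| edgeBit (starCode a b) c

/-- The three pairs of edges into which each set `P a b c` splits. A set is nice if it contains
all three pairs as soon as it contains one of them. -/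
def rules : List (ℕ × ℕ × ℕ) :=
  (frames.filter fun p => p.1.blt p.2.1 && p.2.1.blt p.2.2).map fun p =>
    (pairMask p.1 p.2.1 p.2.2, pairMask p.2.1 p.2.2 p.1, pairMask p.2.2 p.1 p.2.1)

/-- All bits of `a` are bits of `m`. -/
def sub (a m : ℕ) : Bool := (m &&& a).beq a

theorem testBit_of_sub {a m : ℕ} (h : sub a m = true) {n : ℕ} (hn : a.testBit n = true) :
    m.testBit n = true := by
  rw [← Nat.beq_eq.mp h, Nat.testBit_and, Bool.and_eq_true] at hn
  exact hn.1

/-- Enlarge `m` as prescribed by the rules. -/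
def applyRules : List (ℕ × ℕ × ℕ) → ℕ → ℕ
  | [], m => m
  | (a, b, c) :: l, m =>
    bif sub a m || sub b m || sub c m then
      force (a ||| b ||| c ||| m) fun m => applyRules l m
    else applyRules l m

/-- Apply the rules until nothing changes, but at most `n` times. -/
def saturate (rules : List (ℕ × ℕ × ℕ)) : ℕ → ℕ → ℕ
  | 0, m => m
  | n + 1, m => force (applyRules rules m) fun m' => bif m'.beq m then m else saturate rules n m'

/-- The bits of the mask `m` belong to the set `T`. -/
def MaskLE (m : ℕ) (T : Set (Sym2 (Fin 8))) : Prop :=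
  ∀ n, m.testBit n = true → ∃ i j : Fin 8, n = 8 * i + j ∧ s(i, j) ∈ T

theorem MaskLE.or {a m : ℕ} {T : Set (Sym2 (Fin 8))} (ha : MaskLE a T) (hm : MaskLE m T) :
    MaskLE (a ||| m) T := by
  intro n hn
  rw [Nat.testBit_or, Bool.or_eq_true] at hn
  exact hn.elim (ha n) (hm n)

theorem MaskLE.of_sub {a m : ℕ} {T : Set (Sym2 (Fin 8))} (hm : MaskLE m T)
    (h : sub a m = true) : MaskLE a T :=
  fun _ hn => hm _ (testBit_of_sub h hn)

/-- The rules hold in `T`. -/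
def RulesHold (rules : List (ℕ × ℕ × ℕ)) (T : Set (Sym2 (Fin 8))) : Prop :=
  ∀ r ∈ rules, MaskLE r.1 T ∨ MaskLE r.2.1 T ∨ MaskLE r.2.2 T →
    MaskLE r.1 T ∧ MaskLE r.2.1 T ∧ MaskLE r.2.2 T

theorem maskLE_applyRules {T : Set (Sym2 (Fin 8))} {rules : List (ℕ × ℕ × ℕ)} {m : ℕ}
    (hr : RulesHold rules T) (hm : MaskLE m T) :
    MaskLE (applyRules rules m) T ∧
      ∀ n, m.testBit n = true → (applyRules rules m).testBit n = true := by
  induction rules generalizing m with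
  | nil => exact ⟨hm, fun n => id⟩
  | cons r l ih =>
    obtain ⟨a, b, c⟩ := r
    have hl : RulesHold l T := fun r h => hr r (List.mem_cons_of_mem _ h)
    rw [applyRules, force_eq]
    cases h : sub a m || sub b m || sub c m with
    | false => exact ih hl hm
    | true =>
      have hall := hr (a, b, c) List.mem_cons_self (by
        rw [Bool.or_eq_true, Bool.or_eq_true] at h
        rcases h with (h | h) | h
        · exact Or.inl (hm.of_sub h)
        · exact Or.inr (Or.inl (hm.of_sub h))
        · exact Or.inr (Or.inr (hm.of_sub h)))
      obtain ⟨h1, h2⟩ := ih hl (((hall.1.or hall.2.1).or hall.2.2).or hm)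
      refine ⟨h1, fun n hn => h2 n ?_⟩
      rw [Nat.testBit_or, hn, Bool.or_true]

theorem maskLE_saturate {T : Set (Sym2 (Fin 8))} {rules : List (ℕ × ℕ × ℕ)}
    (hr : RulesHold rules T) (k : ℕ) {m : ℕ} (hm : MaskLE m T) :
    MaskLE (saturate rules k m) T ∧
      ∀ n, m.testBit n = true → (saturate rules k m).testBit n = true := by
  induction k generalizing m with
  | zero => exact ⟨hm, fun n => id⟩
  | succ k ih =>
    rw [saturate, force_eq]
    cases (applyRules rules m).beq m with
    | true => exact ⟨hm, fun n => id⟩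
    | false =>
      obtain ⟨h1, h2⟩ := maskLE_applyRules hr hm
      obtain ⟨h3, h4⟩ := ih h1
      exact ⟨h3, fun n hn => h4 n (h2 n hn)⟩

/-- The number of edges in `m`. -/
def size (m : ℕ) : List ℕ → ℕ
  | [] => 0
  | e :: es => bif sub e m then size m es + 1 else size m es

/-- Look for the mask `m` with `c` edges in the table of orbits. -/
def lookup (m c : ℕ) : List (ℕ × List ℕ) → Bool
  | [] => false
  | o :: os => bif c.beq o.1 && contains m o.2 then true else lookup m c os

theorem exists_of_lookup {m c : ℕ} {t : List (ℕ × List ℕ)} (h : lookup m c t = true) :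
    ∃ o ∈ t, m ∈ o.2 := by
  induction t with
  | nil => exact absurd h (by simp [lookup])
  | cons o os ih =>
    rw [lookup] at h
    cases hb : c.beq o.1 && contains m o.2 with
    | true => exact ⟨o, List.mem_cons_self, mem_of_contains (Bool.and_eq_true_iff.1 hb).2⟩
    | false =>
      rw [hb] at h
      obtain ⟨q, hq, hm⟩ := ih h
      exact ⟨q, List.mem_cons_of_mem _ hq, hm⟩

/-- Decide the edges one after the other, where `inn` holds the edges that belong to the set and
`out` those that do not, and check that every nice set found in this way is in the table. The number of rounds of `saturate`
only affects the size of the search tree, not the correctness of the answer. -/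
def search (rules : List (ℕ × ℕ × ℕ)) (table : List (ℕ × List ℕ)) (edges : List ℕ) :
    List ℕ → ℕ → ℕ → Bool
  | [], inn, _ => force (size inn edges) fun c => lookup inn c table
  | e :: es, inn, out =>
    bif sub e inn then search rules table edges es inn out else
      (force (e ||| out) fun out => search rules table edges es inn out) &&
      (force (saturate rules 5 (e ||| inn)) fun inn =>
        bif (inn &&& out).beq 0 then search rules table edges es inn out else true)

theorem search_spec {rules : List (ℕ × ℕ × ℕ)} {table : List (ℕ × List ℕ)} {edges : List ℕ}
    {T : Set (Sym2 (Fin 8))} (hT : T ⊆ X) (hr : RulesHold rules T) (es : List ℕ) (inn out : ℕ)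
    (hes : ∀ e ∈ es, ∃ a b : Fin 8, e = edgeBit a b) (hinn : MaskLE inn T)
    (hout : ∀ i j : Fin 8, out.testBit (8 * i + j) = true → s(i, j) ∉ T)
    (hdec : ∀ i j : Fin 8, s(i, j) ∈ X → inn.testBit (8 * i + j) = true ∨
      out.testBit (8 * i + j) = true ∨ edgeBit i j ∈ es)
    (h : search rules table edges es inn out = true) : ∃ o ∈ table, ∃ m ∈ o.2, IsMask m T := by
  induction es generalizing inn out with
  | nil =>
    rw [search, force_eq] at h
    obtain ⟨o, ho, hm⟩ := exists_of_lookup h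
    refine ⟨o, ho, inn, hm, fun n => ⟨hinn n, ?_⟩⟩
    rintro ⟨i, j, rfl, hij⟩
    rcases hdec i j (hT hij) with h | h | h
    · exact h
    · exact absurd hij (hout i j h)
    · exact absurd h List.not_mem_nil
  | cons e es ih =>
    have hes' : ∀ e ∈ es, ∃ a b : Fin 8, e = edgeBit a b :=
      fun x hx => hes x (List.mem_cons_of_mem _ hx)
    obtain ⟨a, b, rfl⟩ := hes e List.mem_cons_self
    have hself : ∀ i j : Fin 8, edgeBit i j = edgeBit a b →
        (edgeBit a b).testBit (8 * i + j) = true := by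
      intro i j e
      rw [← e, (IsMask.edge i j).testBit]
      rfl
    rw [search, force_eq, force_eq] at h
    cases hsub : sub (edgeBit a b) inn with
    | true =>
      rw [hsub] at h
      refine ih inn out hes' hinn hout (fun i j hij => ?_) h
      rcases hdec i j hij with h | h | h
      · exact Or.inl h
      · exact Or.inr (Or.inl h)
      · rcases List.mem_cons.1 h with h | h
        · exact Or.inl (testBit_of_sub hsub (hself i j h))
        · exact Or.inr (Or.inr h)
    | false =>
      rw [hsub, cond_false, Bool.and_eq_true] at h
      by_cases hab : s(a, b) ∈ T
      · have hle : MaskLE (edgeBit a b ||| inn) T := by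
          refine MaskLE.or (fun n hn => ?_) hinn
          obtain ⟨i, j, e, hij⟩ := (IsMask.edge a b n).1 hn
          exact ⟨i, j, e, hij ▸ hab⟩
        obtain ⟨h1, h2⟩ := maskLE_saturate hr 5 hle
        have hc : (saturate rules 5 (edgeBit a b ||| inn) &&& out).beq 0 = true := by
          rw [Nat.beq_eq]
          by_contra hne
          obtain ⟨n, hn⟩ := Nat.exists_testBit_of_ne_zero hne
          rw [Nat.testBit_and, Bool.and_eq_true] at hn
          obtain ⟨i, j, rfl, hij⟩ := h1 n hn.1
          exact hout i j hn.2 hij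
        rw [hc, cond_true] at h
        refine ih _ out hes' h1 hout (fun i j hij => ?_) h.2
        rcases hdec i j hij with h | h | h
        · exact Or.inl (h2 _ (by rw [Nat.testBit_or, h, Bool.or_true]))
        · exact Or.inr (Or.inl h)
        · rcases List.mem_cons.1 h with h | h
          · exact Or.inl (h2 _ (by rw [Nat.testBit_or, hself i j h, Bool.true_or]))
          · exact Or.inr (Or.inr h)
      · refine ih inn _ hes' hinn (fun i j hij hmem => ?_) (fun i j hij => ?_) h.1
        · rw [Nat.testBit_or, Bool.or_eq_true, (IsMask.edge a b).testBit] at hij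
          rcases hij with hij | hij
          · rw [Set.mem_singleton_iff.1 hij] at hmem
            exact hab hmem
          · exact hout i j hij hmem
        · rw [Nat.testBit_or, Bool.or_eq_true]
          rcases hdec i j hij with h | h | h
          · exact Or.inl h
          · exact Or.inr (Or.inl (Or.inr h))
          · rcases List.mem_cons.1 h with h | h
            · exact Or.inr (Or.inl (Or.inl (hself i j h)))
            · exact Or.inr (Or.inr h)

/-- Evaluate the entries of a list of triples. -/
def forceTriples {α : Type} (k : List (ℕ × ℕ × ℕ) → α) :
    List (ℕ × ℕ × ℕ) → List (ℕ × ℕ × ℕ) → α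
  | [], acc => k acc
  | (a, b, c) :: l, acc => force a fun a => force b fun b => force c fun c =>
      forceTriples k l ((a, b, c) :: acc)

theorem forceTriples_eq {α : Type} (k : List (ℕ × ℕ × ℕ) → α) (l acc : List (ℕ × ℕ × ℕ)) :
    forceTriples k l acc = k (l.reverse ++ acc) := by
  induction l generalizing acc with
  | nil => rfl
  | cons r l ih =>
    obtain ⟨a, b, c⟩ := r
    rw [forceTriples, force_eq, force_eq, force_eq, ih]
    simp

/-- Evaluate the entries of a list. -/
def forceList {α : Type} (k : List ℕ → α) : List ℕ → List ℕ → α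
  | [], acc => k acc
  | a :: l, acc => force a fun a => forceList k l (a :: acc)

theorem forceList_eq {α : Type} (k : List ℕ → α) (l acc : List ℕ) :
    forceList k l acc = k (l.reverse ++ acc) := by
  induction l generalizing acc with
  | nil => rfl
  | cons a l ih =>
    rw [forceList, force_eq, ih]
    simp

/-- The masks of the edges. -/
def edgeMasks : List ℕ := edgePairs.map fun p => edgeBit p.1 p.2

set_option maxRecDepth 100000 in
/-- The search, run by the kernel on the tables of rules, edges and orbits evaluated beforehand. -/
theorem search_eq_true :
    forceTriples (fun r => forceList (fun es =>
      orbits (fun t => search r t es es 0 0) (List.range' 1 24) []) edgeMasks []) rules [] =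
      true := by
  decide +kernel

theorem IsNice.rulesHold {T : Set (Sym2 (Fin 8))} (hT : IsNice T) : RulesHold rules T := by
  intro r hr
  obtain ⟨p, hp, rfl⟩ := List.mem_map.1 hr
  obtain ⟨a, b, c, rfl, ha, hb, hc, hab, hca, hcb, hl⟩ := mem_frames.1 (List.mem_filter.1 hp).1
  have hmask : ∀ a b c : Fin 8, MaskLE (pairMask a b c) T ↔
      s(a, b) ∈ T ∧ s(star a b, c) ∈ T := by
    intro a b c
    have hm := (IsMask.edge a b).union (IsMask.edge (star a b) c)
    rw [← starCode_eq] at hm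
    constructor
    · intro h
      have h' : ∀ i j : Fin 8, s(i, j) ∈ ({s(a, b)} ∪ {s(star a b, c)} : Set (Sym2 (Fin 8))) →
          s(i, j) ∈ T := by
        intro i j hij
        obtain ⟨i', j', e, hT⟩ := h _ ((hm.testBit i j).2 hij)
        obtain ⟨rfl, rfl⟩ : i = i' ∧ j = j' := by omega
        exact hT
      exact ⟨h' _ _ (Or.inl rfl), h' _ _ (Or.inr rfl)⟩
    · rintro ⟨h1, h2⟩ n hn
      obtain ⟨i, j, e, hij⟩ := (hm n).1 hn
      refine ⟨i, j, e, ?_⟩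
      rcases hij with hij | hij
      · rw [Set.mem_singleton_iff.1 hij]; exact h1
      · rw [Set.mem_singleton_iff.1 hij]; exact h2
  have frame : ∀ a b c : Fin 8, a ≠ b → c ≠ a → c ≠ b → c ≠ star a b →
      c ∉ line a b ∧ a ∉ line b c ∧ b ∉ line c a := by
    decide +kernel
  obtain ⟨l1, l2, l3⟩ := frame a b c hab hca hcb hl
  have hP : (P a b c : Set (Sym2 (Fin 8))) ⊆ T →
      (s(a, b) ∈ T ∧ s(star a b, c) ∈ T) ∧ (s(b, c) ∈ T ∧ s(star b c, a) ∈ T) ∧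
        (s(c, a) ∈ T ∧ s(star c a, b) ∈ T) := by
    intro h
    have h' : ∀ e ∈ P a b c, e ∈ T := fun e he => h he
    simp only [P, Finset.mem_insert, Finset.mem_singleton, forall_eq_or_imp, forall_eq] at h'
    obtain ⟨h1, h2, h3, h4, h5, h6⟩ := h'
    exact ⟨⟨h1, Sym2.eq_swap ▸ h6⟩, ⟨h2, Sym2.eq_swap ▸ h4⟩, ⟨h3, Sym2.eq_swap ▸ h5⟩⟩
  have hPr : P b c a = P a b c ∧ P c a b = P a b c := by
    constructor <;> (ext e; simp only [P, Finset.mem_insert, Finset.mem_singleton]; tauto)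
  simp only [hmask]
  rintro (⟨h1, h2⟩ | ⟨h1, h2⟩ | ⟨h1, h2⟩)
  · exact hP (hT.2 a b c ha hb hc hab l1 h1 h2)
  · exact hP (hPr.1 ▸ hT.2 b c a hb hc ha hcb.symm l2 h1 h2)
  · exact hP (hPr.2 ▸ hT.2 c a b hc ha hb hca l3 h1 h2)

theorem IsNice.exists_collinearSets {T : Set (Sym2 (Fin 8))} (hT : IsNice T) :
    ∃ n ∈ Finset.Icc 1 24, CollinearSets T (niceSet n) := by
  have h := search_eq_true
  rw [forceTriples_eq, forceList_eq] at h
  obtain ⟨t, ht, horb⟩ := orbits_spec (fun t => search (rules.reverse ++ []) t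
    (edgeMasks.reverse ++ []) (edgeMasks.reverse ++ []) 0 0) (List.range' 1 24) []
  rw [ht, List.append_nil, List.append_nil] at h
  obtain ⟨o, ho, m, hm, hmask⟩ := search_spec hT.1
    (fun r hr => hT.rulesHold r (List.mem_reverse.1 hr)) edgeMasks.reverse 0 0
    (fun e he => by
      obtain ⟨p, hp, rfl⟩ := List.mem_map.1 (List.mem_reverse.1 he)
      obtain ⟨h1, h2⟩ := lt_of_mem_edgePairs p hp
      exact ⟨⟨p.1, h1⟩, ⟨p.2, h2⟩, rfl⟩)
    (fun n hn => absurd hn (by simp)) (fun i j hij => absurd hij (by simp))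
    (fun i j hij => by
      refine Or.inr (Or.inr (List.mem_reverse.2 (List.mem_map.2 ?_)))
      rcases lt_trichotomy i j with h | h | h
      · exact ⟨_, mem_edgePairs i j hij h, rfl⟩
      · simp [X, h] at hij
      · rw [Sym2.eq_swap] at hij
        exact ⟨_, mem_edgePairs j i hij h, Nat.lor_comm _ _⟩) h
  obtain ⟨n, hn, hx⟩ := (horb o ho).resolve_left (by simp)
  obtain ⟨p, hp, rfl⟩ := hx m hm
  have hn' : n ∈ Finset.Icc 1 24 := by
    rw [List.mem_range'_1] at hn
    rw [Finset.mem_Icc]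
    omega
  obtain ⟨a, b, c, rfl, -⟩ := mem_frames.1 hp
  obtain ⟨σ, hσ, hf⟩ := exists_collineation hp
  have e := hmask.eq (isMask_encode_niceList hn' a b c)
  rw [← hf] at e
  exact ⟨n, hn', σ.symm, hσ.symm, by rw [e, image_map_symm]⟩

end

section

/-! ### Matrix entries of the elements of `𝔟₃` and `𝔡₄` -/

/-- The indices of the rows and columns of the skew-symmetric matrices in `𝔟₃` or `𝔡₄`. -/
def OrthType.indices : OrthType → Finset (Fin 8)
  | .b3 => points
  | .d4 => Finset.univ

theorem OrthType.mem_indices_of_ne_zero (t : OrthType) {a : Fin 8} (ha : a ≠ 0) :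
    a ∈ t.indices := by
  cases t
  · exact mem_points.2 ha
  · exact Finset.mem_univ a

variable (t : OrthType)

theorem mem_alg_iff (f : Module.End ℂ Oct) : f ∈ t.alg ↔
    (∀ i j, f (Pi.single j 1) i + f (Pi.single i 1) j = 0) ∧
      ∀ i j, j ∉ t.indices → f (Pi.single j 1) i = 0 := by
  rw [← mem_d4_iff]
  cases t with
  | b3 =>
    refine and_congr_right fun _ => ⟨fun h i j hj => ?_, fun h => ?_⟩
    · have hj0 : j = 0 := by simpa [OrthType.indices, mem_points] using hj
      subst hj0
      exact congrFun h i
    · funext i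
      exact h i 0 (by simp [OrthType.indices, mem_points])
  | d4 => exact ⟨fun h => ⟨h, fun i j hj => absurd (Finset.mem_univ j) hj⟩, fun h => h.1⟩

/-- The matrix entry in row `a` and column `b`. -/
def ent (a b : Fin 8) : t.alg →ₗ[ℂ] ℂ where
  toFun f := (f : Module.End ℂ Oct) (Pi.single b 1) a
  map_add' _ _ := rfl
  map_smul' _ _ := rfl

variable {t}

theorem ent_skew (a b : Fin 8) (f : t.alg) : ent t a b f = -ent t b a f :=
  eq_neg_of_add_eq_zero_left (((mem_alg_iff t f).1 f.2).1 a b)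

theorem ent_self (a : Fin 8) (f : t.alg) : ent t a a f = 0 :=
  self_eq_neg.1 (ent_skew a a f)

theorem ent_eq_zero_right {b : Fin 8} (hb : b ∉ t.indices) (a : Fin 8) (f : t.alg) :
    ent t a b f = 0 :=
  ((mem_alg_iff t f).1 f.2).2 a b hb

theorem ent_eq_zero_left {a : Fin 8} (ha : a ∉ t.indices) (b : Fin 8) (f : t.alg) :
    ent t a b f = 0 := by
  rw [ent_skew, ent_eq_zero_right ha, neg_zero]

theorem mem_indices_of_ent_ne_zero {a b : Fin 8} {f : t.alg} (h : ent t a b f ≠ 0) :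
    a ∈ t.indices ∧ b ∈ t.indices ∧ a ≠ b := by
  refine ⟨?_, ?_, ?_⟩
  · by_contra ha; exact h (ent_eq_zero_left ha b f)
  · by_contra hb; exact h (ent_eq_zero_right hb a f)
  · rintro rfl; exact h (ent_self a f)

theorem ext_ent {f k : t.alg} (h : ∀ a b, ent t a b f = ent t a b k) : f = k :=
  Subtype.ext (end_ext h)

theorem ent_lie (a b : Fin 8) (f k : t.alg) :
    ent t a b ⁅f, k⁆ = ∑ c, (ent t a c f * ent t c b k - ent t a c k * ent t c b f) := by
  rw [Finset.sum_sub_distrib]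
  exact congrArg₂ (· - ·) (apply_eq (f : Module.End ℂ Oct) _ a)
    (apply_eq (k : Module.End ℂ Oct) _ a)

variable (t)

/-- The skew-symmetric matrix with the entries `1` at `(a, b)` and `-1` at `(b, a)`; it is `0` by
convention if `a` or `b` is not an index. -/
def elem (a b : Fin 8) : t.alg :=
  if h : a ∈ t.indices ∧ b ∈ t.indices then
    ⟨Matrix.toLin' (Matrix.single a b 1 - Matrix.single b a 1), by
      rw [mem_alg_iff]
      simp only [Matrix.toLin'_apply, Matrix.mulVec_single_one, Matrix.col_apply,
        Matrix.sub_apply, Matrix.single_apply]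
      refine ⟨fun i j => ?_, fun i j hj => ?_⟩
      · simp only [and_comm (a := b = _)]
        ring
      · rw [if_neg fun e : a = i ∧ b = j => hj (e.2 ▸ h.2),
          if_neg fun e : b = i ∧ a = j => hj (e.2 ▸ h.1), sub_zero]⟩
  else 0

variable {t}

theorem ent_elem {a b : Fin 8} (ha : a ∈ t.indices) (hb : b ∈ t.indices) (x y : Fin 8) :
    ent t x y (elem t a b) =
      (if x = a then 1 else 0) * (if y = b then 1 else 0) -
        (if x = b then 1 else 0) * (if y = a then 1 else 0) := by
  rw [elem, dif_pos ⟨ha, hb⟩]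
  change Matrix.toLin' _ (Pi.single y 1) x = _
  simp only [Matrix.toLin'_apply, Matrix.mulVec_single_one, Matrix.col_apply,
        Matrix.sub_apply, Matrix.single_apply, ← ite_and, mul_ite, mul_one, mul_zero,
        eq_comm (b := x), eq_comm (b := y), and_comm]

theorem elem_swap (a b : Fin 8) : elem t b a = -elem t a b := by
  by_cases h : a ∈ t.indices ∧ b ∈ t.indices
  · apply ext_ent
    intro x y
    rw [map_neg, ent_elem h.1 h.2, ent_elem h.2 h.1]
    ring
  · rw [elem, elem, dif_neg h, dif_neg fun e => h ⟨e.2, e.1⟩, neg_zero]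

theorem lie_elem {a b c d : Fin 8} (ha : a ∈ t.indices) (hb : b ∈ t.indices) (hc : c ∈ t.indices)
    (hd : d ∈ t.indices) : ⁅elem t a b, elem t c d⁆ =
      (if b = c then elem t a d else 0) - (if b = d then elem t a c else 0) -
        (if a = c then elem t b d else 0) + (if a = d then elem t b c else 0) := by
  apply ext_ent
  intro x y
  have hs : ∀ u v : Fin 8, ∑ z : Fin 8,
      (if z = u then (1 : ℂ) else 0) * (if z = v then 1 else 0) = if u = v then 1 else 0 := by
    intro u v
    simp [eq_comm]
  have expand : ∀ u v u' v' : Fin 8, ∑ z : Fin 8, ((if x = u then (1 : ℂ) else 0) *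
      (if z = v then 1 else 0)) * ((if z = u' then 1 else 0) * (if y = v' then 1 else 0)) =
      (if x = u then (1 : ℂ) else 0) * (if y = v' then 1 else 0) * if v = u' then 1 else 0 := by
    intro u v u' v'
    rw [← hs v u', Finset.mul_sum]
    exact Finset.sum_congr rfl fun z _ => by ring
  rw [ent_lie]
  simp only [ent_elem ha hb, ent_elem hc hd, sub_mul, mul_sub, Finset.sum_sub_distrib, expand]
  have hite : ∀ (p : Prop) [Decidable p] (f : t.alg),
      ent t x y (if p then f else 0) = ent t x y f * if p then 1 else 0 := by
    intro p _ f
    split_ifs <;> simp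
  simp only [map_add, map_sub, hite, ent_elem ha hd, ent_elem ha hc, ent_elem hb hd,
    ent_elem hb hc, eq_comm (a := d) (b := b), eq_comm (a := d) (b := a),
    eq_comm (a := c) (b := b), eq_comm (a := c) (b := a)]
  ring

/-- Every element is a combination of the matrices `elem t a b`. -/
theorem eq_sum_elem (f : t.alg) :
    f = (2 : ℂ)⁻¹ • ∑ a, ∑ b, ent t a b f • elem t a b := by
  apply ext_ent
  intro x y
  have h : ∀ a b, ent t x y (ent t a b f • elem t a b) = ent t a b f *
      ((if x = a then 1 else 0) * (if y = b then 1 else 0) -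
        (if x = b then 1 else 0) * (if y = a then 1 else 0)) := by
    intro a b
    rw [map_smul, smul_eq_mul]
    by_cases h : ent t a b f = 0
    · rw [h, zero_mul, zero_mul]
    · obtain ⟨ha, hb, -⟩ := mem_indices_of_ent_ne_zero h
      rw [ent_elem ha hb]
  simp only [map_smul, map_sum (ent t x y), h, smul_eq_mul]
  simp only [mul_sub, Finset.sum_sub_distrib, mul_ite, mul_one, mul_zero]
  simp
  rw [ent_skew y x]
  ring

theorem star_eq_iff_deg {a b i : Fin 8} : star a b = i ↔ deg a = deg i + deg b := by
  rw [← deg_injective.eq_iff, deg_star, eq_comm (a := deg a), ← CharTwo.sub_eq_add (deg i),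
    sub_eq_iff_eq_add, eq_comm]

theorem mem_component_iff {f : t.alg} {i : Fin 8} :
    f ∈ component t.alg (deg i) ↔ ∀ a b, ent t a b f ≠ 0 → star a b = i := by
  constructor
  · intro hf a b h
    by_contra hab
    rw [star_eq_iff_deg] at hab
    exact h (hf (deg b) (Pi.single b 1)
      (fun k hk => Pi.single_eq_of_ne (fun e => hk (by rw [e])) 1) a hab)
  · intro h g x hx a ha
    rw [apply_eq]
    refine Finset.sum_eq_zero fun b _ => ?_
    by_cases hb : deg b = g
    · rw [← hb] at ha
      have := mt (h a b) fun e => ha (star_eq_iff_deg.1 e)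
      rw [not_not] at this
      exact mul_eq_zero_of_left this _
    · rw [hx b hb, mul_zero]

theorem ent_proj (g : G) (a b : Fin 8) (f : t.alg) :
    ent t a b (proj (component t.alg) g f) = if deg a = g + deg b then ent t a b f else 0 := by
  have hf : f = ∑ h : G, (⟨endPart h f, endPart_mem t h f.2⟩ : t.alg) := by
    apply Subtype.ext
    rw [AddSubmonoidClass.coe_finsetSum]
    exact (sum_endPart _).symm
  have hp : proj (component t.alg) g f = ⟨endPart g f, endPart_mem t g f.2⟩ := by
    conv_lhs => rw [hf]
    rw [map_sum, Finset.sum_eq_single g]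
    · rw [proj_of_mem _ (endPart_mem_component t g f), if_pos rfl]
    · intro h _ hh
      rw [proj_of_mem _ (endPart_mem_component t h f), if_neg hh]
    · simp
  rw [hp]
  exact endPart_single g f a b

/-- The value of `ε` at a pair of degrees given by labels. -/
def coef (ε : G → G → ℂ) (i j : Fin 8) : ℂ := ε (deg i) (deg j)

theorem ent_contractedBracket (ε : G → G → ℂ) (a b : Fin 8) (x y : t.alg) :
    ent t a b (contractedBracket (component t.alg) ε x y) =
      ∑ c, (coef ε (star a c) (star c b) * (ent t a c x * ent t c b y) -
        coef ε (star c b) (star a c) * (ent t a c y * ent t c b x)) := by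
  have hd : ∀ (g : G) (u v : Fin 8), deg u = g + deg v ↔ deg (star u v) = g := by
    intro g u v
    rw [deg_star, ← CharTwo.sub_eq_add (deg u), sub_eq_iff_eq_add]
  have hsum : ∀ (c : Fin 8), ∑ g : G, ∑ h : G, ε g h *
      (ent t a c (proj (component t.alg) g x) * ent t c b (proj (component t.alg) h y) -
        ent t a c (proj (component t.alg) h y) * ent t c b (proj (component t.alg) g x)) =
      coef ε (star a c) (star c b) * (ent t a c x * ent t c b y) -
        coef ε (star c b) (star a c) * (ent t a c y * ent t c b x) := by
    intro c
    simp only [ent_proj, hd, mul_sub, Finset.sum_sub_distrib]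
    congr 1
    · rw [Finset.sum_eq_single (deg (star a c)), Finset.sum_eq_single (deg (star c b))]
      · simp [coef]
      · intro h _ hh; simp [hh.symm]
      · simp
      · intro h _ hh; simp [hh.symm]
      · simp
    · rw [Finset.sum_eq_single (deg (star c b)), Finset.sum_eq_single (deg (star a c))]
      · simp [coef]
      · intro h _ hh; simp [hh.symm]
      · simp
      · intro h _ hh; simp [hh.symm]
      · simp
  simp only [contractedBracket, map_sum, map_smul, ent_lie, smul_eq_mul, Finset.mul_sum]
  simp only [← hsum]
  rw [Finset.sum_comm]
  conv_rhs => rw [Finset.sum_comm]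
  refine (Finset.sum_comm.trans (Finset.sum_congr rfl fun g _ => ?_))
  exact Finset.sum_comm

/-! ### Sums of homogeneous components -/

variable (t) in
/-- The sum of the components `L_g` with `g` in a set of degrees. -/
def gradedPart (S : Finset (Fin 8)) : Submodule ℂ t.alg where
  carrier := {f | ∀ a b, ent t a b f ≠ 0 → star a b ∈ S}
  add_mem' {f k} hf hk a b h := by
    by_contra hS
    have h1 := mt (hf a b) hS
    have h2 := mt (hk a b) hS
    rw [not_not] at h1 h2
    rw [map_add, h1, h2, add_zero] at h
    exact h rfl
  zero_mem' a b h := absurd (map_zero _) h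
  smul_mem' c f hf a b h := hf a b fun e => h (by rw [map_smul, e, smul_zero])

theorem mem_gradedPart {S : Finset (Fin 8)} {f : t.alg} :
    f ∈ gradedPart t S ↔ ∀ a b, ent t a b f ≠ 0 → star a b ∈ S := Iff.rfl

theorem gradedPart_singleton (i : Fin 8) : gradedPart t {i} = component t.alg (deg i) := by
  ext f
  simp only [mem_gradedPart, mem_component_iff, Finset.mem_singleton]

theorem elem_mem_gradedPart {S : Finset (Fin 8)} {a b : Fin 8} (h : star a b ∈ S) :
    elem t a b ∈ gradedPart t S := by
  by_cases hab : a ∈ t.indices ∧ b ∈ t.indices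
  · intro x y hxy
    rw [ent_elem hab.1 hab.2] at hxy
    by_cases h1 : x = a ∧ y = b
    · rwa [h1.1, h1.2]
    by_cases h2 : x = b ∧ y = a
    · rwa [h2.1, h2.2, star_comm]
    rw [ite_zero_mul_ite_zero, ite_zero_mul_ite_zero, if_neg h1, if_neg h2, sub_zero] at hxy
    exact absurd rfl hxy
  · rw [elem, dif_neg hab]
    exact zero_mem _

/-- A subspace contains a sum of components if it contains the matrices `elem t a b` of
these degrees. -/
theorem gradedPart_le {S : Finset (Fin 8)} {N : Submodule ℂ t.alg}
    (h : ∀ a ∈ t.indices, ∀ b ∈ t.indices, a ≠ b → star a b ∈ S → elem t a b ∈ N) :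
    gradedPart t S ≤ N := by
  intro f hf
  rw [eq_sum_elem f]
  refine N.smul_mem _ (sum_mem fun a _ => sum_mem fun b _ => ?_)
  by_cases hab : ent t a b f = 0
  · rw [hab, zero_smul]
    exact zero_mem _
  · obtain ⟨h1, h2, h3⟩ := mem_indices_of_ent_ne_zero hab
    exact N.smul_mem _ (h a h1 b h2 h3 (hf a b hab))

theorem gradedPart_mono {S S' : Finset (Fin 8)} (h : S ⊆ S') :
    gradedPart t S ≤ gradedPart t S' :=
  fun _ hf a b hab => h (hf a b hab)

theorem gradedPart_points : gradedPart t points = ⊤ := by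
  refine eq_top_iff.2 fun f _ a b hab => ?_
  rw [mem_points, Ne, star_eq_zero]
  exact (mem_indices_of_ent_ne_zero hab).2.2

theorem gradedPart_inf (S S' : Finset (Fin 8)) :
    gradedPart t S ⊓ gradedPart t S' = gradedPart t (S ∩ S') := by
  ext f
  simp only [Submodule.mem_inf, mem_gradedPart, Finset.mem_inter]
  exact ⟨fun h a b hab => ⟨h.1 a b hab, h.2 a b hab⟩,
    fun h => ⟨fun a b hab => (h a b hab).1, fun a b hab => (h a b hab).2⟩⟩

theorem gradedPart_sup (S S' : Finset (Fin 8)) :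
    gradedPart t S ⊔ gradedPart t S' = gradedPart t (S ∪ S') := by
  refine le_antisymm (sup_le (gradedPart_mono Finset.subset_union_left)
    (gradedPart_mono Finset.subset_union_right)) (gradedPart_le fun a _ b _ _ h => ?_)
  rcases Finset.mem_union.1 h with h | h
  · exact Submodule.mem_sup_left (elem_mem_gradedPart h)
  · exact Submodule.mem_sup_right (elem_mem_gradedPart h)

theorem gradedPart_empty : gradedPart t ∅ = ⊥ :=
  eq_bot_iff.2 (gradedPart_le fun _ _ _ _ _ h => absurd h (Finset.notMem_empty _))

/-- The positions above the diagonal with degree in `S`. -/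
def OrthType.positions (t : OrthType) (S : Finset (Fin 8)) : Finset (Fin 8 × Fin 8) :=
  Finset.univ.filter fun p => p.1 < p.2 ∧ p.1 ∈ t.indices ∧ p.2 ∈ t.indices ∧ star p.1 p.2 ∈ S

theorem OrthType.card_positions (t : OrthType) {S : Finset (Fin 8)} (hS : 0 ∉ S) :
    (t.positions S).card = t.r * S.card := by
  have h1 : ∀ i : Fin 8, i ≠ 0 → (Finset.univ.filter fun p : Fin 8 × Fin 8 => p.1 < p.2 ∧
      p.1 ∈ t.indices ∧ p.2 ∈ t.indices ∧ star p.1 p.2 = i).card = t.r := by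
    cases t <;> decide +kernel
  rw [Finset.card_eq_sum_card_fiberwise (f := fun p => star p.1 p.2) (t := S), mul_comm,
    ← smul_eq_mul, ← Finset.sum_const]
  · refine Finset.sum_congr rfl fun i hi => ?_
    rw [← h1 i (fun e => hS (e ▸ hi)), positions, Finset.filter_filter]
    congr 1
    ext p
    simp only [Finset.mem_filter]
    constructor
    · rintro ⟨h, ⟨h1, h2, h3, h4⟩, h5⟩
      exact ⟨h, h1, h2, h3, h5⟩
    · rintro ⟨h, h1, h2, h3, rfl⟩
      exact ⟨h, ⟨h1, h2, h3, hi⟩, rfl⟩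
  · intro p hp
    exact (Finset.mem_filter.1 hp).2.2.2.2

theorem finrank_gradedPart {S : Finset (Fin 8)} (hS : 0 ∉ S) :
    Module.finrank ℂ (gradedPart t S) = t.r * S.card := by
  let φ : gradedPart t S →ₗ[ℂ] (t.positions S → ℂ) :=
    LinearMap.pi fun p => ent t p.1.1 p.1.2 ∘ₗ (gradedPart t S).subtype
  have hinj : Function.Injective φ := by
    rw [injective_iff_map_eq_zero]
    intro f hf
    have hlt : ∀ a b, a < b → ent t a b f = 0 := by
      intro a b hab
      by_contra h
      obtain ⟨h1, h2, h3⟩ := mem_indices_of_ent_ne_zero h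
      exact h (congrFun hf ⟨(a, b), Finset.mem_filter.2
        ⟨Finset.mem_univ _, hab, h1, h2, f.2 a b h⟩⟩)
    apply Subtype.ext
    apply ext_ent
    intro a b
    rw [Submodule.coe_zero, map_zero]
    rcases lt_trichotomy a b with h | rfl | h
    · exact hlt a b h
    · exact ent_self a f.1
    · rw [ent_skew, hlt b a h, neg_zero]
  have hsurj : Function.Surjective φ := by
    intro c
    refine ⟨∑ p : t.positions S, c p • ⟨elem t p.1.1 p.1.2,
      elem_mem_gradedPart (Finset.mem_filter.1 p.2).2.2.2.2⟩, ?_⟩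
    funext q
    rw [map_sum, Finset.sum_apply, Finset.sum_eq_single q]
    · obtain ⟨h1, h2, h3, -⟩ := (Finset.mem_filter.1 q.2).2
      rw [map_smul]
      change c q * ent t q.1.1 q.1.2 (elem t q.1.1 q.1.2) = c q
      rw [ent_elem h2 h3]
      simp [h1.ne]
    · intro p _ hpq
      obtain ⟨h1, h2, h3, -⟩ := (Finset.mem_filter.1 p.2).2
      obtain ⟨h1', -⟩ := (Finset.mem_filter.1 q.2).2
      rw [map_smul]
      change c p * ent t q.1.1 q.1.2 (elem t p.1.1 p.1.2) = 0
      rw [ent_elem h2 h3, ite_zero_mul_ite_zero, ite_zero_mul_ite_zero, if_neg, if_neg, sub_zero,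
        mul_zero]
      · rintro ⟨e1, e2⟩
        rw [e1, e2] at h1'
        exact lt_asymm h1 h1'
      · rintro ⟨e1, e2⟩
        exact hpq (Subtype.ext (Prod.ext e1.symm e2.symm))
    · simp
  rw [(LinearEquiv.ofBijective φ ⟨hinj, hsurj⟩).finrank_eq, Module.finrank_fintype_fun_eq_card,
    Fintype.card_coe, t.card_positions hS]

theorem gradedPart_eq_bot {S : Finset (Fin 8)} (hS : 0 ∉ S) : gradedPart t S = ⊥ ↔ S = ∅ := by
  refine ⟨fun h => ?_, fun h => h ▸ gradedPart_empty⟩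
  have h1 := finrank_gradedPart (t := t) hS
  rw [h, finrank_bot, zero_eq_mul] at h1
  exact Finset.card_eq_zero.1 (h1.resolve_left (by cases t <;> decide))

end

section

/-! ### The bracket of a graded contraction -/

variable {t : OrthType} {ε : G → G → ℂ} (hε : IsGradedContraction (component t.alg) ε)

/-- The matrix entry in row `a` and column `b`, on the contracted algebra. -/
def cent (a b : Fin 8) : Contracted hε →ₗ[ℂ] ℂ := ent t a b ∘ₗ (toContracted hε).symm.toLinearMap

/-- The matrix `elem t a b`, as an element of the contracted algebra. -/
def celem (a b : Fin 8) : Contracted hε := toContracted hε (elem t a b)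

/-- The sum of the components with degree in `S`, as a subspace of the contracted algebra. -/
def part (S : Finset (Fin 8)) : Submodule ℂ (Contracted hε) :=
  (gradedPart t S).map (toContracted hε).toLinearMap

variable {hε}

theorem mem_part {S : Finset (Fin 8)} {x : Contracted hε} :
    x ∈ part hε S ↔ ∀ a b, cent hε a b x ≠ 0 → star a b ∈ S := by
  constructor
  · rintro ⟨f, hf, rfl⟩ a b h
    exact hf a b h
  · intro h
    exact ⟨(toContracted hε).symm x, h, rfl⟩

theorem part_le {S : Finset (Fin 8)} {N : Submodule ℂ (Contracted hε)}
    (h : ∀ a ∈ t.indices, ∀ b ∈ t.indices, a ≠ b → star a b ∈ S → celem hε a b ∈ N) :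
    part hε S ≤ N :=
  Submodule.map_le_iff_le_comap.2 (gradedPart_le h)

theorem celem_mem_part {S : Finset (Fin 8)} {a b : Fin 8} (h : star a b ∈ S) :
    celem hε a b ∈ part hε S :=
  Submodule.mem_map_of_mem (elem_mem_gradedPart h)

theorem part_points : part hε points = ⊤ := by
  rw [part, gradedPart_points, Submodule.map_top, LinearEquiv.range]

theorem part_inf (S S' : Finset (Fin 8)) : part hε S ⊓ part hε S' = part hε (S ∩ S') := by
  rw [part, part, part, ← gradedPart_inf, Submodule.map_inf _ (toContracted hε).injective]

theorem part_sup (S S' : Finset (Fin 8)) : part hε S ⊔ part hε S' = part hε (S ∪ S') := by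
  rw [part, part, part, ← gradedPart_sup, Submodule.map_sup]

theorem part_eq_bot {S : Finset (Fin 8)} (hS : 0 ∉ S) : part hε S = ⊥ ↔ S = ∅ := by
  rw [part, (Submodule.map_injective_of_injective (toContracted hε).injective).eq_iff'
    (Submodule.map_bot _), gradedPart_eq_bot hS]

theorem finrank_part {S : Finset (Fin 8)} (hS : 0 ∉ S) :
    Module.finrank ℂ (part hε S) = t.r * S.card := by
  rw [← finrank_gradedPart hS]
  exact LinearEquiv.finrank_map_eq (toContracted hε) _

theorem cent_skew (a b : Fin 8) (x : Contracted hε) : cent hε a b x = -cent hε b a x :=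
  ent_skew a b _

theorem mem_indices_of_cent_ne_zero {a b : Fin 8} {x : Contracted hε} (h : cent hε a b x ≠ 0) :
    a ∈ t.indices ∧ b ∈ t.indices ∧ a ≠ b :=
  mem_indices_of_ent_ne_zero h

theorem ext_cent {x y : Contracted hε} (h : ∀ a b, cent hε a b x = cent hε a b y) : x = y :=
  (toContracted hε).symm.injective (ext_ent h)

theorem cent_celem {a b : Fin 8} (ha : a ∈ t.indices) (hb : b ∈ t.indices) (x y : Fin 8) :
    cent hε x y (celem hε a b) =
      (if x = a then 1 else 0) * (if y = b then 1 else 0) -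
        (if x = b then 1 else 0) * (if y = a then 1 else 0) :=
  ent_elem ha hb x y

theorem celem_ne_zero {a b : Fin 8} (ha : a ∈ t.indices) (hb : b ∈ t.indices) (hab : a ≠ b) :
    celem hε a b ≠ 0 := by
  intro h
  have := cent_celem (hε := hε) ha hb a b
  rw [h, map_zero] at this
  simp [hab] at this

theorem celem_swap (a b : Fin 8) : celem hε b a = -celem hε a b := by
  rw [celem, elem_swap, map_neg, celem]

theorem lie_toContracted (f k : t.alg) : ⁅toContracted hε f, toContracted hε k⁆ =
    toContracted hε (contractedBracket (component t.alg) ε f k) := rfl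

theorem lie_celem (a b c d : Fin 8) : ⁅celem hε a b, celem hε c d⁆ =
    coef ε (star a b) (star c d) • toContracted hε ⁅elem t a b, elem t c d⁆ := by
  have h : ∀ a b, elem t a b ∈ component t.alg (deg (star a b)) := by
    intro a b
    rw [← gradedPart_singleton]
    exact elem_mem_gradedPart (Finset.mem_singleton_self _)
  rw [celem, celem, lie_toContracted, contractedBracket_of_mem _ ε (h a b) (h c d), map_smul]
  rfl

theorem lie_celem_chain {a b c : Fin 8} (ha : a ∈ t.indices) (hb : b ∈ t.indices)
    (hc : c ∈ t.indices) (hab : a ≠ b) (hbc : b ≠ c) (hac : a ≠ c) :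
    ⁅celem hε a b, celem hε b c⁆ = coef ε (star a b) (star b c) • celem hε a c := by
  rw [lie_celem, lie_elem ha hb hb hc, if_pos rfl, if_neg hbc, if_neg hab, if_neg hac]
  simp [celem]

theorem lie_celem_disjoint {a b c d : Fin 8} (ha : a ∈ t.indices) (hb : b ∈ t.indices)
    (hc : c ∈ t.indices) (hd : d ∈ t.indices) (hac : a ≠ c) (had : a ≠ d) (hbc : b ≠ c)
    (hbd : b ≠ d) : ⁅celem hε a b, celem hε c d⁆ = 0 := by
  rw [lie_celem, lie_elem ha hb hc hd, if_neg hac, if_neg had, if_neg hbc, if_neg hbd]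
  simp

theorem deg_zero : deg 0 = 0 := by decide

theorem coef_zero_left {ε : G → G → ℂ} (hadm : IsAdmissible ε) (i : Fin 8) : coef ε 0 i = 0 := by
  rw [coef, deg_zero, (hadm _).2.1]

theorem coef_zero_right {ε : G → G → ℂ} (hadm : IsAdmissible ε) (i : Fin 8) :
    coef ε i 0 = 0 := by
  rw [coef, deg_zero, (hadm _).2.2]

/-- The symmetry of `ε`: skew-symmetry of the bracket of two steps of a path `a, b, c` whose degrees
are the given ones. -/
theorem coef_comm (hε : IsGradedContraction (component t.alg) ε) (hadm : IsAdmissible ε)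
    (i j : Fin 8) : coef ε i j = coef ε j i := by
  rcases eq_or_ne i 0 with rfl | hi
  · rw [coef_zero_left hadm, coef_zero_right hadm]
  rcases eq_or_ne j 0 with rfl | hj
  · rw [coef_zero_left hadm, coef_zero_right hadm]
  rcases eq_or_ne i j with rfl | hij
  · rfl
  have hex : ∀ i j : Fin 8, i ≠ 0 → j ≠ 0 → i ≠ j → ∃ a b c : Fin 8, a ≠ 0 ∧ b ≠ 0 ∧ c ≠ 0 ∧
      a ≠ b ∧ b ≠ c ∧ a ≠ c ∧ star a b = i ∧ star b c = j := by decide +kernel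
  obtain ⟨a, b, c, ha, hb, hc, hab, hbc, hac, rfl, rfl⟩ := hex i j hi hj hij
  have hA := t.mem_indices_of_ne_zero ha
  have hB := t.mem_indices_of_ne_zero hb
  have hC := t.mem_indices_of_ne_zero hc
  have h1 := lie_celem_chain (hε := hε) hA hB hC hab hbc hac
  have h2 := lie_celem_chain (hε := hε) hC hB hA hbc.symm hab.symm hac.symm
  rw [celem_swap b c, celem_swap a b, celem_swap a c, neg_lie, lie_neg, neg_neg,
    ← lie_skew, h1, star_comm c b, star_comm b a, smul_neg, neg_inj] at h2
  exact smul_left_injective ℂ (celem_ne_zero (hε := hε) hA hC hac) h2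

/-- The Jacobi identity for the three steps of a path `a, b, c, d` whose degrees `i, j, k` span
`ℤ₂³`; the first and the last step commute. -/
theorem coef_mul_coef (hε : IsGradedContraction (component t.alg) ε) {i j k : Fin 8} (hi : i ≠ 0)
    (hj : j ≠ 0) (hk : k ≠ 0) (hij : i ≠ j) (hl : k ∉ line i j) :
    coef ε j k * coef ε i (star j k) = coef ε i j * coef ε (star i j) k := by
  have hex : ∀ i j k : Fin 8, ∃ a : Fin 8, a ≠ 0 ∧ star a i ≠ 0 ∧ star (star a i) j ≠ 0 ∧
      star (star (star a i) j) k ≠ 0 := by decide +kernel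
  have hne : ∀ i j k a : Fin 8, i ≠ 0 → j ≠ 0 → k ≠ 0 → i ≠ j → k ∉ line i j →
      a ≠ star a i ∧ a ≠ star (star a i) j ∧ a ≠ star (star (star a i) j) k ∧
        star a i ≠ star (star a i) j ∧ star a i ≠ star (star (star a i) j) k ∧
          star (star a i) j ≠ star (star (star a i) j) k := by decide +kernel
  obtain ⟨a, ha, hb, hc, hd⟩ := hex i j k
  obtain ⟨hab, hac, had, hbc, hbd, hcd⟩ := hne i j k a hi hj hk hij hl
  have e1 : star a (star a i) = i := star_star_cancel a i
  generalize star a i = b at *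
  have e2 : star b (star b j) = j := star_star_cancel b j
  generalize star b j = c at *
  have e3 : star c (star c k) = k := star_star_cancel c k
  generalize star c k = d at *
  have hA := t.mem_indices_of_ne_zero ha
  have hB := t.mem_indices_of_ne_zero hb
  have hC := t.mem_indices_of_ne_zero hc
  have hD := t.mem_indices_of_ne_zero hd
  have h := leibniz_lie (celem hε a b) (celem hε b c) (celem hε c d)
  rw [lie_celem_disjoint hA hB hC hD hac had hbc hbd, lie_zero, add_zero,
    lie_celem_chain hB hC hD hbc hcd hbd, lie_celem_chain hA hB hC hab hbc hac, lie_smul, smul_lie,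
    lie_celem_chain hA hB hD hab hbd had, lie_celem_chain hA hC hD hac hcd had, smul_smul,
    smul_smul] at h
  have h' := smul_left_injective ℂ (celem_ne_zero (hε := hε) hA hD had) h
  have e4 : star b d = star j k := by
    rw [← e2, ← e3, star_assoc, ← star_assoc c c d, star_self, zero_star]
  have e5 : star a c = star i j := by
    rw [← e1, ← e2, star_assoc, ← star_assoc b b c, star_self, zero_star]
  rwa [e1, e2, e3, e4, e5] at h'

theorem mk_mem_supp (hadm : IsAdmissible ε) (hsymm : ∀ i j, coef ε i j = coef ε j i)
    {i j : Fin 8} : s(i, j) ∈ supp ε ↔ coef ε i j ≠ 0 := by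
  constructor
  · rintro ⟨i', j', -, -, -, e, h⟩
    rcases Sym2.eq_iff.1 e with ⟨rfl, rfl⟩ | ⟨rfl, rfl⟩
    · exact h
    · rw [hsymm]; exact h
  · intro h
    refine ⟨i, j, ?_, ?_, ?_, rfl, h⟩
    · rintro rfl; exact h (coef_zero_left hadm j)
    · rintro rfl; exact h (coef_zero_right hadm i)
    · rintro rfl; exact h (hadm (deg i)).1

theorem supp_subset (ε : G → G → ℂ) : supp ε ⊆ (X : Set (Sym2 (Fin 8))) := by
  rintro _ ⟨i, j, hi, hj, hij, rfl, -⟩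
  simp [X, hij, hi.symm, hj.symm]

theorem isNice_supp (hε : IsGradedContraction (component t.alg) ε) (hadm : IsAdmissible ε) :
    IsNice (supp ε) := by
  refine ⟨supp_subset ε, fun i j k hi hj hk hij hl h1 h2 => ?_⟩
  have hsymm := coef_comm hε hadm
  have hframe : ∀ i j k : Fin 8, i ≠ j → k ∉ line i j → j ≠ k ∧ i ∉ line j k := by decide +kernel
  obtain ⟨hjk, hl'⟩ := hframe i j k hij hl
  have e1 := coef_mul_coef hε hi hj hk hij hl
  have e2 := coef_mul_coef hε hj hk hi hjk hl'
  rw [mk_mem_supp hadm hsymm] at h1 h2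
  have h := mul_ne_zero h1 h2
  rw [← e1] at h
  have h3 := left_ne_zero_of_mul h
  have h4 := right_ne_zero_of_mul h
  have h' := mul_ne_zero h3 (hsymm i _ ▸ h4)
  rw [← e2] at h'
  have h5 := left_ne_zero_of_mul h'
  have h6 := right_ne_zero_of_mul h'
  intro e he
  simp only [P, Finset.coe_insert, Finset.coe_singleton, Set.mem_insert_iff,
    Set.mem_singleton_iff] at he
  rcases he with rfl | rfl | rfl | rfl | rfl | rfl <;> rw [mk_mem_supp hadm hsymm]
  · exact h1
  · exact h3
  · exact h5
  · exact h4
  · exact h6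
  · rw [hsymm]; exact h2

theorem cent_lie (hsymm : ∀ i j, coef ε i j = coef ε j i) (a b : Fin 8) (x y : Contracted hε) :
    cent hε a b ⁅x, y⁆ = ∑ c, coef ε (star a c) (star c b) *
      (cent hε a c x * cent hε c b y - cent hε a c y * cent hε c b x) := by
  refine (ent_contractedBracket ε a b _ _).trans (Finset.sum_congr rfl fun c _ => ?_)
  rw [hsymm (star c b), ← mul_sub]
  rfl

end

section

/-! ### The lower central series, the derived series and the center -/

variable {t : OrthType} {ε : G → G → ℂ} {hε : IsGradedContraction (component t.alg) ε}
  {T : Finset (Sym2 (Fin 8))}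

theorem coef_ne_zero_iff (hε : IsGradedContraction (component t.alg) ε) (hadm : IsAdmissible ε)
    (hT : supp ε = T) {i j : Fin 8} : coef ε i j ≠ 0 ↔ s(i, j) ∈ T := by
  rw [← mk_mem_supp hadm (coef_comm hε hadm), hT, Finset.mem_coe]

theorem subset_of_supp_eq (hT : supp ε = T) : T ⊆ X :=
  Finset.coe_subset.1 (hT ▸ supp_subset ε)

theorem lie_mem_part_step (hadm : IsAdmissible ε) (hT : supp ε = T) {S S' : Finset (Fin 8)}
    {x y : Contracted hε} (hx : x ∈ part hε S) (hy : y ∈ part hε S') :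
    ⁅x, y⁆ ∈ part hε (step T S S') := by
  rw [mem_part] at hx hy ⊢
  intro a b h
  rw [cent_lie (coef_comm hε hadm)] at h
  obtain ⟨c, -, hc⟩ := Finset.exists_ne_zero_of_sum_ne_zero h
  have h1 := (coef_ne_zero_iff hε hadm hT).1 (left_ne_zero_of_mul hc)
  have h2 := right_ne_zero_of_mul hc
  have e : ∀ a b c : Fin 8, star (star a c) (star c b) = star a b := by decide +kernel
  rw [mem_step]
  by_cases h3 : cent hε a c x * cent hε c b y = 0
  · rw [h3, zero_sub, neg_ne_zero] at h2
    exact ⟨star c b, hx c b (right_ne_zero_of_mul h2), star a c, hy a c (left_ne_zero_of_mul h2),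
      Sym2.eq_swap ▸ h1, by rw [star_comm, e]⟩
  · exact ⟨star a c, hx a c (left_ne_zero_of_mul h3), star c b, hy c b (right_ne_zero_of_mul h3),
      h1, e a b c⟩

/-- The bracket of two ideals that are sums of components is the sum of the components whose degrees
are in `step`. -/
theorem toSubmodule_lie (hadm : IsAdmissible ε) (hT : supp ε = T) {S S' : Finset (Fin 8)}
    {I J : LieIdeal ℂ (Contracted hε)} (hI : I.toSubmodule = part hε S)
    (hJ : J.toSubmodule = part hε S') :
    (⁅I, J⁆ : LieIdeal ℂ (Contracted hε)).toSubmodule = part hε (step T S S') := by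
  have hI' : ∀ {x}, x ∈ I ↔ x ∈ part hε S := fun {x} => by rw [← hI]; rfl
  have hJ' : ∀ {x}, x ∈ J ↔ x ∈ part hε S' := fun {x} => by rw [← hJ]; rfl
  refine le_antisymm ?_ (part_le fun a ha b hb hab h => ?_)
  · rw [LieSubmodule.lieIdeal_oper_eq_linear_span', Submodule.span_le]
    rintro _ ⟨x, hx, y, hy, rfl⟩
    exact lie_mem_part_step hadm hT (hI'.1 hx) (hJ'.1 hy)
  · obtain ⟨i, hi, j, hj, hij, e⟩ := mem_step.1 h
    have hc := (coef_ne_zero_iff hε hadm hT).2 hij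
    have hi0 : i ≠ 0 := by rintro rfl; exact hc (coef_zero_left hadm j)
    have hj0 : j ≠ 0 := by rintro rfl; exact hc (coef_zero_right hadm i)
    have hne : i ≠ j := by rintro rfl; exact hc (hadm _).1
    -- one of the two indices `a * i`, `a * j` between `a` and `b` is not `0`
    by_cases h0 : star a i = 0
    · have facts : ∀ a b i j : Fin 8, i ≠ 0 → j ≠ 0 → i ≠ j → star i j = star a b →
          star a i = 0 → star a j ≠ 0 ∧ a ≠ star a j ∧ star a j ≠ b ∧ star a (star a j) = j ∧
            star (star a j) b = i := by decide +kernel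
      obtain ⟨f0, f1, f2, f3, f4⟩ := facts a b i j hi0 hj0 hne e h0
      have h1 := lie_celem_chain (hε := hε) hb (t.mem_indices_of_ne_zero f0) ha f2.symm f1.symm
        hab.symm
      rw [star_comm b, star_comm _ a, f3, f4] at h1
      have h2 : ⁅celem hε b (star a j), celem hε (star a j) a⁆ ∈ ⁅I, J⁆ :=
        LieSubmodule.lie_mem_lie (hI'.2 (celem_mem_part (by rwa [star_comm, f4])))
          (hJ'.2 (celem_mem_part (by rwa [star_comm, f3])))
      rw [h1, celem_swap a b] at h2
      have h3 := (⁅I, J⁆).smul_mem (coef ε i j)⁻¹ h2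
      rw [smul_smul, inv_mul_cancel₀ hc, one_smul] at h3
      exact neg_mem_iff.1 h3
    · have facts : ∀ a b i j : Fin 8, i ≠ 0 → j ≠ 0 → star i j = star a b →
          a ≠ star a i ∧ star a i ≠ b ∧ star a (star a i) = i ∧ star (star a i) b = j := by
        decide +kernel
      obtain ⟨f1, f2, f3, f4⟩ := facts a b i j hi0 hj0 e
      have h1 := lie_celem_chain (hε := hε) ha (t.mem_indices_of_ne_zero h0) hb f1 f2 hab
      rw [f3, f4] at h1
      have h2 : ⁅celem hε a (star a i), celem hε (star a i) b⁆ ∈ ⁅I, J⁆ :=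
        LieSubmodule.lie_mem_lie (hI'.2 (celem_mem_part (by rwa [f3])))
          (hJ'.2 (celem_mem_part (by rwa [f4])))
      rw [h1] at h2
      have h3 := (⁅I, J⁆).smul_mem (coef ε i j)⁻¹ h2
      rwa [smul_smul, inv_mul_cancel₀ hc, one_smul] at h3

theorem toSubmodule_lowerCentralSeries (hadm : IsAdmissible ε) (hT : supp ε = T) (m : ℕ) :
    (LieModule.lowerCentralSeries ℂ (Contracted hε) (Contracted hε) m).toSubmodule =
      part hε (lowerSet T m) := by
  induction m with
  | zero => exact part_points.symm
  | succ m ih =>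
    rw [LieModule.lowerCentralSeries_succ]
    exact toSubmodule_lie hadm hT part_points.symm ih

theorem toSubmodule_derivedSeries (hadm : IsAdmissible ε) (hT : supp ε = T) (m : ℕ) :
    (LieAlgebra.derivedSeries ℂ (Contracted hε) m).toSubmodule = part hε (derivedSet T m) := by
  induction m with
  | zero => exact part_points.symm
  | succ m ih =>
    rw [LieAlgebra.derivedSeries_def, LieAlgebra.derivedSeriesOfIdeal_succ]
    exact toSubmodule_lie hadm hT ih ih

theorem toSubmodule_center (hadm : IsAdmissible ε) (hT : supp ε = T) :
    (LieAlgebra.center ℂ (Contracted hε)).toSubmodule = part hε (isolated T) := by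
  have hsymm := coef_comm hε hadm
  ext x
  rw [LieSubmodule.mem_toSubmodule, LieModule.mem_maxTrivSubmodule]
  constructor
  · intro hx
    rw [mem_part]
    -- a nonzero entry of `x` at `(a, b)` is moved by `celem b d` if `{a * b, b * d}` is in `T`
    have key : ∀ a b j : Fin 8, cent hε a b x ≠ 0 → s(star a b, j) ∈ T → b ≠ j → False := by
      intro a b j h hj hbj
      obtain ⟨ha, hb, hab⟩ := mem_indices_of_cent_ne_zero h
      have hc := (coef_ne_zero_iff hε hadm hT).2 hj
      have hj0 : j ≠ 0 := by rintro rfl; exact hc (coef_zero_right hadm _)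
      have hne : star a b ≠ j := by rintro rfl; exact hc (hadm _).1
      have facts : ∀ a b j : Fin 8, j ≠ 0 → star a b ≠ j → b ≠ j → star b j ≠ 0 ∧ b ≠ star b j ∧
          a ≠ star b j ∧ star b (star b j) = j := by decide +kernel
      obtain ⟨f0, f1, f2, f3⟩ := facts a b j hj0 hne hbj
      have h0 := hx (celem hε b (star b j))
      rw [← lie_skew, neg_eq_zero] at h0
      have h1 := cent_lie hsymm a (star b j) x (celem hε b (star b j))
      rw [h0, map_zero, Finset.sum_eq_single b] at h1
      · simp [cent_celem hb (t.mem_indices_of_ne_zero f0), f1.symm, f3, hab, f2] at h1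
        exact h1.elim hc h
      · intro c _ hcb
        simp [cent_celem hb (t.mem_indices_of_ne_zero f0), f1.symm, hab, f2, hcb]
      · simp
    intro a b h
    refine Finset.mem_filter.2 ⟨mem_points.2 ?_, fun j hj => ?_⟩
    · rw [Ne, star_eq_zero]
      exact (mem_indices_of_cent_ne_zero h).2.2
    · by_cases hbj : b = j
      · refine key b a j (by rwa [cent_skew, neg_ne_zero]) (by rwa [star_comm]) ?_
        exact fun e => (mem_indices_of_cent_ne_zero h).2.2 (e.trans hbj.symm)
      · exact key a b j h hj hbj
  · intro hx y
    rw [mem_part] at hx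
    apply ext_cent
    intro a b
    rw [cent_lie hsymm, map_zero]
    have h0 : ∀ c d : Fin 8, cent hε c d x ≠ 0 → ∀ j, coef ε (star c d) j = 0 := by
      intro c d h j
      by_contra hc
      exact (Finset.mem_filter.1 (hx c d h)).2 j ((coef_ne_zero_iff hε hadm hT).1 hc)
    refine Finset.sum_eq_zero fun c _ => ?_
    by_cases h1 : cent hε c b x = 0
    · by_cases h2 : cent hε a c x = 0
      · rw [h1, h2, mul_zero, zero_mul, sub_zero, mul_zero]
      · rw [h0 a c h2, zero_mul]
    · rw [hsymm, h0 c b h1, zero_mul]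

theorem zero_notMem_lowerSet (hT : T ⊆ X) (m : ℕ) : 0 ∉ lowerSet T m := by
  cases m with
  | zero => exact fun h => mem_points.1 h rfl
  | succ m => exact zero_notMem_step hT _ _

theorem zero_notMem_derivedSet (hT : T ⊆ X) (m : ℕ) : 0 ∉ derivedSet T m := by
  cases m with
  | zero => exact fun h => mem_points.1 h rfl
  | succ m => exact zero_notMem_step hT _ _

theorem zero_notMem_isolated : 0 ∉ isolated T :=
  fun h => mem_points.1 (Finset.mem_filter.1 h).1 rfl

/-! For a support that is collinear to `N`, everything is read off from `N`. -/

variable {N : Finset (Sym2 (Fin 8))}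

theorem finrank_derivedAlg (hadm : IsAdmissible ε) (h : CollinearSets (supp ε) N) {m : ℕ}
    (hm : (derivedSet N 1).card = m) :
    Module.finrank ℂ (derivedAlg (Contracted hε)) = m * t.r := by
  obtain ⟨τ, hτ, hT⟩ := h.exists_image
  have e := toSubmodule_derivedSeries (hε := hε) hadm hT 1
  have hf := finrank_part (hε := hε) (zero_notMem_derivedSet (subset_of_supp_eq hT) 1)
  rw [← e, hτ.derivedSet_image, Finset.card_image_of_injective _ τ.injective, hm, mul_comm] at hf
  exact hf

theorem finrank_center (hadm : IsAdmissible ε) (h : CollinearSets (supp ε) N) {m : ℕ}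
    (hm : (isolated N).card = m) :
    Module.finrank ℂ (LieAlgebra.center ℂ (Contracted hε)) = m * t.r := by
  obtain ⟨τ, hτ, hT⟩ := h.exists_image
  have e := toSubmodule_center (hε := hε) hadm hT
  have hf := finrank_part (hε := hε) (zero_notMem_isolated (T := N.image (Sym2.map τ)))
  rw [← e, hτ.isolated_image, Finset.card_image_of_injective _ τ.injective, hm, mul_comm] at hf
  exact hf

theorem lowerCentralSeries_eq_bot (hadm : IsAdmissible ε) (h : CollinearSets (supp ε) N) (m : ℕ) :
    LieModule.lowerCentralSeries ℂ (Contracted hε) (Contracted hε) m = ⊥ ↔ lowerSet N m = ∅ := by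
  obtain ⟨τ, hτ, hT⟩ := h.exists_image
  rw [← LieSubmodule.toSubmodule_eq_bot, toSubmodule_lowerCentralSeries hadm hT,
    part_eq_bot (zero_notMem_lowerSet (subset_of_supp_eq hT) m), hτ.lowerSet_image,
    Finset.image_eq_empty]

theorem derivedSeries_eq_bot (hadm : IsAdmissible ε) (h : CollinearSets (supp ε) N) (m : ℕ) :
    LieAlgebra.derivedSeries ℂ (Contracted hε) m = ⊥ ↔ derivedSet N m = ∅ := by
  obtain ⟨τ, hτ, hT⟩ := h.exists_image
  rw [← LieSubmodule.toSubmodule_eq_bot, toSubmodule_derivedSeries hadm hT,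
    part_eq_bot (zero_notMem_derivedSet (subset_of_supp_eq hT) m), hτ.derivedSet_image,
    Finset.image_eq_empty]

theorem isStepNilpotent (hadm : IsAdmissible ε) (h : CollinearSets (supp ε) N) {k : ℕ}
    (hk : lowerSet N k = ∅ ∧ ∀ m < k, lowerSet N m ≠ ∅) : IsStepNilpotent (Contracted hε) k :=
  ⟨(lowerCentralSeries_eq_bot hadm h k).2 hk.1,
    fun m hm => mt (lowerCentralSeries_eq_bot hadm h m).1 (hk.2 m hm)⟩

theorem isStepSolvable (hadm : IsAdmissible ε) (h : CollinearSets (supp ε) N) {k : ℕ}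
    (hk : derivedSet N k = ∅ ∧ ∀ m < k, derivedSet N m ≠ ∅) : IsStepSolvable (Contracted hε) k :=
  ⟨(derivedSeries_eq_bot hadm h k).2 hk.1,
    fun m hm => mt (derivedSeries_eq_bot hadm h m).1 (hk.2 m hm)⟩

/-- Two edges `{i, j}` and `{i, i * j}` obstruct nilpotency, since `L_i` then maps `L_j` to
`L_{i * j}` and back. -/
theorem not_isNilpotent (hadm : IsAdmissible ε) (h : CollinearSets (supp ε) N)
    (h12 : s(1, 2) ∈ N) (h15 : s(1, 5) ∈ N) : ¬ LieRing.IsNilpotent (Contracted hε) := by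
  rw [LieRing.IsNilpotent, LieModule.isNilpotent_iff ℂ]
  rintro ⟨k, hk⟩
  rw [lowerCentralSeries_eq_bot hadm h] at hk
  have key : ∀ m, 2 ∈ lowerSet N m ∧ 5 ∈ lowerSet N m := by
    intro m
    induction m with
    | zero => simp [lowerSet, points]
    | succ m ih =>
      exact ⟨mem_step.2 ⟨1, by decide, 5, ih.2, h15, rfl⟩,
        mem_step.2 ⟨1, by decide, 2, ih.1, h12, rfl⟩⟩
  exact Finset.notMem_empty _ (hk ▸ (key k).1)

theorem not_isSolvable (hadm : IsAdmissible ε) (h : CollinearSets (supp ε) N)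
    (h12 : s(1, 2) ∈ N) (h15 : s(1, 5) ∈ N) (h25 : s(2, 5) ∈ N) :
    ¬ LieAlgebra.IsSolvable (Contracted hε) := by
  rw [LieAlgebra.isSolvable_iff ℂ]
  rintro ⟨k, hk⟩
  rw [derivedSeries_eq_bot hadm h] at hk
  have key : ∀ m, 1 ∈ derivedSet N m ∧ 2 ∈ derivedSet N m ∧ 5 ∈ derivedSet N m := by
    intro m
    induction m with
    | zero => simp [derivedSet, points]
    | succ m ih =>
      exact ⟨mem_step.2 ⟨2, ih.2.1, 5, ih.2.2, h25, rfl⟩,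
        mem_step.2 ⟨1, ih.1, 5, ih.2.2, h15, rfl⟩, mem_step.2 ⟨1, ih.1, 2, ih.2.1, h12, rfl⟩⟩
  exact Finset.notMem_empty _ (hk ▸ (key k).1)

theorem center_eq_derivedAlg (hadm : IsAdmissible ε) (h : CollinearSets (supp ε) N)
    (hN : isolated N = derivedSet N 1) :
    LieAlgebra.center ℂ (Contracted hε) = derivedAlg (Contracted hε) := by
  obtain ⟨τ, hτ, hT⟩ := h.exists_image
  rw [← LieSubmodule.toSubmodule_inj, toSubmodule_center hadm hT,
    toSubmodule_derivedSeries hadm hT, hτ.isolated_image, hτ.derivedSet_image, hN]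

theorem center_eq_bot (hadm : IsAdmissible ε) (h : CollinearSets (supp ε) N)
    (hN : isolated N = ∅) : LieAlgebra.center ℂ (Contracted hε) = ⊥ := by
  obtain ⟨τ, hτ, hT⟩ := h.exists_image
  rw [← LieSubmodule.toSubmodule_eq_bot, toSubmodule_center hadm hT,
    part_eq_bot zero_notMem_isolated, hτ.isolated_image, hN, Finset.image_empty]

theorem isCompl_center_derivedAlg (hadm : IsAdmissible ε) (h : CollinearSets (supp ε) N)
    (hN : isolated N ∩ derivedSet N 1 = ∅) (hN' : isolated N ∪ derivedSet N 1 = points) :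
    IsCompl (LieAlgebra.center ℂ (Contracted hε)) (derivedAlg (Contracted hε)) := by
  obtain ⟨τ, hτ, hT⟩ := h.exists_image
  constructor
  · rw [disjoint_iff, ← LieSubmodule.toSubmodule_eq_bot, LieSubmodule.inf_toSubmodule,
      toSubmodule_center hadm hT, toSubmodule_derivedSeries hadm hT, part_inf, hτ.isolated_image,
      hτ.derivedSet_image, ← Finset.image_inter _ _ τ.injective, hN, Finset.image_empty]
    exact (part_eq_bot (Finset.notMem_empty _)).2 rfl
  · rw [codisjoint_iff, ← LieSubmodule.toSubmodule_inj, LieSubmodule.sup_toSubmodule,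
      toSubmodule_center hadm hT, toSubmodule_derivedSeries hadm hT, part_sup, hτ.isolated_image,
      hτ.derivedSet_image, ← Finset.image_union, hN', hτ.image_points, part_points]
    rfl

theorem isLieAbelian_of_supp_empty (hadm : IsAdmissible ε) (h : CollinearSets (supp ε) N)
    (hN : N = ∅) : IsLieAbelian (Contracted hε) := by
  have h1 := (lowerCentralSeries_eq_bot (hε := hε) hadm h 1).2 (by rw [hN]; decide)
  rw [LieModule.lowerCentralSeries_succ, LieModule.lowerCentralSeries_zero] at h1
  exact (LieModule.trivial_iff_lower_central_eq_bot ℂ _ _).2 h1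

end

section

/-! ### Families of commuting `𝔰𝔩(2)`-triples -/

section Triples

variable {K : Type} [LieRing K] [LieAlgebra ℂ K] {r : ℕ}

/-- A family of `r` commuting triples, each of which multiplies like the standard basis of `ℂ³`
under the cross product. -/
structure IsTripleFamily (v : Fin r → Fin 3 → K) : Prop where
  lie_succ : ∀ s i, ⁅v s i, v s (i + 1)⁆ = v s (i + 2)
  lie_of_ne : ∀ s s', s ≠ s' → ∀ i j, ⁅v s i, v s' j⁆ = 0

variable {v : Fin r → Fin 3 → K}

theorem sl_entry (M : LieAlgebra.SpecialLinear.sl (Fin 2) ℂ) : M.1 1 1 = -M.1 0 0 := by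
  have h : Matrix.trace M.1 = 0 := LinearMap.mem_ker.1 M.2
  rw [Matrix.trace_fin_two] at h
  linear_combination h

/-- The homomorphism from `𝔰𝔩(2, ℂ)` given by a triple. The coefficients express a traceless
matrix in the basis `-(I / 2) σ_k`, where the `σ_k` are the Pauli matrices. -/
def IsTripleFamily.hom (hv : IsTripleFamily v) (s : Fin r) :
    LieAlgebra.SpecialLinear.sl (Fin 2) ℂ →ₗ⁅ℂ⁆ K where
  toFun M := (Complex.I * (M.1 0 1 + M.1 1 0)) • v s 0 + (M.1 1 0 - M.1 0 1) • v s 1 +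
    (2 * Complex.I * M.1 0 0) • v s 2
  map_add' M M' := by
    have h : ∀ i j, (M + M').1 i j = M.1 i j + M'.1 i j := fun _ _ => rfl
    simp only [h]
    module
  map_smul' c M := by
    have h : ∀ i j, (c • M).1 i j = c * M.1 i j := fun _ _ => rfl
    simp only [h, RingHom.id_apply]
    module
  map_lie' {M M'} := by
    have h01 : ⁅v s 0, v s 1⁆ = v s 2 := hv.lie_succ s 0
    have h12 : ⁅v s 1, v s 2⁆ = v s 0 := hv.lie_succ s 1
    have h20 : ⁅v s 2, v s 0⁆ = v s 1 := hv.lie_succ s 2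
    have h10 : ⁅v s 1, v s 0⁆ = -v s 2 := by rw [← lie_skew, h01]
    have h21 : ⁅v s 2, v s 1⁆ = -v s 0 := by rw [← lie_skew, h12]
    have h02 : ⁅v s 0, v s 2⁆ = -v s 1 := by rw [← lie_skew, h20]
    simp only [lie_add, add_lie, lie_smul, smul_lie, lie_self, h01, h12, h20, h10, h21, h02,
      LieSubalgebra.coe_bracket, LieRing.of_associative_ring_bracket, Matrix.sub_apply,
      Matrix.mul_apply, Fin.sum_univ_two, sl_entry]
    match_scalars
    · ring
    · linear_combination (2 * (M.1 1 0 * M'.1 0 0 + M'.1 0 0 * M.1 0 1 - M.1 0 0 * M'.1 1 0 -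
        M.1 0 0 * M'.1 0 1)) * Complex.I_sq
    · ring

theorem IsTripleFamily.hom_apply (hv : IsTripleFamily v) (s : Fin r)
    (M : LieAlgebra.SpecialLinear.sl (Fin 2) ℂ) :
    hv.hom s M = (Complex.I * (M.1 0 1 + M.1 1 0)) • v s 0 + (M.1 1 0 - M.1 0 1) • v s 1 +
      (2 * Complex.I * M.1 0 0) • v s 2 := rfl

theorem IsTripleFamily.mem_range_hom (hv : IsTripleFamily v) (s : Fin r) (i : Fin 3) :
    ∃ M, hv.hom s M = v s i := by
  have hI := Complex.I_mul_I
  have htr : ∀ M : Matrix (Fin 2) (Fin 2) ℂ, M 0 0 + M 1 1 = 0 →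
      M ∈ LieAlgebra.SpecialLinear.sl (Fin 2) ℂ := by
    intro M h
    refine LinearMap.mem_ker.2 ?_
    rw [← h]
    exact Matrix.trace_fin_two M
  fin_cases i
  · refine ⟨⟨!![0, -(Complex.I / 2); -(Complex.I / 2), 0], htr _ (by simp)⟩, ?_⟩
    change (Complex.I * (-(Complex.I / 2) + -(Complex.I / 2))) • v s 0 +
      (-(Complex.I / 2) - -(Complex.I / 2)) • v s 1 + (2 * Complex.I * 0) • v s 2 = v s 0
    match_scalars <;> first | ring1 | linear_combination -hI
  · refine ⟨⟨!![0, -(1 / 2); 1 / 2, 0], htr _ (by simp)⟩, ?_⟩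
    change (Complex.I * (-(1 / 2) + 1 / 2)) • v s 0 +
      ((1 / 2) - -(1 / 2) : ℂ) • v s 1 + (2 * Complex.I * 0) • v s 2 = v s 1
    match_scalars <;> ring
  · refine ⟨⟨!![-(Complex.I / 2), 0; 0, Complex.I / 2], htr _ (by simp)⟩, ?_⟩
    change (Complex.I * (0 + 0)) • v s 0 +
      (0 - 0 : ℂ) • v s 1 + (2 * Complex.I * -(Complex.I / 2)) • v s 2 = v s 2
    match_scalars <;> first | ring1 | linear_combination -hI

/-- The homomorphism from the sum of `r` copies of `𝔰𝔩(2, ℂ)` given by `r` commuting triples. -/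
def IsTripleFamily.sumHom (hv : IsTripleFamily v) : sl2Sum r →ₗ⁅ℂ⁆ K :=
  DirectSum.toLieAlgebra (L := fun _ : Fin r => LieAlgebra.SpecialLinear.sl (Fin 2) ℂ) K hv.hom
    fun s s' hs M M' => by
      rw [hv.hom_apply, hv.hom_apply]
      simp only [lie_add, add_lie, lie_smul, smul_lie, hv.lie_of_ne s s' hs, smul_zero, add_zero]

theorem IsTripleFamily.range_sumHom (hv : IsTripleFamily v) :
    LinearMap.range (hv.sumHom : sl2Sum r →ₗ[ℂ] K) =
      Submodule.span ℂ (Set.range fun p : Fin r × Fin 3 => v p.1 p.2) := by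
  have happ : ∀ s M, hv.sumHom (DirectSum.of (fun _ : Fin r =>
      LieAlgebra.SpecialLinear.sl (Fin 2) ℂ) s M) = hv.hom s M :=
    fun s M => DirectSum.toModule_lof ℂ
      (φ := fun s => (hv.hom s : LieAlgebra.SpecialLinear.sl (Fin 2) ℂ →ₗ[ℂ] K)) s M
  apply le_antisymm
  · rintro _ ⟨x, rfl⟩
    have hmem : ∀ s i, v s i ∈ Submodule.span ℂ (Set.range fun p : Fin r × Fin 3 => v p.1 p.2) :=
      fun s i => Submodule.subset_span ⟨(s, i), rfl⟩
    induction x using DirectSum.induction_on with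
    | zero => rw [map_zero]; exact zero_mem _
    | of s M =>
      change hv.sumHom _ ∈ _
      rw [happ]
      exact add_mem (add_mem (Submodule.smul_mem _ _ (hmem s 0))
        (Submodule.smul_mem _ _ (hmem s 1))) (Submodule.smul_mem _ _ (hmem s 2))
    | add x y hx hy => rw [map_add]; exact add_mem hx hy
  · rw [Submodule.span_le]
    rintro _ ⟨⟨s, i⟩, rfl⟩
    obtain ⟨M, hM⟩ := hv.mem_range_hom s i
    exact ⟨_, (happ s M).trans hM⟩

theorem finrank_sl_le : Module.finrank ℂ (LieAlgebra.SpecialLinear.sl (Fin 2) ℂ) ≤ 3 := by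
  let φ : LieAlgebra.SpecialLinear.sl (Fin 2) ℂ →ₗ[ℂ] (Fin 3 → ℂ) :=
    { toFun := fun M => ![M.1 0 0, M.1 0 1, M.1 1 0]
      map_add' := fun M M' => by ext i; fin_cases i <;> rfl
      map_smul' := fun c M => by ext i; fin_cases i <;> rfl }
  have hφ : Function.Injective φ := by
    rw [injective_iff_map_eq_zero]
    intro M hM
    have h0 : M.1 0 0 = 0 := congrFun hM 0
    have h1 : M.1 0 1 = 0 := congrFun hM 1
    have h2 : M.1 1 0 = 0 := congrFun hM 2
    apply Subtype.ext
    ext i j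
    fin_cases i <;> fin_cases j
    · exact h0
    · exact h1
    · exact h2
    · exact (sl_entry M).trans (by rw [h0, neg_zero]; rfl)
  simpa using LinearMap.finrank_le_finrank_of_injective hφ

instance finite_sl : Module.Finite ℂ (LieAlgebra.SpecialLinear.sl (Fin 2) ℂ) :=
  Module.Finite.of_injective
    (LieAlgebra.SpecialLinear.sl (Fin 2) ℂ).toSubmodule.subtype Subtype.val_injective

theorem IsTripleFamily.injective_sumHom (hv : IsTripleFamily v)
    (hdim : 3 * r ≤ Module.finrank ℂ
      (Submodule.span ℂ (Set.range fun p : Fin r × Fin 3 => v p.1 p.2))) :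
    Function.Injective hv.sumHom := by
  have h1 : Module.finrank ℂ (sl2Sum r) ≤ 3 * r := by
    rw [Module.finrank_directSum, Finset.sum_const, Finset.card_univ, Fintype.card_fin,
      smul_eq_mul, mul_comm]
    exact Nat.mul_le_mul_right r finrank_sl_le
  rw [← hv.range_sumHom] at hdim
  have h2 := (hv.sumHom : sl2Sum r →ₗ[ℂ] K).finrank_range_add_finrank_ker
  have h3 : Module.finrank ℂ (LinearMap.ker (hv.sumHom : sl2Sum r →ₗ[ℂ] K)) = 0 := by omega
  rw [Submodule.finrank_eq_zero] at h3
  exact LinearMap.ker_eq_bot.1 h3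

variable [Module.Finite ℂ K]

/-- If commuting triples span a complement of a solvable ideal `C`, then `C` is the radical: the
coefficient of an element of the radical at a member of a triple is isolated by two brackets, so
if it does not vanish, then the radical contains the triple, which is perfect. -/
theorem IsTripleFamily.radical_eq (hv : IsTripleFamily v) (C : LieIdeal ℂ K)
    [LieAlgebra.IsSolvable C]
    (hC : Submodule.span ℂ (Set.range fun p : Fin r × Fin 3 => v p.1 p.2) ⊔ C.toSubmodule = ⊤) :
    LieAlgebra.radical ℂ K = C := by
  have hle : C ≤ LieAlgebra.radical ℂ K :=
    (LieAlgebra.LieIdeal.solvable_iff_le_radical ℂ K C).1 inferInstance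
  refine le_antisymm (fun x hx => ?_) hle
  obtain ⟨y, hy, z, hz, rfl⟩ := Submodule.mem_sup.1 (hC ▸ Submodule.mem_top : x ∈ _)
  have hyr : y ∈ LieAlgebra.radical ℂ K := (add_mem_cancel_right (hle hz)).1 hx
  have hfin : ∀ i : Fin 3, i + 1 + 1 = i + 2 ∧ i + 1 + 2 = i ∧ i + 2 + 1 = i ∧ i + 2 + 2 = i + 1 ∧
      ∀ j, j = i ∨ j = i + 1 ∨ j = i + 2 := by decide
  -- a triple with a member in the radical vanishes
  have hzero : ∀ s i, v s i ∈ LieAlgebra.radical ℂ K → ∀ j, v s j = 0 := by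
    intro s i hi
    have hi2 : v s (i + 2) ∈ LieAlgebra.radical ℂ K := by
      rw [← hv.lie_succ]
      exact lie_mem_left ℂ K _ _ _ hi
    have hi1 : v s (i + 1) ∈ LieAlgebra.radical ℂ K := by
      have e := (hfin i).2.2.2.1
      rw [← e, ← hv.lie_succ]
      exact lie_mem_left ℂ K _ _ _ hi2
    have hall : ∀ j, v s j ∈ LieAlgebra.radical ℂ K := by
      intro j
      rcases (hfin i).2.2.2.2 j with rfl | rfl | rfl <;> assumption
    obtain ⟨k, hk⟩ := (LieAlgebra.isSolvable_iff ℂ (LieAlgebra.radical ℂ K)).1 inferInstance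
    rw [LieIdeal.derivedSeries_eq_bot_iff] at hk
    have hser : ∀ m j, v s j ∈ LieAlgebra.derivedSeriesOfIdeal ℂ K m (LieAlgebra.radical ℂ K) := by
      intro m
      induction m with
      | zero => exact hall
      | succ m ih =>
        intro j
        have e := (hfin j).2.1
        rw [LieAlgebra.derivedSeriesOfIdeal_succ, ← e, ← hv.lie_succ]
        exact LieSubmodule.lie_mem_lie (ih _) (ih _)
    intro j
    have := hser k j
    rw [hk] at this
    exact this
  obtain ⟨c, rfl⟩ := (Submodule.mem_span_range_iff_exists_fun ℂ).1 hy
  have hcoef : ∀ s i, c (s, i) • v s i = 0 := by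
    intro s i
    by_cases hc : c (s, i) = 0
    · rw [hc, zero_smul]
    -- `⁅v s i, ⁅v s (i + 2), y⁆⁆` is the multiple of `v s (i + 2)` by the coefficient at `v s i`
    have e1 : ⁅v s (i + 2), ∑ p : Fin r × Fin 3, c p • v p.1 p.2⁆ =
        c (s, i) • v s (i + 1) - c (s, i + 1) • v s i := by
      obtain ⟨h3, h4, h1, h2, -⟩ := hfin i
      rw [Fintype.sum_prod_type, lie_sum, Finset.sum_eq_single s]
      · have hs : ∀ f : Fin 3 → K, ∑ j, f j = f i + f (i + 1) + f (i + 2) := by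
          intro f
          rw [Fin.sum_univ_three]
          fin_cases i
          · rfl
          · change _ = f 1 + f 2 + f 0
            abel
          · change _ = f 2 + f 0 + f 1
            abel
        have h5 := hv.lie_succ s (i + 2)
        have h6 := hv.lie_succ s (i + 1)
        rw [h1, h2] at h5
        rw [h3, h4] at h6
        rw [hs, lie_add, lie_add, lie_smul, lie_smul, lie_smul, lie_self, h5, ← lie_skew, h6]
        module
      · intro s' _ hs'
        rw [lie_sum]
        refine Finset.sum_eq_zero fun j _ => ?_
        rw [lie_smul, hv.lie_of_ne s s' hs'.symm, smul_zero]
      · simp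
    have e2 := congrArg (fun w => ⁅v s i, w⁆) e1
    simp only [lie_sub, lie_smul, lie_self, smul_zero, sub_zero, hv.lie_succ] at e2
    have h1 : c (s, i) • v s (i + 2) ∈ LieAlgebra.radical ℂ K := by
      rw [← e2]
      exact lie_mem_right ℂ K _ _ _ (lie_mem_right ℂ K _ _ _ hyr)
    have h2 := (LieAlgebra.radical ℂ K).smul_mem (c (s, i))⁻¹ h1
    rw [smul_smul, inv_mul_cancel₀ hc, one_smul] at h2
    rw [hzero s (i + 2) h2 i, smul_zero]
  rw [Finset.sum_eq_zero fun p _ => hcoef p.1 p.2, zero_add]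
  exact hz

omit [Module.Finite ℂ K] in
/-- A complement `S` of the radical is isomorphic to any Lie algebra `A` that is embedded as a
complement of the radical: project along the radical. -/
theorem IsLevi.nonempty_equiv {A : Type} [LieRing A] [LieAlgebra ℂ A] {φ : A →ₗ⁅ℂ⁆ K}
    (hinj : Function.Injective φ)
    (hφ : IsCompl φ.range.toSubmodule (LieAlgebra.radical ℂ K).toSubmodule)
    {S : LieSubalgebra ℂ K} (hS : IsLevi S) : Nonempty (S ≃ₗ⁅ℂ⁆ A) := by
  let R := LieAlgebra.radical ℂ K
  let π : K →ₗ[ℂ] S := S.toSubmodule.projectionOnto R.toSubmodule hS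
  have hπ : ∀ x : S, π x = x := fun x => Submodule.projectionOnto_apply_left hS x
  have hker : ∀ x, π x = 0 ↔ x ∈ R := fun x => Submodule.projectionOnto_apply_eq_zero_iff hS
  have hsub : ∀ x, x - π x ∈ R := fun x => (hker _).1 (by rw [map_sub, hπ, sub_self])
  have hlie : ∀ x y, π ⁅x, y⁆ = ⁅π x, π y⁆ := by
    intro x y
    have h : ⁅x, y⁆ - (⁅π x, π y⁆ : S) ∈ R := by
      have e : ⁅x, y⁆ - (⁅π x, π y⁆ : S) = ⁅x - π x, y⁆ + ⁅(π x : K), y - π y⁆ := by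
        rw [LieSubalgebra.coe_bracket, sub_lie, lie_sub]
        abel
      rw [e]
      exact add_mem (lie_mem_left ℂ K R _ _ (hsub x)) (lie_mem_right ℂ K R _ _ (hsub y))
    rw [← hker, map_sub, hπ, sub_eq_zero] at h
    exact h
  let ψ : A →ₗ⁅ℂ⁆ S :=
    { π ∘ₗ (φ : A →ₗ[ℂ] K) with
      map_lie' := fun {x y} => by
        change π (φ ⁅x, y⁆) = ⁅π (φ x), π (φ y)⁆
        rw [LieHom.map_lie, hlie] }
  refine ⟨(LieEquiv.ofBijective ψ ⟨?_, ?_⟩).symm⟩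
  · rw [injective_iff_map_eq_zero]
    intro x hx
    have h1 : φ x ∈ φ.range.toSubmodule ⊓ R.toSubmodule := ⟨⟨x, rfl⟩, (hker _).1 hx⟩
    rw [hφ.inf_eq_bot] at h1
    exact hinj (h1.trans (map_zero φ).symm)
  · intro y
    obtain ⟨_, ⟨x, rfl⟩, z, hz, e⟩ := Submodule.mem_sup.1
      (hφ.sup_eq_top ▸ Submodule.mem_top : (y : K) ∈ _)
    refine ⟨x, ?_⟩
    have h1 := congrArg π e
    rw [map_add, (hker z).2 hz, add_zero, hπ] at h1
    exact h1

end Triples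

end

section

/-! ### The `𝔰𝔩(2)`-triples carried by a line -/

variable {t : OrthType}

/-- The sum (`σ = 1`) or difference (`σ = -1`) of two commuting elements of the same degree. On
the four-dimensional space with the coordinates `p, c 0, c 1, c 2` these elements span the two
ideals `𝔰𝔬(3)` of `𝔰𝔬(4)`. -/
def quat (t : OrthType) (σ : ℂ) (p : Fin 8) (c : Fin 3 → Fin 8) (i : Fin 3) : t.alg :=
  (2 : ℂ)⁻¹ • (elem t (c (i + 2)) (c (i + 1)) + σ • elem t p (c i))

theorem elem_self (a : Fin 8) : elem t a a = 0 := by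
  apply ext_ent
  intro x y
  have h := congrArg (ent t x y) (elem_swap (t := t) a a)
  rw [map_neg] at h
  rw [map_zero]
  exact self_eq_neg.1 h

theorem fin_three_add : ∀ i : Fin 3, i + 1 + 1 = i + 2 ∧ i + 1 + 2 = i ∧ i + 2 + 1 = i ∧
    i + 2 + 2 = i + 1 ∧ i ≠ i + 1 ∧ i ≠ i + 2 ∧ i + 1 ≠ i + 2 ∧
      ∀ j, j = i ∨ j = i + 1 ∨ j = i + 2 := by decide

section Quat

variable {p : Fin 8} {c : Fin 3 → Fin 8} (hp : p ∈ t.indices) (hc : ∀ i, c i ∈ t.indices)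
  (hinj : Function.Injective c) (hpc : ∀ i, p ≠ c i)

include hc hinj in
theorem lie_elem_succ (i : Fin 3) :
    ⁅elem t (c (i + 2)) (c (i + 1)), elem t (c (i + 1 + 2)) (c (i + 1 + 1))⁆ =
      elem t (c (i + 2 + 2)) (c (i + 2 + 1)) := by
  obtain ⟨e1, e2, e3, e4, h1, h2, h3, -⟩ := fin_three_add i
  rw [e1, e2, e3, e4, lie_elem (hc _) (hc _) (hc _) (hc _)]
  simp only [hinj.eq_iff, if_true, if_neg h1.symm, if_neg h2.symm, if_neg h3, sub_zero, zero_add]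

include hp hc hinj hpc in
/-- The product of two consecutive elements; the case `σ' = -σ` shows that the two families
commute. -/
theorem lie_quat_succ (σ σ' : ℂ) (i : Fin 3) : ⁅quat t σ p c i, quat t σ' p c (i + 1)⁆ =
    (4 : ℂ)⁻¹ • ((1 + σ * σ') • elem t (c (i + 1)) (c i) + (σ + σ') • elem t p (c (i + 2))) := by
  obtain ⟨e1, e2, e3, e4, h1, h2, h3, -⟩ := fin_three_add i
  rw [quat, quat, e1, e2]
  simp only [lie_add, add_lie, lie_smul, smul_lie, smul_add,
    lie_elem (hc _) (hc _) (hc _) (hc _), lie_elem (hc _) (hc _) hp (hc _),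
    lie_elem hp (hc _) (hc _) (hc _), lie_elem hp (hc _) hp (hc _)]
  simp only [hinj.eq_iff, if_true, if_neg h1, if_neg h2, if_neg h1.symm, if_neg h2.symm, if_neg h3,
    if_neg h3.symm, if_neg (hpc _), if_neg (hpc _).symm]
  rw [elem_swap p (c (i + 2)), elem_swap (c (i + 1)) (c i)]
  module

include hp hc hinj hpc in
theorem lie_quat_self (σ σ' : ℂ) (i : Fin 3) : ⁅quat t σ p c i, quat t σ' p c i⁆ = 0 := by
  obtain ⟨e1, e2, e3, e4, h1, h2, h3, -⟩ := fin_three_add i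
  rw [quat, quat]
  simp only [lie_add, add_lie, lie_smul, smul_lie, smul_add,
    lie_elem (hc _) (hc _) (hc _) (hc _), lie_elem (hc _) (hc _) hp (hc _),
    lie_elem hp (hc _) (hc _) (hc _), lie_elem hp (hc _) hp (hc _)]
  simp only [hinj.eq_iff, if_true, if_neg h1, if_neg h2, if_neg h1.symm, if_neg h2.symm, if_neg h3,
    if_neg h3.symm, if_neg (hpc _), if_neg (hpc _).symm]
  simp [elem_self]

include hp hc hinj hpc in
theorem lie_quat_same {σ : ℂ} (hσ : σ * σ = 1) (i : Fin 3) :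
    ⁅quat t σ p c i, quat t σ p c (i + 1)⁆ = quat t σ p c (i + 2) := by
  obtain ⟨e1, e2, e3, e4, -⟩ := fin_three_add i
  rw [lie_quat_succ hp hc hinj hpc, hσ, quat, e3, e4]
  module

include hp hc hinj hpc in
theorem lie_quat_opposite {σ : ℂ} (hσ : σ * σ = 1) (i j : Fin 3) :
    ⁅quat t σ p c i, quat t (-σ) p c j⁆ = 0 := by
  obtain ⟨-, -, -, -, -, -, -, h⟩ := fin_three_add i
  rcases h j with rfl | rfl | rfl
  · exact lie_quat_self hp hc hinj hpc _ _ _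
  · rw [lie_quat_succ hp hc hinj hpc, mul_neg, hσ]
    simp
  · have := lie_quat_succ hp hc hinj hpc (-σ) σ (i + 2)
    rw [(fin_three_add i).2.2.1] at this
    rw [← lie_skew, this, neg_mul, hσ]
    simp

include hp hc in
theorem lie_quat_disjoint {p' : Fin 8} {c' : Fin 3 → Fin 8} (hp' : p' ∈ t.indices)
    (hc' : ∀ i, c' i ∈ t.indices) (h1 : p ≠ p') (h2 : ∀ i, p ≠ c' i) (h3 : ∀ i, c i ≠ p')
    (h4 : ∀ i j, c i ≠ c' j) (σ σ' : ℂ) (i j : Fin 3) :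
    ⁅quat t σ p c i, quat t σ' p' c' j⁆ = 0 := by
  rw [quat, quat]
  simp only [lie_add, add_lie, lie_smul, smul_lie, smul_add,
    lie_elem (hc _) (hc _) (hc' _) (hc' _), lie_elem (hc _) (hc _) hp' (hc' _),
    lie_elem hp (hc _) (hc' _) (hc' _), lie_elem hp (hc _) hp' (hc' _)]
  simp [h1, h2, h3, h4]

include hc in
theorem lie_elem_quat_disjoint {p' : Fin 8} {c' : Fin 3 → Fin 8} (hp' : p' ∈ t.indices)
    (hc' : ∀ i, c' i ∈ t.indices) (h3 : ∀ i, c i ≠ p')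
    (h4 : ∀ i j, c i ≠ c' j) (σ' : ℂ) (i i' j : Fin 3) :
    ⁅elem t (c i) (c i'), quat t σ' p' c' j⁆ = 0 := by
  rw [quat]
  simp only [lie_add, lie_smul, smul_add,
    lie_elem (hc _) (hc _) (hc' _) (hc' _), lie_elem (hc _) (hc _) hp' (hc' _)]
  simp [h3, h4]

end Quat

/-- The labels `1, 2, 5` of a line. -/
def lineLabel : Fin 3 → Fin 8 := ![1, 2, 5]

/-- The labels other than `3` in the coset `{3, 6, 7, 4}` of `{0, 1, 2, 5}`, so that
`3 * cosetLabel i = lineLabel i`. -/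
def cosetLabel : Fin 3 → Fin 8 := ![6, 7, 4]

theorem quat_mem {τ : Equiv.Perm (Fin 8)} (hτ : IsCollineation τ) (σ : ℂ) {p : Fin 8}
    {c : Fin 3 → Fin 8} {i : Fin 3}
    (h : star (c (i + 2)) (c (i + 1)) = lineLabel i ∧ star p (c i) = lineLabel i) :
    quat t σ (τ p) (τ ∘ c) i ∈ gradedPart t {τ (lineLabel i)} := by
  refine Submodule.smul_mem _ _ (add_mem ?_ (Submodule.smul_mem _ _ ?_)) <;>
    refine elem_mem_gradedPart (Finset.mem_singleton.2 ?_)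
  · rw [Function.comp_apply, Function.comp_apply, ← hτ.map_star, h.1]
  · rw [Function.comp_apply, ← hτ.map_star, h.2]

theorem elem_mem_of_quat_mem {N : Submodule ℂ t.alg} {p : Fin 8} {c : Fin 3 → Fin 8} {i : Fin 3}
    (h1 : quat t 1 p c i ∈ N) (h2 : quat t (-1) p c i ∈ N) :
    elem t (c (i + 2)) (c (i + 1)) ∈ N ∧ elem t p (c i) ∈ N := by
  constructor
  · have := add_mem h1 h2
    rw [quat, quat] at this
    convert this using 1
    module
  · have := sub_mem h1 h2
    rw [quat, quat] at this
    convert this using 1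
    module

/-- The standard bases of the `r` ideals `𝔰𝔬(3)` of the part of degrees `τ 1, τ 2, τ 5`. For `𝔡₄`
these are the ideals of the two copies of `𝔰𝔬(4)` belonging to the cosets `{0, 1, 2, 5}` and
`{3, 6, 7, 4}`; for `𝔟₃` the first copy is reduced to `𝔰𝔬(3)`. -/
def lineTriples (τ : Equiv.Perm (Fin 8)) : (t : OrthType) → Fin t.r → Fin 3 → t.alg
  | .d4 => ![quat .d4 1 (τ 0) (τ ∘ lineLabel), quat .d4 (-1) (τ 0) (τ ∘ lineLabel),
      quat .d4 1 (τ 3) (τ ∘ cosetLabel), quat .d4 (-1) (τ 3) (τ ∘ cosetLabel)]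
  | .b3 => ![fun i => elem .b3 (τ (lineLabel (i + 2))) (τ (lineLabel (i + 1))),
      quat .b3 1 (τ 3) (τ ∘ cosetLabel), quat .b3 (-1) (τ 3) (τ ∘ cosetLabel)]

theorem lineTriples_spec (t : OrthType) {τ : Equiv.Perm (Fin 8)} (hτ : IsCollineation τ) :
    (∀ s i, ⁅lineTriples τ t s i, lineTriples τ t s (i + 1)⁆ = lineTriples τ t s (i + 2)) ∧
      (∀ s s', s ≠ s' → ∀ i j, ⁅lineTriples τ t s i, lineTriples τ t s' j⁆ = 0) ∧
        (∀ s i, lineTriples τ t s i ∈ gradedPart t {τ (lineLabel i)}) ∧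
          gradedPart t (({1, 2, 5} : Finset (Fin 8)).image τ) ≤
            Submodule.span ℂ (Set.range fun q : Fin t.r × Fin 3 => lineTriples τ t q.1 q.2) := by
  have hl : ∀ i, star (lineLabel (i + 2)) (lineLabel (i + 1)) = lineLabel i ∧
      star 0 (lineLabel i) = lineLabel i := by decide
  have hl' : ∀ i, star (cosetLabel (i + 2)) (cosetLabel (i + 1)) = lineLabel i ∧
      star 3 (cosetLabel i) = lineLabel i := by decide
  have hinj : Function.Injective (τ ∘ lineLabel) := τ.injective.comp (by decide)
  have hinj' : Function.Injective (τ ∘ cosetLabel) := τ.injective.comp (by decide)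
  have hp : ∀ i, τ 0 ≠ (τ ∘ lineLabel) i := fun i =>
    τ.injective.ne ((by decide : ∀ i, 0 ≠ lineLabel i) i)
  have hp' : ∀ i, τ 3 ≠ (τ ∘ cosetLabel) i := fun i =>
    τ.injective.ne ((by decide : ∀ i, 3 ≠ cosetLabel i) i)
  have h1 : τ 0 ≠ τ 3 := τ.injective.ne (by decide)
  have h2 : ∀ i, τ 0 ≠ (τ ∘ cosetLabel) i := fun i =>
    τ.injective.ne ((by decide : ∀ i, 0 ≠ cosetLabel i) i)
  have h3 : ∀ i, (τ ∘ lineLabel) i ≠ τ 3 := fun i =>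
    τ.injective.ne ((by decide : ∀ i, lineLabel i ≠ 3) i)
  have h4 : ∀ i j, (τ ∘ lineLabel) i ≠ (τ ∘ cosetLabel) j := fun i j =>
    τ.injective.ne ((by decide : ∀ i j, lineLabel i ≠ cosetLabel j) i j)
  have hi : ∀ i, (τ ∘ lineLabel) i ∈ t.indices := fun i =>
    t.mem_indices_of_ne_zero (hτ.ne_zero.2 ((by decide : ∀ i, lineLabel i ≠ 0) i))
  have hi' : ∀ i, (τ ∘ cosetLabel) i ∈ t.indices := fun i =>
    t.mem_indices_of_ne_zero (hτ.ne_zero.2 ((by decide : ∀ i, cosetLabel i ≠ 0) i))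
  have hi3 : τ 3 ∈ t.indices := t.mem_indices_of_ne_zero (hτ.ne_zero.2 (by decide))
  have hσ : (1 : ℂ) * 1 = 1 := one_mul 1
  have hσ' : (-1 : ℂ) * -1 = 1 := by norm_num
  -- every matrix `elem t a b` of one of the degrees `τ 1, τ 2, τ 5` is one of the following
  have hle : ∀ N : Submodule ℂ t.alg,
      (∀ i, elem t (τ (lineLabel (i + 2))) (τ (lineLabel (i + 1))) ∈ N) →
      (τ 0 ∈ t.indices → ∀ i, elem t (τ 0) (τ (lineLabel i)) ∈ N) →
      (∀ i, elem t (τ (cosetLabel (i + 2))) (τ (cosetLabel (i + 1))) ∈ N ∧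
        elem t (τ 3) (τ (cosetLabel i)) ∈ N) →
      gradedPart t (({1, 2, 5} : Finset (Fin 8)).image τ) ≤ N := by
    intro N n1 n2 n3
    refine gradedPart_le fun a ha b hb hab h => ?_
    obtain ⟨a, rfl⟩ := τ.surjective a
    obtain ⟨b, rfl⟩ := τ.surjective b
    rw [← hτ.map_star, Function.Injective.mem_finset_image τ.injective] at h
    have facts : ∀ a b : Fin 8, star a b ∈ ({1, 2, 5} : Finset (Fin 8)) → ∃ i : Fin 3,
        (a = lineLabel (i + 2) ∧ b = lineLabel (i + 1)) ∨
        (b = lineLabel (i + 2) ∧ a = lineLabel (i + 1)) ∨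
        (a = cosetLabel (i + 2) ∧ b = cosetLabel (i + 1)) ∨
        (b = cosetLabel (i + 2) ∧ a = cosetLabel (i + 1)) ∨
        (a = 0 ∧ b = lineLabel i) ∨ (b = 0 ∧ a = lineLabel i) ∨
        (a = 3 ∧ b = cosetLabel i) ∨ (b = 3 ∧ a = cosetLabel i) := by decide +kernel
    obtain ⟨i, ⟨rfl, rfl⟩ | ⟨rfl, rfl⟩ | ⟨rfl, rfl⟩ | ⟨rfl, rfl⟩ | ⟨rfl, rfl⟩ | ⟨rfl, rfl⟩ |
      ⟨rfl, rfl⟩ | ⟨rfl, rfl⟩⟩ := facts a b h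
    · exact n1 i
    · rw [elem_swap]; exact neg_mem (n1 i)
    · exact (n3 i).1
    · rw [elem_swap]; exact neg_mem (n3 i).1
    · exact n2 ha i
    · rw [elem_swap]; exact neg_mem (n2 hb i)
    · exact (n3 i).2
    · rw [elem_swap]; exact neg_mem (n3 i).2
  cases t with
  | d4 =>
    have hi0 : τ 0 ∈ OrthType.d4.indices := Finset.mem_univ _
    refine ⟨fun s i => ?_, fun s s' hs i j => ?_, fun s i => ?_, ?_⟩
    · fin_cases s
      · exact lie_quat_same hi0 hi hinj hp hσ i
      · exact lie_quat_same hi0 hi hinj hp hσ' i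
      · exact lie_quat_same hi3 hi' hinj' hp' hσ i
      · exact lie_quat_same hi3 hi' hinj' hp' hσ' i
    · have hlt : ∀ s s' : Fin 4, s < s' → ∀ i j,
          ⁅lineTriples τ .d4 s i, lineTriples τ .d4 s' j⁆ = 0 := by
        intro s s' h i j
        fin_cases s <;> fin_cases s' <;> first
          | exact absurd h (by decide)
          | exact lie_quat_opposite hi0 hi hinj hp hσ i j
          | exact lie_quat_opposite hi3 hi' hinj' hp' hσ i j
          | exact lie_quat_disjoint hi0 hi hi3 hi' h1 h2 h3 h4 _ _ i j
      rcases lt_or_gt_of_ne hs with h | h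
      · exact hlt s s' h i j
      · rw [← lie_skew, hlt s' s h j i, neg_zero]
    · fin_cases s
      · exact quat_mem hτ 1 (hl i)
      · exact quat_mem hτ (-1) (hl i)
      · exact quat_mem hτ 1 (hl' i)
      · exact quat_mem hτ (-1) (hl' i)
    · have hm : ∀ (s : Fin 4) (i : Fin 3), _ := fun s i =>
        Submodule.subset_span (R := ℂ) (Set.mem_range_self (f := fun q : Fin 4 × Fin 3 =>
          lineTriples τ .d4 q.1 q.2) (s, i))
      have k1 := fun i => elem_mem_of_quat_mem (hm 0 i) (hm 1 i)
      exact hle _ (fun i => (k1 i).1) (fun _ i => (k1 i).2)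
        (fun i => elem_mem_of_quat_mem (hm 2 i) (hm 3 i))
  | b3 =>
    have hi0 : τ 0 ∉ OrthType.b3.indices := by rw [hτ.1]; decide
    refine ⟨fun s i => ?_, fun s s' hs i j => ?_, fun s i => ?_, ?_⟩
    · fin_cases s
      · exact lie_elem_succ hi hinj i
      · exact lie_quat_same hi3 hi' hinj' hp' hσ i
      · exact lie_quat_same hi3 hi' hinj' hp' hσ' i
    · have hlt : ∀ s s' : Fin 3, s < s' → ∀ i j,
          ⁅lineTriples τ .b3 s i, lineTriples τ .b3 s' j⁆ = 0 := by
        intro s s' h i j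
        fin_cases s <;> fin_cases s' <;> first
          | exact absurd h (by decide)
          | exact lie_quat_opposite hi3 hi' hinj' hp' hσ i j
          | exact lie_elem_quat_disjoint hi hi3 hi' h3 h4 _ _ _ j
      rcases lt_or_gt_of_ne hs with h | h
      · exact hlt s s' h i j
      · rw [← lie_skew, hlt s' s h j i, neg_zero]
    · fin_cases s
      · refine elem_mem_gradedPart (Finset.mem_singleton.2 ?_)
        rw [← hτ.map_star, (hl i).1]
      · exact quat_mem hτ 1 (hl' i)
      · exact quat_mem hτ (-1) (hl' i)
    · have hm : ∀ (s : Fin 3) (i : Fin 3), _ := fun s i =>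
        Submodule.subset_span (R := ℂ) (Set.mem_range_self (f := fun q : Fin 3 × Fin 3 =>
          lineTriples τ .b3 q.1 q.2) (s, i))
      exact hle _ (hm 0) (fun h => absurd h hi0)
        (fun i => elem_mem_of_quat_mem (hm 1 i) (hm 2 i))

end

section

/-! ### Radical and Levi subalgebras for the supports containing a full line -/

variable {t : OrthType} {ε : G → G → ℂ} {hε : IsGradedContraction (component t.alg) ε}
  {T N : Finset (Sym2 (Fin 8))}

instance finite_contracted : Module.Finite ℂ (Contracted hε) :=
  Module.Finite.equiv (toContracted hε)

theorem lie_toContracted_of_mem {i j : Fin 8} {x y : t.alg} (hx : x ∈ gradedPart t {i})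
    (hy : y ∈ gradedPart t {j}) : ⁅toContracted hε x, toContracted hε y⁆ =
      coef ε i j • toContracted hε ⁅x, y⁆ := by
  rw [gradedPart_singleton] at hx hy
  rw [lie_toContracted, contractedBracket_of_mem _ ε hx hy, map_smul]
  rfl

/-- The factors by which three vectors with the structure constants `e 0, e 1, e 2` have to be
scaled to obtain the structure constants `1`. -/
theorem exists_scaling (e : Fin 3 → ℂ) (he : ∀ i, e i ≠ 0) : ∃ l : Fin 3 → ℂ,
    (∀ i, l i ≠ 0) ∧ ∀ i, l i * l (i + 1) * e i = l (i + 2) := by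
  -- the equations force `l 0 ^ 2 * e 0 * e 2 = 1` and `l 1 ^ 2 * e 0 * e 1 = 1`
  obtain ⟨a, ha⟩ := IsAlgClosed.exists_eq_mul_self ((e 0 * e 2)⁻¹)
  obtain ⟨b, hb⟩ := IsAlgClosed.exists_eq_mul_self ((e 0 * e 1)⁻¹)
  have h0 := he 0
  have h1 := he 1
  have h2 := he 2
  have ha' : a * a * (e 0 * e 2) = 1 := by rw [← ha, inv_mul_cancel₀ (mul_ne_zero h0 h2)]
  have hb' : b * b * (e 0 * e 1) = 1 := by rw [← hb, inv_mul_cancel₀ (mul_ne_zero h0 h1)]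
  have ha0 : a ≠ 0 := by rintro rfl; simp at ha'
  have hb0 : b ≠ 0 := by rintro rfl; simp at hb'
  refine ⟨![a, b, a * b * e 0], fun i => ?_, fun i => ?_⟩
  · fin_cases i
    · exact ha0
    · exact hb0
    · exact mul_ne_zero (mul_ne_zero ha0 hb0) h0
  · fin_cases i
    · rfl
    · change b * (a * b * e 0) * e 1 = a
      linear_combination a * hb'
    · change a * b * e 0 * a * e 2 = b
      linear_combination b * ha'

/-- If the support contains all edges of the line `τ {1, 2, 5}`, then the part of these degrees is
a direct sum of `r` copies of `𝔰𝔩(2)`. -/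
theorem exists_isTripleFamily (hadm : IsAdmissible ε) (hT : supp ε = T)
    {τ : Equiv.Perm (Fin 8)} (hτ : IsCollineation τ)
    (h : ∀ i, s(τ (lineLabel i), τ (lineLabel (i + 1))) ∈ T) :
    ∃ v : Fin t.r → Fin 3 → Contracted hε, IsTripleFamily v ∧
      Submodule.span ℂ (Set.range fun q : Fin t.r × Fin 3 => v q.1 q.2) =
        part hε (({1, 2, 5} : Finset (Fin 8)).image τ) := by
  obtain ⟨h1, h2, h3, h4⟩ := lineTriples_spec t hτ
  let u := lineTriples τ t
  obtain ⟨l, hl0, hl⟩ := exists_scaling (fun i => coef ε (τ (lineLabel i)) (τ (lineLabel (i + 1))))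
    fun i => (coef_ne_zero_iff hε hadm hT).2 (h i)
  refine ⟨fun s i => l i • toContracted hε (u s i), ⟨fun s i => ?_, fun s s' hs i j => ?_⟩,
    le_antisymm (Submodule.span_le.2 ?_) ?_⟩
  · rw [lie_smul, smul_lie, lie_toContracted_of_mem (h3 s i) (h3 s (i + 1)), h1, smul_smul,
      smul_smul, ← hl]
    congr 1
    ring
  · rw [lie_smul, smul_lie, lie_toContracted_of_mem (h3 s i) (h3 s' j), h2 s s' hs, map_zero,
      smul_zero, smul_zero, smul_zero]
  · rintro _ ⟨⟨s, i⟩, rfl⟩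
    refine Submodule.smul_mem _ _ (Submodule.mem_map_of_mem (gradedPart_mono ?_ (h3 s i)))
    rw [Finset.singleton_subset_iff]
    exact Finset.mem_image_of_mem _ ((by decide : ∀ i, lineLabel i ∈ ({1, 2, 5} : Finset _)) i)
  · refine (Submodule.map_mono h4).trans ?_
    rw [Submodule.map_span_le]
    rintro _ ⟨⟨s, i⟩, rfl⟩
    have := Submodule.smul_mem _ (l i)⁻¹ (Submodule.subset_span (R := ℂ)
      (Set.mem_range_self (f := fun q : Fin t.r × Fin 3 => l q.2 • toContracted hε (u q.1 q.2))
        (s, i)))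
    rwa [smul_smul, inv_mul_cancel₀ (hl0 i), one_smul] at this

/-- Under conditions that say that the sum of the components off the line `{1, 2, 5}` is an
abelian ideal: this ideal is the radical, and the sum of the components on the line is a Levi
subalgebra. -/
theorem exists_radical_eq_part (hadm : IsAdmissible ε) (h : CollinearSets (supp ε) N)
    (hN : ∀ i, s(lineLabel i, lineLabel (i + 1)) ∈ N)
    (hstep : step N points {3, 4, 6, 7} ⊆ {3, 4, 6, 7})
    (hstep' : step N {3, 4, 6, 7} {3, 4, 6, 7} = ∅) :
    ∃ τ : Equiv.Perm (Fin 8), IsCollineation τ ∧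
      supp ε = (N.image (Sym2.map τ) : Finset (Sym2 (Fin 8))) ∧
      (LieAlgebra.radical ℂ (Contracted hε)).toSubmodule =
        part hε (({3, 4, 6, 7} : Finset (Fin 8)).image τ) ∧
      ∃ φ : sl2Sum t.r →ₗ⁅ℂ⁆ Contracted hε, Function.Injective φ ∧
        IsCompl φ.range.toSubmodule (LieAlgebra.radical ℂ (Contracted hε)).toSubmodule := by
  obtain ⟨τ, hτ, hT⟩ := h.exists_image
  refine ⟨τ, hτ, hT, ?_⟩
  obtain ⟨v, hv, hspan⟩ := exists_isTripleFamily (hε := hε) hadm hT hτ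
    fun i => (mk_mem_image τ N _ _).2 (hN i)
  let C : LieIdeal ℂ (Contracted hε) :=
    { part hε (({3, 4, 6, 7} : Finset (Fin 8)).image τ) with
      lie_mem := fun {x m} hm => by
        have h1 := lie_mem_part_step hadm hT (part_points (hε := hε) ▸ Submodule.mem_top :
          x ∈ part hε points) hm
        rw [← hτ.image_points, hτ.step_image] at h1
        rw [mem_part] at h1
        exact mem_part.2 fun a b hab => Finset.image_subset_image hstep (h1 a b hab) }
  have hC : IsLieAbelian C := by
    refine ⟨fun x y => Subtype.ext ?_⟩
    have h1 := lie_mem_part_step hadm hT x.2 y.2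
    rw [hτ.step_image, hstep', Finset.image_empty,
      (part_eq_bot (Finset.notMem_empty _)).2 rfl] at h1
    exact h1
  have h0 : ∀ S : Finset (Fin 8), 0 ∉ S → 0 ∉ S.image τ := by
    intro S hS h
    rw [← hτ.1, Function.Injective.mem_finset_image τ.injective] at h
    exact hS h
  have hcompl : IsCompl (part hε (({1, 2, 5} : Finset (Fin 8)).image τ))
      (part hε (({3, 4, 6, 7} : Finset (Fin 8)).image τ)) := by
    constructor
    · rw [disjoint_iff, part_inf, ← Finset.image_inter _ _ τ.injective]
      exact (part_eq_bot (h0 _ (by decide))).2 rfl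
    · rw [codisjoint_iff, part_sup, ← Finset.image_union,
        (by decide : ({1, 2, 5} : Finset (Fin 8)) ∪ {3, 4, 6, 7} = points), hτ.image_points,
        part_points]
  have hrad := hv.radical_eq C (hspan ▸ hcompl.sup_eq_top)
  have hrange : hv.sumHom.range.toSubmodule = part hε (({1, 2, 5} : Finset (Fin 8)).image τ) :=
    hv.range_sumHom.trans hspan
  refine ⟨by rw [hrad], hv.sumHom, hv.injective_sumHom ?_, ?_⟩
  · rw [hspan, finrank_part (h0 _ (by decide)), Finset.card_image_of_injective _ τ.injective,
      mul_comm]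
    rfl
  · rw [hrange, hrad]
    exact hcompl

end

section

/-! ### Simplicity for the full support -/

variable {t : OrthType} {ε : G → G → ℂ} {hε : IsGradedContraction (component t.alg) ε}

theorem cent_lie_celem_left (hsymm : ∀ i j, coef ε i j = coef ε j i) {a b y : Fin 8}
    (ha : a ∈ t.indices) (hb : b ∈ t.indices) (hab : a ≠ b) (hya : y ≠ a) (hyb : y ≠ b)
    (z : Contracted hε) :
    cent hε a y ⁅celem hε a b, z⁆ = coef ε (star a b) (star b y) * cent hε b y z := by
  rw [cent_lie hsymm, Finset.sum_eq_single b]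
  · simp [cent_celem ha hb, hab, hya, hyb]
  · intro c _ hc
    simp [cent_celem ha hb, hab, hya, hyb, hc]
  · simp

theorem cent_lie_celem_right (hsymm : ∀ i j, coef ε i j = coef ε j i) {a b y : Fin 8}
    (ha : a ∈ t.indices) (hb : b ∈ t.indices) (hab : a ≠ b) (hya : y ≠ a) (hyb : y ≠ b)
    (z : Contracted hε) :
    cent hε b y ⁅celem hε a b, z⁆ = -(coef ε (star b a) (star a y) * cent hε a y z) := by
  rw [celem_swap, neg_lie, map_neg, cent_lie_celem_left hsymm hb ha hab.symm hyb hya]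

/-- The bracket with `celem hε a b` moves the entries in the rows and columns `a` and `b`, and
kills all others. -/
theorem cent_lie_celem_ne_zero (hsymm : ∀ i j, coef ε i j = coef ε j i) {a b : Fin 8}
    (ha : a ∈ t.indices) (hb : b ∈ t.indices) (hab : a ≠ b) {z : Contracted hε} {x y : Fin 8}
    (h : cent hε x y ⁅celem hε a b, z⁆ ≠ 0) :
    (x = a ∧ y ≠ a ∧ y ≠ b ∧ cent hε b y z ≠ 0) ∨ (x = b ∧ y ≠ a ∧ y ≠ b ∧ cent hε a y z ≠ 0) ∨
      (y = a ∧ x ≠ a ∧ x ≠ b ∧ cent hε x b z ≠ 0) ∨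
        (y = b ∧ x ≠ a ∧ x ≠ b ∧ cent hε x a z ≠ 0) := by
  have hxy := (mem_indices_of_cent_ne_zero h).2.2
  have h' := h
  rw [cent_skew, neg_ne_zero] at h'
  have key : cent hε a b ⁅celem hε a b, z⁆ = 0 := by
    rw [cent_lie hsymm]
    refine Finset.sum_eq_zero fun c _ => ?_
    have hzero : ∀ u, cent hε u u z = 0 := fun u => by
      by_contra h
      exact (mem_indices_of_cent_ne_zero h).2.2 rfl
    by_cases hcb : c = b
    · subst hcb
      simp [cent_celem ha hb, hab, hab.symm, hzero]
    by_cases hca : c = a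
    · subst hca
      simp [cent_celem ha hb, hab, hzero]
    simp [cent_celem ha hb, hab, hab.symm, hcb, hca]
  by_cases hxa : x = a
  · subst hxa
    by_cases hyb : y = b
    · subst hyb
      exact absurd key h
    rw [cent_lie_celem_left hsymm ha hb hab hxy.symm hyb] at h
    exact Or.inl ⟨rfl, hxy.symm, hyb, right_ne_zero_of_mul h⟩
  by_cases hxb : x = b
  · subst hxb
    by_cases hya : y = a
    · subst hya
      exact absurd key h'
    rw [cent_lie_celem_right hsymm ha hb hab hya hxy.symm, neg_ne_zero] at h
    exact Or.inr (Or.inl ⟨rfl, hya, hxy.symm, right_ne_zero_of_mul h⟩)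
  by_cases hya : y = a
  · subst hya
    rw [cent_lie_celem_left hsymm ha hb hab hxa hxb] at h'
    have := right_ne_zero_of_mul h'
    rw [cent_skew, neg_ne_zero] at this
    exact Or.inr (Or.inr (Or.inl ⟨rfl, hxa, hxb, this⟩))
  by_cases hyb : y = b
  · subst hyb
    rw [cent_lie_celem_right hsymm ha hb hab hxa hxb, neg_ne_zero] at h'
    have := right_ne_zero_of_mul h'
    rw [cent_skew, neg_ne_zero] at this
    exact Or.inr (Or.inr (Or.inr ⟨rfl, hxa, hxb, this⟩))
  refine absurd ?_ h
  rw [cent_lie hsymm]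
  refine Finset.sum_eq_zero fun c _ => ?_
  simp [cent_celem ha hb, hxa, hxb, hya, hyb]

/-- If the nonzero entries of `z` lie in the rows `A` and columns `B` or vice versa, then the
bracket with `celem hε a b`, for `a, b` outside `B`, replaces `A` by `{b}`, or by `{a, b}` if `b` is
in `A`. -/
theorem cent_lie_celem_support (hsymm : ∀ i j, coef ε i j = coef ε j i) {a b : Fin 8}
    (ha : a ∈ t.indices) (hb : b ∈ t.indices) (hab : a ≠ b) {z : Contracted hε}
    {A B : Fin 8 → Prop} (hz : ∀ x y, cent hε x y z ≠ 0 → (A x ∧ B y) ∨ (A y ∧ B x))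
    (haB : ¬ B a) (hbB : ¬ B b) {x y : Fin 8} (h : cent hε x y ⁅celem hε a b, z⁆ ≠ 0) :
    ((x = b ∨ x = a ∧ A b) ∧ B y) ∨ ((y = b ∨ y = a ∧ A b) ∧ B x) := by
  rcases cent_lie_celem_ne_zero hsymm ha hb hab h with ⟨rfl, -, -, h3⟩ | ⟨rfl, -, -, h3⟩ |
    ⟨rfl, -, -, h3⟩ | ⟨rfl, -, -, h3⟩ <;> have := hz _ _ h3 <;> tauto

theorem isSimple_of_coef_ne_zero (hsymm : ∀ i j, coef ε i j = coef ε j i)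
    (hcoef : ∀ i j, i ≠ 0 → j ≠ 0 → i ≠ j → coef ε i j ≠ 0) :
    LieAlgebra.IsSimple ℂ (Contracted hε) := by
  have hpath : ∀ a b c : Fin 8, a ≠ b → b ≠ c → a ≠ c → coef ε (star a b) (star b c) ≠ 0 := by
    intro a b c hab hbc hac
    refine hcoef _ _ (mt star_eq_zero.1 hab) (mt star_eq_zero.1 hbc) fun e => hac ?_
    rw [star_comm a b] at e
    rw [← star_star_cancel b a, e, star_star_cancel]
  refine ⟨fun I => or_iff_not_imp_left.2 fun hI => ?_, fun hab => ?_⟩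
  · obtain ⟨z, hz, hz0⟩ := Submodule.exists_mem_ne_zero_of_ne_bot
      (mt (LieSubmodule.toSubmodule_eq_bot I).1 hI)
    obtain ⟨c, d, hcd⟩ : ∃ c d, cent hε c d z ≠ 0 := by
      by_contra h
      push Not at h
      exact hz0 (ext_cent fun a b => by rw [h, map_zero])
    obtain ⟨hc, hd, hne⟩ := mem_indices_of_cent_ne_zero hcd
    have hex : ∀ c d : Fin 8, ∃ f, (f ≠ 0 ∧ c ≠ f ∧ d ≠ f) ∧ ∃ g, (g ≠ 0 ∧ c ≠ g ∧ d ≠ g ∧ f ≠ g) ∧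
        ∃ h, (h ≠ 0 ∧ c ≠ h ∧ d ≠ h ∧ f ≠ h ∧ g ≠ h) ∧
          ∃ k, k ≠ 0 ∧ d ≠ k ∧ f ≠ k ∧ h ≠ k := by decide +kernel
    obtain ⟨f, ⟨hf, hcf, hdf⟩, g, ⟨hg, hcg, hdg, hfg⟩, h, ⟨hh, hch, hdh, hfh, hgh⟩,
      k, hk, hdk, hfk, hhk⟩ := hex c d
    replace hf := t.mem_indices_of_ne_zero hf
    replace hg := t.mem_indices_of_ne_zero hg
    replace hh := t.mem_indices_of_ne_zero hh
    replace hk := t.mem_indices_of_ne_zero hk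
    -- four brackets reduce `z` to a multiple of one matrix `celem hε k h`
    set w1 := ⁅celem hε d f, z⁆ with hw1
    set w2 := ⁅celem hε c g, w1⁆ with hw2
    set w3 := ⁅celem hε g h, w2⁆ with hw3
    set w4 := ⁅celem hε f k, w3⁆ with hw4
    have hw4I : w4 ∈ I := lie_mem_right ℂ _ I _ _ (lie_mem_right ℂ _ I _ _
      (lie_mem_right ℂ _ I _ _ (lie_mem_right ℂ _ I _ _ hz)))
    have s1 : ∀ x y, cent hε x y w1 ≠ 0 → (True ∧ (y = d ∨ y = f)) ∨ (True ∧ (x = d ∨ x = f)) := by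
      intro x y hxy
      rcases cent_lie_celem_ne_zero hsymm hd hf hdf hxy with h | h | h | h <;> simp [h.1]
    have s2 : ∀ x y, cent hε x y w2 ≠ 0 → _ := fun x y hxy =>
      cent_lie_celem_support (B := fun y => y = d ∨ y = f) hsymm hc hg hcg s1
        (not_or.2 ⟨hne, hcf⟩) (not_or.2 ⟨Ne.symm hdg, Ne.symm hfg⟩) hxy
    have s3 : ∀ x y, cent hε x y w3 ≠ 0 →
        (x = h ∧ (y = d ∨ y = f)) ∨ (y = h ∧ (x = d ∨ x = f)) := by
      intro x y hxy
      have := cent_lie_celem_support (B := fun y => y = d ∨ y = f) hsymm hg hh hgh s2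
        (not_or.2 ⟨Ne.symm hdg, Ne.symm hfg⟩) (not_or.2 ⟨Ne.symm hdh, Ne.symm hfh⟩) hxy
      simpa [Ne.symm hgh, Ne.symm hch] using this
    have s4 : ∀ x y, cent hε x y w4 ≠ 0 → (x = k ∧ y = h) ∨ (y = k ∧ x = h) := by
      intro x y hxy
      have := cent_lie_celem_support (A := fun y => y = d ∨ y = f) (B := fun y => y = h) hsymm hf hk
        hfk (fun x y hxy => by simpa only [and_comm, or_comm] using s3 x y hxy) hfh
        (Ne.symm hhk) hxy
      simpa [Ne.symm hdk, Ne.symm hfk] using this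
    have v1 : cent hε f c w1 ≠ 0 := by
      rw [hw1, cent_lie_celem_right hsymm hd hf hdf hne hcf, neg_ne_zero, cent_skew]
      exact mul_ne_zero (hpath _ _ _ (Ne.symm hdf) hne.symm (Ne.symm hcf)) (neg_ne_zero.2 hcd)
    have v2 : cent hε g f w2 ≠ 0 := by
      rw [hw2, cent_lie_celem_right hsymm hc hg hcg (Ne.symm hcf) hfg, neg_ne_zero, cent_skew]
      exact mul_ne_zero (hpath _ _ _ (Ne.symm hcg) hcf (Ne.symm hfg)) (neg_ne_zero.2 v1)
    have v3 : cent hε h f w3 ≠ 0 := by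
      rw [hw3, cent_lie_celem_right hsymm hg hh hgh hfg hfh, neg_ne_zero]
      exact mul_ne_zero (hpath _ _ _ (Ne.symm hgh) (Ne.symm hfg) (Ne.symm hfh)) v2
    have v4 : cent hε k h w4 ≠ 0 := by
      rw [hw4, cent_lie_celem_right hsymm hf hk hfk (Ne.symm hfh) hhk, neg_ne_zero, cent_skew]
      exact mul_ne_zero (hpath _ _ _ (Ne.symm hfk) hfh (Ne.symm hhk)) (neg_ne_zero.2 v3)
    have hw : w4 = cent hε k h w4 • celem hε k h := by
      apply ext_cent
      intro x y
      rw [map_smul, cent_celem hk hh, smul_eq_mul]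
      by_cases hxy : cent hε x y w4 = 0
      · rw [hxy]
        by_cases e1 : x = k ∧ y = h
        · exact absurd (e1.1 ▸ e1.2 ▸ hxy) v4
        by_cases e2 : x = h ∧ y = k
        · rw [cent_skew, neg_eq_zero] at hxy
          exact absurd (e2.1 ▸ e2.2 ▸ hxy) v4
        rw [ite_zero_mul_ite_zero, ite_zero_mul_ite_zero, if_neg e1, if_neg e2]
        ring
      · rcases s4 x y hxy with ⟨rfl, rfl⟩ | ⟨rfl, rfl⟩
        · simp [hhk]
        · rw [cent_skew x y]
          simp [hhk]
    have hkh : celem hε k h ∈ I := by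
      rw [hw] at hw4I
      have := I.smul_mem (cent hε k h w4)⁻¹ hw4I
      rwa [smul_smul, inv_mul_cancel₀ v4, one_smul] at this
    have hmove : ∀ a ∈ t.indices, ∀ b ∈ t.indices, ∀ c ∈ t.indices, a ≠ b → a ≠ c →
        celem hε a b ∈ I → celem hε a c ∈ I := by
      intro a ha b hb c hc hab hac hI
      rcases eq_or_ne b c with rfl | hbc
      · exact hI
      have h1 := lie_mem_left ℂ _ I _ (celem hε b c) hI
      rw [lie_celem_chain ha hb hc hab hbc hac] at h1
      have := I.smul_mem (coef ε (star a b) (star b c))⁻¹ h1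
      rwa [smul_smul, inv_mul_cancel₀ (hpath a b c hab hbc hac), one_smul] at this
    rw [← LieSubmodule.toSubmodule_eq_top, eq_top_iff, ← part_points]
    refine part_le fun a ha b hb hab _ => ?_
    rcases eq_or_ne a k with rfl | hak
    · exact hmove _ hk _ hh _ hb (Ne.symm hhk) hab hkh
    · refine hmove _ ha _ hk _ hb hak hab ?_
      rw [celem_swap, neg_mem_iff]
      exact hmove _ hk _ hh _ ha (Ne.symm hhk) hak.symm hkh
  · have h1 := t.mem_indices_of_ne_zero (a := 1) (by decide)
    have h2 := t.mem_indices_of_ne_zero (a := 2) (by decide)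
    have h3 := t.mem_indices_of_ne_zero (a := 3) (by decide)
    have h := lie_celem_chain (hε := hε) h1 h2 h3 (by decide) (by decide) (by decide)
    rw [trivial_lie_zero] at h
    exact smul_ne_zero (hpath 1 2 3 (by decide) (by decide) (by decide))
      (celem_ne_zero h1 h3 (by decide)) h.symm

end

section

/-! ### Homogeneous elements are semisimple -/

variable {t : OrthType}

theorem apply_single_of_mem_component {i : Fin 8} {x : t.alg} (hx : x ∈ component t.alg (deg i))
    (b : Fin 8) : (x : Module.End ℂ Oct) (Pi.single b 1) =
      ent t (star i b) b x • Pi.single (star i b) 1 := by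
  funext a
  rw [Pi.smul_apply, Pi.single_apply]
  split_ifs with h
  · rw [h, smul_eq_mul, mul_one]
    rfl
  · rw [smul_zero]
    by_contra h'
    have := mem_component_iff.1 hx a b h'
    rw [← this, star_assoc, star_self, star_zero] at h
    exact h rfl

theorem apply_apply_single_of_mem_component {i : Fin 8} {x : t.alg}
    (hx : x ∈ component t.alg (deg i)) (b : Fin 8) :
    (x : Module.End ℂ Oct) ((x : Module.End ℂ Oct) (Pi.single b 1)) =
      (-ent t (star i b) b x ^ 2) • Pi.single b 1 := by
  rw [apply_single_of_mem_component hx, map_smul, apply_single_of_mem_component hx,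
    star_star_cancel, smul_smul, ent_skew b]
  congr 1
  ring

/-- The square of a homogeneous element is diagonal in the basis `e_0, …, e_7`. An element whose
square is a nonzero scalar `-c ^ 2` is annihilated by `(X - I c) (X + I c)`. -/
theorem isSemisimple_of_mem_component {i : Fin 8} {x : t.alg}
    (hx : x ∈ component t.alg (deg i)) : (x : Module.End ℂ Oct).IsSemisimple := by
  classical
  let c : Fin 8 → ℂ := fun b => ent t (star i b) b x
  let F : Finset ℂ := {0} ∪ (Finset.univ.image fun b => Complex.I * c b) ∪
    Finset.univ.image fun b => -(Complex.I * c b)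
  let p : Polynomial ℂ := ∏ μ ∈ F, (Polynomial.X - Polynomial.C μ)
  have hp : Squarefree p :=
    (Polynomial.separable_prod_X_sub_C_iff' (f := id) |>.2 fun _ _ _ _ h => h).squarefree
  refine Module.End.isSemisimple_of_squarefree_aeval_eq_zero hp ?_
  have key : ∀ q : Polynomial ℂ, q ∣ p → ∀ v : Oct,
      Polynomial.aeval (x : Module.End ℂ Oct) q v = 0 →
        Polynomial.aeval (x : Module.End ℂ Oct) p v = 0 := by
    rintro q ⟨s, hs⟩ v h
    rw [hs, mul_comm, map_mul, Module.End.mul_apply, h, map_zero]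
  apply end_ext
  intro a b
  rw [LinearMap.zero_apply]
  refine congrFun ?_ a
  by_cases hb : c b = 0
  · refine key (∏ μ ∈ {0}, (Polynomial.X - Polynomial.C μ))
      (Finset.prod_dvd_prod_of_subset _ _ _ (by simp [F])) _ ?_
    rw [Finset.prod_singleton, map_zero, sub_zero, Polynomial.aeval_X,
      apply_single_of_mem_component hx]
    exact (congrArg (· • _) hb).trans (zero_smul _ _)
  · have hne : Complex.I * c b ≠ -(Complex.I * c b) := by
      intro h
      exact mul_ne_zero Complex.I_ne_zero hb (self_eq_neg.1 h)
    refine key (∏ μ ∈ {Complex.I * c b, -(Complex.I * c b)}, (Polynomial.X - Polynomial.C μ))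
      (Finset.prod_dvd_prod_of_subset _ _ _ ?_) _ ?_
    · rw [Finset.insert_subset_iff, Finset.singleton_subset_iff]
      simp [F]
    · have e : (Polynomial.X - Polynomial.C (Complex.I * c b)) *
          (Polynomial.X - Polynomial.C (-(Complex.I * c b))) =
          Polynomial.X * Polynomial.X + Polynomial.C (c b ^ 2) := by
        have hI : (Polynomial.C Complex.I : Polynomial ℂ) * Polynomial.C Complex.I = -1 := by
          rw [← Polynomial.C_mul, Complex.I_mul_I, Polynomial.C_neg, Polynomial.C_1]
        simp only [Polynomial.C_neg, Polynomial.C_mul, Polynomial.C_pow]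
        linear_combination (-(Polynomial.C (c b)) ^ 2) * hI
      rw [Finset.prod_pair hne, e, map_add, map_mul, Polynomial.aeval_X, Polynomial.aeval_C,
        LinearMap.add_apply, Module.End.mul_apply, apply_apply_single_of_mem_component hx,
        Module.algebraMap_end_apply, ← add_smul]
      exact (congrArg (· • _) (neg_add_cancel _)).trans (zero_smul _ _)

theorem isSemisimple_ad {x : t.alg} (hx : (x : Module.End ℂ Oct).IsSemisimple) :
    (LieAlgebra.ad ℂ t.alg x).IsSemisimple := by
  have h := LieAlgebra.ad_isSemisimple_of_isSemisimple hx
  have hinv : t.alg.toSubmodule ∈ (LieAlgebra.ad ℂ (Module.End ℂ Oct) x).invtSubmodule :=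
    fun y hy => t.alg.lie_mem x.2 hy
  exact h.restrict hinv

theorem exists_deg_eq : ∀ g : G, ∃ i, deg i = g := by decide +kernel

end

section

/-! ### The rank -/

variable {t : OrthType}

/-- The entries of `cartanElem`: the entry at `(1 * b, b)` is `diagEntry t b`. -/
def OrthType.diagEntry : OrthType → Fin 8 → ℤ
  | .b3 => ![0, 0, 1, 2, 3, -1, -2, -3]
  | .d4 => ![4, -4, 1, 2, 3, -1, -2, -3]

/-- Columns representing the pairs `{b, 1 * b}` of indices at which `diagEntry` does not vanish. -/
def OrthType.column : (t : OrthType) → Fin t.r → Fin 8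
  | .b3 => ![2, 3, 4]
  | .d4 => ![2, 3, 4, 0]

theorem OrthType.diagEntry_star (t : OrthType) :
    ∀ b, t.diagEntry (star 1 b) = -t.diagEntry b := by
  cases t <;> decide

theorem OrthType.diagEntry_column (t : OrthType) :
    ∀ s, t.diagEntry (t.column s) = (s : ℕ) + 1 := by
  cases t <;> decide

theorem OrthType.eq_of_diagEntry_sq_eq (t : OrthType) :
    ∀ a b, t.diagEntry a ^ 2 = t.diagEntry b ^ 2 → a = b ∨ star a b = 1 := by
  cases t <;> decide

theorem OrthType.diagEntry_eq_zero (t : OrthType) :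
    ∀ b ∉ t.indices, t.diagEntry b = 0 := by
  cases t <;> decide

variable (t) in
/-- An element of degree `1` whose nonzero eigenvalues are simple. -/
def cartanElem : t.alg :=
  ⟨Matrix.toLin' (Matrix.of fun a b => if a = star 1 b then (t.diagEntry b : ℂ) else 0), by
    rw [mem_alg_iff]
    simp only [Matrix.toLin'_apply, Matrix.mulVec_single_one, Matrix.col_apply, Matrix.of_apply]
    refine ⟨fun i j => ?_, fun i j hj => by rw [t.diagEntry_eq_zero j hj, Int.cast_zero, ite_self]⟩
    have e : i = star 1 j ↔ j = star 1 i :=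
      ⟨fun h => by rw [h, star_star_cancel], fun h => by rw [h, star_star_cancel]⟩
    simp only [e]
    split_ifs with h
    · rw [h, t.diagEntry_star, Int.cast_neg, neg_add_cancel]
    · exact add_zero 0⟩

theorem ent_cartanElem (a b : Fin 8) :
    ent t a b (cartanElem t) = if a = star 1 b then (t.diagEntry b : ℂ) else 0 := by
  change Matrix.toLin' _ (Pi.single b 1) a = _
  rw [Matrix.toLin'_apply, Matrix.mulVec_single_one, Matrix.col_apply, Matrix.of_apply]

theorem cartanElem_mem_component : cartanElem t ∈ component t.alg (deg 1) := by
  rw [mem_component_iff]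
  intro a b h
  rw [ent_cartanElem] at h
  split_ifs at h with e
  · rw [e, star_assoc, star_self, star_zero]
  · exact absurd rfl h

/-- If `y` commutes with `x = cartanElem t`, then it commutes with `x ^ 2`, a diagonal matrix whose
entries agree only at the two ends of a pair `{b, 1 * b}`. -/
theorem engel_cartanElem_le : (LieSubalgebra.engel ℂ (cartanElem t)).toSubmodule ≤
    gradedPart t {1} := by
  intro y hy
  have hss := (isSemisimple_ad (isSemisimple_of_mem_component
    (cartanElem_mem_component (t := t)))).isFinitelySemisimple
  have h0 : ⁅cartanElem t, y⁆ = 0 := by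
    have h1 : y ∈ (LieAlgebra.ad ℂ t.alg (cartanElem t)).maxGenEigenspace 0 := hy
    rw [hss.maxGenEigenspace_eq_eigenspace, Module.End.mem_eigenspace_iff, zero_smul] at h1
    exact h1
  -- comparison of the entries of `x y` and `y x` at `(1 * a, b)`
  have h1 : ∀ a b, (t.diagEntry a : ℂ) * ent t a b y =
      t.diagEntry b * ent t (star 1 a) (star 1 b) y := by
    intro a b
    have h2 := ent_lie (star 1 a) b (cartanElem t) y
    have e : ∀ c, star 1 a = star 1 c ↔ c = a := fun c =>
      ⟨fun h => by rw [← star_star_cancel 1 c, ← h, star_star_cancel], fun h => by rw [h]⟩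
    rw [h0, map_zero] at h2
    simp only [ent_cartanElem, e, ite_mul, zero_mul, mul_ite, mul_zero, Finset.sum_sub_distrib,
      Finset.sum_ite_eq', Finset.mem_univ, if_true] at h2
    linear_combination -h2
  intro a b hab
  have h2 := h1 a b
  have h3 := h1 (star 1 a) (star 1 b)
  rw [star_star_cancel, star_star_cancel, t.diagEntry_star, t.diagEntry_star, Int.cast_neg,
    Int.cast_neg] at h3
  have h4 : ((t.diagEntry a : ℂ) ^ 2 - (t.diagEntry b : ℂ) ^ 2) * ent t a b y = 0 := by
    linear_combination (t.diagEntry a : ℂ) * h2 - (t.diagEntry b : ℂ) * h3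
  have h5 := (mul_eq_zero.1 h4).resolve_right hab
  have h6 : t.diagEntry a ^ 2 = t.diagEntry b ^ 2 := by exact_mod_cast sub_eq_zero.1 h5
  exact Finset.mem_singleton.2 ((t.eq_of_diagEntry_sq_eq a b h6).resolve_left
    (mem_indices_of_ent_ne_zero hab).2.2)

theorem rank_le : LieAlgebra.rank ℂ t.alg ≤ t.r := by
  have h1 := LieAlgebra.rank_le_finrank_engel ℂ (cartanElem t)
  have h2 := Submodule.finrank_mono (engel_cartanElem_le (t := t))
  rw [finrank_gradedPart (by decide), Finset.card_singleton, mul_one] at h2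
  exact h1.trans h2

/-- The triple product of two skew-symmetric maps; it shows that odd powers are skew-symmetric. -/
theorem sandwich_mem {f k : Module.End ℂ Oct} (hf : f ∈ t.alg) (hk : k ∈ t.alg) :
    f * k * f ∈ t.alg := by
  have key : ∀ f ∈ d4, ∀ k ∈ d4, f * k * f ∈ d4 := by
    intro f hf k hk x y
    have h1 := hf (k (f x)) y
    have h2 := hk (f x) (f y)
    have h3 := hf x (k (f y))
    simp only [Module.End.mul_apply]
    linear_combination h1 - h2 + h3
  cases t with
  | d4 => exact key f hf k hk
  | b3 => exact ⟨key f hf.1 k hk.1, by rw [Module.End.mul_apply, hf.2, map_zero]⟩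

theorem pow_odd_mem {f : Module.End ℂ Oct} (hf : f ∈ t.alg) (k : ℕ) : f ^ (2 * k + 1) ∈ t.alg := by
  induction k with
  | zero => rwa [mul_zero, zero_add, pow_one]
  | succ k ih =>
    have e : f ^ (2 * (k + 1) + 1) = f * f ^ (2 * k + 1) * f := by
      rw [← pow_succ', ← pow_succ]
      rfl
    rw [e]
    exact sandwich_mem hf ih

/-- The odd power `x ^ (2 k + 1)`. -/
def oddPow (x : t.alg) (k : ℕ) : t.alg := ⟨(x : Module.End ℂ Oct) ^ (2 * k + 1), pow_odd_mem x.2 k⟩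

theorem oddPow_mem_engel (x : t.alg) (k : ℕ) : oddPow x k ∈ LieSubalgebra.engel ℂ x := by
  rw [LieSubalgebra.mem_engel_iff]
  refine ⟨1, ?_⟩
  rw [pow_one, LieAlgebra.ad_apply]
  exact Subtype.ext (commute_iff_lie_eq.1 (Commute.self_pow _ _))

theorem oddPow_cartanElem (k : ℕ) (b : Fin 8) : ent t (star 1 b) b (oddPow (cartanElem t) k) =
    t.diagEntry b * (-(t.diagEntry b : ℂ) ^ 2) ^ k := by
  have hent : ∀ b, ent t (star 1 b) b (cartanElem t) = t.diagEntry b := fun b => by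
    rw [ent_cartanElem, if_pos rfl]
  have h : ∀ k, ((cartanElem t : Module.End ℂ Oct) ^ (2 * k)) (Pi.single b 1) =
      ((-(t.diagEntry b : ℂ) ^ 2) ^ k) • Pi.single b 1 := by
    intro k
    induction k with
    | zero => simp
    | succ k ih =>
      rw [mul_add, pow_add, Module.End.mul_apply, mul_one, pow_two, Module.End.mul_apply,
        apply_apply_single_of_mem_component cartanElem_mem_component, hent, map_smul, ih,
        smul_smul, ← pow_succ']
  change ((cartanElem t : Module.End ℂ Oct) ^ (2 * k + 1)) (Pi.single b 1) (star 1 b) = _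
  rw [pow_succ', Module.End.mul_apply, h, map_smul,
    apply_single_of_mem_component cartanElem_mem_component, hent]
  simp [mul_comm]

variable (t) in
/-- The entries of the first `r` odd powers of `x` in the positions of degree `1`. -/
def oddMatrix (x : t.alg) : Matrix (Fin t.r) (Fin t.r) ℂ :=
  Matrix.of fun k s => ent t (star 1 (t.column s)) (t.column s) (oddPow x k)

theorem det_oddMatrix_cartanElem : (oddMatrix t (cartanElem t)).det ≠ 0 := by
  have e : (oddMatrix t (cartanElem t)).transpose = Matrix.of fun s k : Fin t.r =>
      ((s : ℕ) + 1 : ℂ) * Matrix.vandermonde (fun s : Fin t.r => -((s : ℕ) + 1 : ℂ) ^ 2) s k := by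
    ext s k
    rw [Matrix.transpose_apply, oddMatrix, Matrix.of_apply, oddPow_cartanElem, t.diagEntry_column,
      Matrix.of_apply, Matrix.vandermonde_apply]
    push_cast
    rfl
  rw [← Matrix.det_transpose, e, Matrix.det_mul_column]
  refine mul_ne_zero (Finset.prod_ne_zero_iff.2 fun s _ => Nat.cast_add_one_ne_zero _)
    (Matrix.det_vandermonde_ne_zero_iff.2 fun s s' h => ?_)
  have h1 : ((s : ℕ) + 1) ^ 2 = ((s' : ℕ) + 1) ^ 2 := by exact_mod_cast neg_inj.1 h
  have h2 := Nat.pow_left_injective two_ne_zero h1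
  exact Fin.ext (Nat.succ.inj h2)

theorem le_finrank_engel {x : t.alg} (hx : (oddMatrix t x).det ≠ 0) :
    t.r ≤ Module.finrank ℂ (LieSubalgebra.engel ℂ x) := by
  have h1 := Matrix.linearIndependent_rows_of_det_ne_zero hx
  let φ : LieSubalgebra.engel ℂ x →ₗ[ℂ] (Fin t.r → ℂ) :=
    LinearMap.pi fun s => ent t (star 1 (t.column s)) (t.column s) ∘ₗ
      (LieSubalgebra.engel ℂ x).toSubmodule.subtype
  have h2 : LinearIndependent ℂ fun k : Fin t.r =>
      (⟨oddPow x k, oddPow_mem_engel x k⟩ : LieSubalgebra.engel ℂ x) :=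
    LinearIndependent.of_comp φ h1
  simpa using h2.fintype_card_le_finrank

/-- Both the nonvanishing of the determinant of `oddMatrix` and regularity are nonempty Zariski
open conditions, so some element satisfies both. -/
theorem exists_isRegular_det_oddMatrix_ne_zero :
    ∃ x : t.alg, LieAlgebra.IsRegular ℂ x ∧ (oddMatrix t x).det ≠ 0 := by
  classical
  let b := Module.finBasis ℂ t.alg
  let M : Matrix (Fin 8) (Fin 8) (MvPolynomial (Fin (Module.finrank ℂ t.alg)) ℂ) :=
    Matrix.of fun a c => ∑ i, MvPolynomial.X i * MvPolynomial.C (ent t a c (b i))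
  let D := Matrix.det (Matrix.of fun k s : Fin t.r =>
    (M ^ (2 * (k : ℕ) + 1)) (star 1 (t.column s)) (t.column s))
  let F := ((LieAlgebra.ad ℂ t.alg).toLinearMap.polyCharpoly b).coeff (LieAlgebra.rank ℂ t.alg)
  have hM : ∀ x : t.alg, M.map (MvPolynomial.eval (b.repr x)) =
      LinearMap.toMatrixAlgEquiv' (x : Module.End ℂ Oct) := by
    intro x
    ext a c
    have e : ent t a c x = ∑ i, b.repr x i * ent t a c (b i) := by
      conv_lhs => rw [← b.sum_repr x]
      rw [map_sum]
      exact Finset.sum_congr rfl fun i _ => by rw [map_smul, smul_eq_mul]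
    have e' : LinearMap.toMatrixAlgEquiv' (x : Module.End ℂ Oct) a c = ent t a c x := by
      rw [LinearMap.toMatrixAlgEquiv'_apply]
      rfl
    rw [e', e]
    simp [M]
  have hD : ∀ x : t.alg, MvPolynomial.eval (b.repr x) D = (oddMatrix t x).det := by
    intro x
    rw [RingHom.map_det]
    congr 1
    ext k s
    have e : (M ^ (2 * (k : ℕ) + 1)).map (MvPolynomial.eval (b.repr x)) =
        LinearMap.toMatrixAlgEquiv' ((x : Module.End ℂ Oct) ^ (2 * (k : ℕ) + 1)) := by
      rw [map_pow, ← hM]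
      exact map_pow (MvPolynomial.eval (b.repr x)).mapMatrix M _
    refine (congrFun (congrFun e (star 1 (t.column s))) (t.column s)).trans ?_
    rw [LinearMap.toMatrixAlgEquiv'_apply]
    rfl
  have hD0 : D ≠ 0 := by
    intro h
    have h1 := hD (cartanElem t)
    rw [h, map_zero] at h1
    exact det_oddMatrix_cartanElem h1.symm
  have hF0 : F ≠ 0 := LieAlgebra.polyCharpoly_coeff_rank_ne_zero ℂ t.alg b
  by_contra! hcon
  refine mul_ne_zero hF0 hD0 (MvPolynomial.funext fun w => ?_)
  let x : t.alg := ∑ i, w i • b i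
  have hw : b.repr x = w := funext fun i => congrFun (b.repr_sum_self w) i
  by_cases hF : MvPolynomial.eval w F = 0
  · rw [map_mul, hF, zero_mul, map_zero]
  · have h1 := hcon x ((LieAlgebra.isRegular_iff_coeff_polyCharpoly_rank_ne_zero ℂ b x).2
      (by rw [hw]; exact hF))
    rw [map_mul, ← hw, hD, h1, mul_zero, map_zero]

theorem rank_eq (t : OrthType) : LieAlgebra.rank ℂ t.alg = t.r := by
  refine le_antisymm rank_le ?_
  obtain ⟨x, hx, hdet⟩ := exists_isRegular_det_oddMatrix_ne_zero (t := t)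
  rw [← (LieAlgebra.isRegular_iff_finrank_engel_eq_rank ℂ x).1 hx]
  exact le_finrank_engel hdet

end

section

/-! ### The contracted algebras -/

variable {t : OrthType} {ε : G → G → ℂ} {hε : IsGradedContraction (component t.alg) ε}
  {N : Finset (Sym2 (Fin 8))}

theorem isInternal_component (hε : IsGradedContraction (component t.alg) ε) :
    DirectSum.IsInternal fun g : G => (component t.alg g).map (toContracted hε).toLinearMap := by
  have h := (DirectSum.isInternal_submodule_iff_iSupIndep_and_iSup_eq_top _).1
    (DirectSum.Decomposition.isInternal (component t.alg))
  refine (DirectSum.isInternal_submodule_iff_iSupIndep_and_iSup_eq_top _).2 ⟨?_, ?_⟩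
  · exact (iSupIndep_map_orderIso_iff (Submodule.orderIsoMapComap (toContracted hε))).2 h.1
  · rw [← Submodule.map_iSup, h.2, Submodule.map_top, LinearEquiv.range]

theorem lie_mem_map_component {g h : G} {x y : Contracted hε}
    (hx : x ∈ (component t.alg g).map (toContracted hε).toLinearMap)
    (hy : y ∈ (component t.alg h).map (toContracted hε).toLinearMap) :
    ⁅x, y⁆ ∈ (component t.alg (g + h)).map (toContracted hε).toLinearMap := by
  obtain ⟨x, hx, rfl⟩ := hx
  obtain ⟨y, hy, rfl⟩ := hy
  refine ⟨contractedBracket (component t.alg) ε x y, ?_, rfl⟩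
  rw [contractedBracket_of_mem _ ε hx hy]
  exact Submodule.smul_mem _ _ (lie_mem_component t.alg hx hy)

theorem existsUnique_collinearSets {T : Set (Sym2 (Fin 8))} (hT : IsNice T) :
    ∃! n : ℕ, n ∈ Finset.Icc 1 24 ∧ CollinearSets T (niceSet n) := by
  obtain ⟨n, hn, h⟩ := hT.exists_collinearSets
  refine ⟨n, ⟨hn, h⟩, fun m ⟨hm, h'⟩ => ?_⟩
  obtain ⟨σ, hσ, e⟩ := h
  obtain ⟨σ', hσ', e'⟩ := h'
  refine eq_of_collinearSets hm hn ⟨σ'.symm.trans σ, hσ'.symm.trans hσ, ?_⟩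
  rw [← e', Equiv.coe_trans, Sym2.map_comp, Set.image_comp, image_map_symm, e]

theorem isReductive (hadm : IsAdmissible ε) (h : CollinearSets (supp ε) N)
    (hN : ∀ i, s(lineLabel i, lineLabel (i + 1)) ∈ N)
    (hstep : step N points {3, 4, 6, 7} ⊆ {3, 4, 6, 7})
    (hstep' : step N {3, 4, 6, 7} {3, 4, 6, 7} = ∅) (hiso : isolated N = {3, 4, 6, 7}) :
    IsReductive (Contracted hε) := by
  obtain ⟨τ, hτ, hT, hrad, -⟩ := exists_radical_eq_part (hε := hε) hadm h hN hstep hstep'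
  rw [IsReductive, ← LieSubmodule.toSubmodule_inj, hrad, toSubmodule_center hadm hT,
    hτ.isolated_image, hiso]

theorem finrank_radical (hadm : IsAdmissible ε) (h : CollinearSets (supp ε) N)
    (hN : ∀ i, s(lineLabel i, lineLabel (i + 1)) ∈ N)
    (hstep : step N points {3, 4, 6, 7} ⊆ {3, 4, 6, 7})
    (hstep' : step N {3, 4, 6, 7} {3, 4, 6, 7} = ∅) :
    Module.finrank ℂ (LieAlgebra.radical ℂ (Contracted hε)) = 4 * t.r := by
  obtain ⟨τ, hτ, hT, hrad, -⟩ := exists_radical_eq_part (hε := hε) hadm h hN hstep hstep'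
  have h0 : 0 ∉ ({3, 4, 6, 7} : Finset (Fin 8)).image τ := by
    rw [← hτ.1, Function.Injective.mem_finset_image τ.injective]
    decide
  have hf := finrank_part (hε := hε) h0
  rw [← hrad, Finset.card_image_of_injective _ τ.injective, mul_comm] at hf
  exact hf

theorem not_isReductive (hadm : IsAdmissible ε) (h : CollinearSets (supp ε) N)
    (hN : ∀ i, s(lineLabel i, lineLabel (i + 1)) ∈ N)
    (hstep : step N points {3, 4, 6, 7} ⊆ {3, 4, 6, 7})
    (hstep' : step N {3, 4, 6, 7} {3, 4, 6, 7} = ∅) (hiso : isolated N = ∅) :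
    ¬ IsReductive (Contracted hε) := by
  intro hred
  have h1 := finrank_radical (hε := hε) hadm h hN hstep hstep'
  have h2 := congrArg LieSubmodule.toSubmodule (hred.trans (center_eq_bot hadm h hiso))
  change Module.finrank ℂ (LieAlgebra.radical ℂ (Contracted hε)).toSubmodule = _ at h1
  rw [h2, LieSubmodule.bot_toSubmodule, finrank_bot] at h1
  exact absurd h1 (by cases t <;> decide)

theorem exists_isLevi (hadm : IsAdmissible ε) (h : CollinearSets (supp ε) N)
    (hN : ∀ i, s(lineLabel i, lineLabel (i + 1)) ∈ N)
    (hstep : step N points {3, 4, 6, 7} ⊆ {3, 4, 6, 7})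
    (hstep' : step N {3, 4, 6, 7} {3, 4, 6, 7} = ∅) :
    (∃ S : LieSubalgebra ℂ (Contracted hε), IsLevi S) ∧
      ∀ S : LieSubalgebra ℂ (Contracted hε), IsLevi S → Nonempty (S ≃ₗ⁅ℂ⁆ sl2Sum t.r) := by
  obtain ⟨τ, hτ, hT, -, φ, hinj, hφ⟩ := exists_radical_eq_part (hε := hε) hadm h hN hstep hstep'
  exact ⟨⟨φ.range, hφ⟩, fun S hS => hS.nonempty_equiv hinj hφ⟩

theorem isSimple (hadm : IsAdmissible ε) (h : CollinearSets (supp ε) N) (hN : N = X) :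
    LieAlgebra.IsSimple ℂ (Contracted hε) := by
  obtain ⟨τ, hτ, hT⟩ := h.exists_image
  refine isSimple_of_coef_ne_zero (coef_comm hε hadm) fun i j hi hj hij => ?_
  rw [coef_ne_zero_iff hε hadm hT, hN, ← τ.apply_symm_apply i, ← τ.apply_symm_apply j, mk_mem_image]
  have hX : ∀ i j : Fin 8, i ≠ 0 → j ≠ 0 → i ≠ j → s(i, j) ∈ X := by decide +kernel
  exact hX _ _ (hτ.symm.ne_zero.2 hi) (hτ.symm.ne_zero.2 hj) (τ.symm.injective.ne hij)

theorem isSemisimple_of_mem_map_component {g : G} {x : Contracted hε}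
    (hx : x ∈ (component t.alg g).map (toContracted hε).toLinearMap) :
    (LieAlgebra.ad ℂ t.alg ((toContracted hε).symm x)).IsSemisimple ∧
      (((toContracted hε).symm x : t.alg) : Module.End ℂ Oct).IsSemisimple := by
  obtain ⟨x, hx, rfl⟩ := hx
  obtain ⟨i, rfl⟩ := exists_deg_eq g
  have h := isSemisimple_of_mem_component hx
  exact ⟨isSemisimple_ad h, h⟩

end

end OctGrading

end

theorem mainTheorem3 (t : OrthType) (ε : G → G → ℂ)
    (hε : IsGradedContraction (component t.alg) ε) (hadm : IsAdmissible ε) :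
    LieAlgebra.rank ℂ t.alg = t.r ∧
    (∀ n ∈ Finset.Icc 1 24, IsNice (niceSet n : Set (Sym2 (Fin 8)))) ∧
    (∃! n : ℕ, n ∈ Finset.Icc 1 24 ∧ CollinearSets (supp ε) (niceSet n)) ∧
    (CollinearSets (supp ε) (niceSet 1) →
      IsLieAbelian (Contracted hε)) ∧
    (CollinearSets (supp ε) (niceSet 2) →
      IsStepNilpotent (Contracted hε) 2 ∧
      Module.finrank ℂ (derivedAlg (Contracted hε)) = t.r ∧
      Module.finrank ℂ (LieAlgebra.center ℂ (Contracted hε)) = 5 * t.r) ∧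
    (CollinearSets (supp ε) (niceSet 3) →
      IsStepNilpotent (Contracted hε) 2 ∧
      Module.finrank ℂ (derivedAlg (Contracted hε)) = 2 * t.r ∧
      Module.finrank ℂ (LieAlgebra.center ℂ (Contracted hε)) = 4 * t.r) ∧
    (CollinearSets (supp ε) (niceSet 4) →
      IsStepSolvable (Contracted hε) 2 ∧
      ¬ LieRing.IsNilpotent (Contracted hε) ∧
      Module.finrank ℂ (derivedAlg (Contracted hε)) = 2 * t.r ∧
      Module.finrank ℂ (LieAlgebra.center ℂ (Contracted hε)) = 4 * t.r) ∧
    (CollinearSets (supp ε) (niceSet 5) →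
      IsStepNilpotent (Contracted hε) 2 ∧
      Module.finrank ℂ (derivedAlg (Contracted hε)) = t.r ∧
      Module.finrank ℂ (LieAlgebra.center ℂ (Contracted hε)) = 3 * t.r) ∧
    (CollinearSets (supp ε) (niceSet 6) →
      IsReductive (Contracted hε) ∧
      ¬ LieRing.IsNilpotent (Contracted hε) ∧
      ¬ LieAlgebra.IsSolvable (Contracted hε) ∧
      IsCompl (LieAlgebra.center ℂ (Contracted hε)) (derivedAlg (Contracted hε)) ∧
      Module.finrank ℂ (LieAlgebra.center ℂ (Contracted hε)) = 4 * t.r) ∧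
    (CollinearSets (supp ε) (niceSet 7) →
      IsStepNilpotent (Contracted hε) 2 ∧
      LieAlgebra.center ℂ (Contracted hε) = derivedAlg (Contracted hε) ∧
      Module.finrank ℂ (LieAlgebra.center ℂ (Contracted hε)) = t.r) ∧
    (CollinearSets (supp ε) (niceSet 8) →
      IsStepNilpotent (Contracted hε) 2 ∧
      LieAlgebra.center ℂ (Contracted hε) = derivedAlg (Contracted hε) ∧
      Module.finrank ℂ (LieAlgebra.center ℂ (Contracted hε)) = 3 * t.r) ∧
    (CollinearSets (supp ε) (niceSet 9) →
      IsStepSolvable (Contracted hε) 2 ∧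
      ¬ LieRing.IsNilpotent (Contracted hε) ∧
      Module.finrank ℂ (derivedAlg (Contracted hε)) = 3 * t.r ∧
      Module.finrank ℂ (LieAlgebra.center ℂ (Contracted hε)) = 3 * t.r) ∧
    (CollinearSets (supp ε) (niceSet 10) →
      IsStepNilpotent (Contracted hε) 2 ∧
      Module.finrank ℂ (derivedAlg (Contracted hε)) = 3 * t.r ∧
      Module.finrank ℂ (LieAlgebra.center ℂ (Contracted hε)) = 3 * t.r) ∧
    (CollinearSets (supp ε) (niceSet 11) →
      IsStepNilpotent (Contracted hε) 2 ∧
      Module.finrank ℂ (derivedAlg (Contracted hε)) = 3 * t.r ∧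
      Module.finrank ℂ (LieAlgebra.center ℂ (Contracted hε)) = 4 * t.r) ∧
    (CollinearSets (supp ε) (niceSet 12) →
      IsStepNilpotent (Contracted hε) 2 ∧
      Module.finrank ℂ (derivedAlg (Contracted hε)) = 2 * t.r ∧
      Module.finrank ℂ (LieAlgebra.center ℂ (Contracted hε)) = 3 * t.r) ∧
    (CollinearSets (supp ε) (niceSet 13) →
      IsStepSolvable (Contracted hε) 2 ∧
      ¬ LieRing.IsNilpotent (Contracted hε) ∧
      Module.finrank ℂ (LieAlgebra.center ℂ (Contracted hε)) = 2 * t.r ∧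
      Module.finrank ℂ (derivedAlg (Contracted hε)) = 4 * t.r) ∧
    (CollinearSets (supp ε) (niceSet 14) →
      IsStepSolvable (Contracted hε) 2 ∧
      ¬ LieRing.IsNilpotent (Contracted hε) ∧
      Module.finrank ℂ (LieAlgebra.center ℂ (Contracted hε)) = 2 * t.r ∧
      Module.finrank ℂ (derivedAlg (Contracted hε)) = 4 * t.r) ∧
    (CollinearSets (supp ε) (niceSet 15) →
      IsStepNilpotent (Contracted hε) 2 ∧
      Module.finrank ℂ (derivedAlg (Contracted hε)) = 3 * t.r ∧
      Module.finrank ℂ (LieAlgebra.center ℂ (Contracted hε)) = 3 * t.r) ∧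
    (CollinearSets (supp ε) (niceSet 16) →
      IsStepNilpotent (Contracted hε) 2 ∧
      Module.finrank ℂ (derivedAlg (Contracted hε)) = 2 * t.r ∧
      Module.finrank ℂ (LieAlgebra.center ℂ (Contracted hε)) = 3 * t.r) ∧
    (CollinearSets (supp ε) (niceSet 17) →
      IsStepSolvable (Contracted hε) 2 ∧
      ¬ LieRing.IsNilpotent (Contracted hε) ∧
      Module.finrank ℂ (derivedAlg (Contracted hε)) = 5 * t.r ∧
      Module.finrank ℂ (LieAlgebra.center ℂ (Contracted hε)) = t.r) ∧
    (CollinearSets (supp ε) (niceSet 18) →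
      IsStepNilpotent (Contracted hε) 2 ∧
      Module.finrank ℂ (derivedAlg (Contracted hε)) = 3 * t.r ∧
      Module.finrank ℂ (LieAlgebra.center ℂ (Contracted hε)) = 3 * t.r) ∧
    (CollinearSets (supp ε) (niceSet 19) →
      IsStepNilpotent (Contracted hε) 2 ∧
      Module.finrank ℂ (derivedAlg (Contracted hε)) = 3 * t.r ∧
      Module.finrank ℂ (LieAlgebra.center ℂ (Contracted hε)) = 3 * t.r) ∧
    (CollinearSets (supp ε) (niceSet 20) →
      IsStepSolvable (Contracted hε) 2 ∧
      ¬ LieRing.IsNilpotent (Contracted hε) ∧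
      Module.finrank ℂ (derivedAlg (Contracted hε)) = 6 * t.r ∧
      LieAlgebra.center ℂ (Contracted hε) = ⊥) ∧
    (CollinearSets (supp ε) (niceSet 21) →
      IsStepSolvable (Contracted hε) 2 ∧
      IsStepNilpotent (Contracted hε) 3 ∧
      Module.finrank ℂ (derivedAlg (Contracted hε)) = 4 * t.r ∧
      Module.finrank ℂ (LieAlgebra.center ℂ (Contracted hε)) = t.r) ∧
    (CollinearSets (supp ε) (niceSet 22) →
      IsStepSolvable (Contracted hε) 3 ∧
      ¬ LieRing.IsNilpotent (Contracted hε) ∧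
      Module.finrank ℂ (derivedAlg (Contracted hε)) = 6 * t.r ∧
      LieAlgebra.center ℂ (Contracted hε) = ⊥) ∧
    (CollinearSets (supp ε) (niceSet 23) →
      ¬ LieRing.IsNilpotent (Contracted hε) ∧
      ¬ LieAlgebra.IsSolvable (Contracted hε) ∧
      ¬ IsReductive (Contracted hε) ∧
      Module.finrank ℂ (LieAlgebra.radical ℂ (Contracted hε)) = 4 * t.r ∧
      (∃ S : LieSubalgebra ℂ (Contracted hε), IsLevi S) ∧
      (∀ S : LieSubalgebra ℂ (Contracted hε), IsLevi S → Nonempty (S ≃ₗ⁅ℂ⁆ sl2Sum t.r))) ∧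
    (CollinearSets (supp ε) (niceSet 24) →
      LieAlgebra.IsSimple ℂ (Contracted hε)) ∧
    (DirectSum.IsInternal (fun g : G => (component t.alg g).map (toContracted hε).toLinearMap) ∧
      ∀ g h : G, ∀ x ∈ (component t.alg g).map (toContracted hε).toLinearMap,
        ∀ y ∈ (component t.alg h).map (toContracted hε).toLinearMap,
          ⁅x, y⁆ ∈ (component t.alg (g + h)).map (toContracted hε).toLinearMap) ∧
    (∀ g : G, ∀ x ∈ (component t.alg g).map (toContracted hε).toLinearMap,
      (LieAlgebra.ad ℂ t.alg ((toContracted hε).symm x)).IsSemisimple ∧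
      (((toContracted hε).symm x : t.alg) : Module.End ℂ Oct).IsSemisimple) := by
  refine ⟨rank_eq t, isNice_niceSet, existsUnique_collinearSets (isNice_supp hε hadm), ?_⟩
  refine ⟨fun h => ?_, fun h => ?_, fun h => ?_, fun h => ?_, fun h => ?_, fun h => ?_,
    fun h => ?_, fun h => ?_, fun h => ?_, fun h => ?_, fun h => ?_, fun h => ?_,
    fun h => ?_, fun h => ?_, fun h => ?_, fun h => ?_, fun h => ?_, fun h => ?_,
    fun h => ?_, fun h => ?_, fun h => ?_, fun h => ?_, fun h => ?_, fun h => ?_,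
    ⟨isInternal_component hε, fun _ _ _ hx _ hy => lie_mem_map_component hx hy⟩,
    fun _ _ => isSemisimple_of_mem_map_component⟩
  · exact isLieAbelian_of_supp_empty hadm h rfl
  · exact ⟨isStepNilpotent hadm h (by decide +kernel),
      (finrank_derivedAlg hadm h (m := 1) (by decide +kernel)).trans (one_mul _),
      finrank_center hadm h (by decide +kernel)⟩
  · exact ⟨isStepNilpotent hadm h (by decide +kernel),
      finrank_derivedAlg hadm h (by decide +kernel),
      finrank_center hadm h (by decide +kernel)⟩
  · exact ⟨isStepSolvable hadm h (by decide +kernel),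
      not_isNilpotent hadm h (by decide +kernel) (by decide +kernel),
      finrank_derivedAlg hadm h (by decide +kernel),
      finrank_center hadm h (by decide +kernel)⟩
  · exact ⟨isStepNilpotent hadm h (by decide +kernel),
      (finrank_derivedAlg hadm h (m := 1) (by decide +kernel)).trans (one_mul _),
      finrank_center hadm h (by decide +kernel)⟩
  · exact ⟨isReductive hadm h (by decide +kernel) (by decide +kernel) (by decide +kernel)
        (by decide +kernel),
      not_isNilpotent hadm h (by decide +kernel) (by decide +kernel),
      not_isSolvable hadm h (by decide +kernel) (by decide +kernel) (by decide +kernel),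
      isCompl_center_derivedAlg hadm h (by decide +kernel) (by decide +kernel),
      finrank_center hadm h (by decide +kernel)⟩
  · exact ⟨isStepNilpotent hadm h (by decide +kernel),
      center_eq_derivedAlg hadm h (by decide +kernel),
      (finrank_center hadm h (m := 1) (by decide +kernel)).trans (one_mul _)⟩
  · exact ⟨isStepNilpotent hadm h (by decide +kernel),
      center_eq_derivedAlg hadm h (by decide +kernel),
      finrank_center hadm h (by decide +kernel)⟩
  · exact ⟨isStepSolvable hadm h (by decide +kernel),
      not_isNilpotent hadm h (by decide +kernel) (by decide +kernel),
      finrank_derivedAlg hadm h (by decide +kernel),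
      finrank_center hadm h (by decide +kernel)⟩
  · exact ⟨isStepNilpotent hadm h (by decide +kernel),
      finrank_derivedAlg hadm h (by decide +kernel),
      finrank_center hadm h (by decide +kernel)⟩
  · exact ⟨isStepNilpotent hadm h (by decide +kernel),
      finrank_derivedAlg hadm h (by decide +kernel),
      finrank_center hadm h (by decide +kernel)⟩
  · exact ⟨isStepNilpotent hadm h (by decide +kernel),
      finrank_derivedAlg hadm h (by decide +kernel),
      finrank_center hadm h (by decide +kernel)⟩
  · exact ⟨isStepSolvable hadm h (by decide +kernel),
      not_isNilpotent hadm h (by decide +kernel) (by decide +kernel),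
      finrank_center hadm h (by decide +kernel),
      finrank_derivedAlg hadm h (by decide +kernel)⟩
  · exact ⟨isStepSolvable hadm h (by decide +kernel),
      not_isNilpotent hadm h (by decide +kernel) (by decide +kernel),
      finrank_center hadm h (by decide +kernel),
      finrank_derivedAlg hadm h (by decide +kernel)⟩
  · exact ⟨isStepNilpotent hadm h (by decide +kernel),
      finrank_derivedAlg hadm h (by decide +kernel),
      finrank_center hadm h (by decide +kernel)⟩
  · exact ⟨isStepNilpotent hadm h (by decide +kernel),
      finrank_derivedAlg hadm h (by decide +kernel),
      finrank_center hadm h (by decide +kernel)⟩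
  · exact ⟨isStepSolvable hadm h (by decide +kernel),
      not_isNilpotent hadm h (by decide +kernel) (by decide +kernel),
      finrank_derivedAlg hadm h (by decide +kernel),
      (finrank_center hadm h (m := 1) (by decide +kernel)).trans (one_mul _)⟩
  · exact ⟨isStepNilpotent hadm h (by decide +kernel),
      finrank_derivedAlg hadm h (by decide +kernel),
      finrank_center hadm h (by decide +kernel)⟩
  · exact ⟨isStepNilpotent hadm h (by decide +kernel),
      finrank_derivedAlg hadm h (by decide +kernel),
      finrank_center hadm h (by decide +kernel)⟩
  · exact ⟨isStepSolvable hadm h (by decide +kernel),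
      not_isNilpotent hadm h (by decide +kernel) (by decide +kernel),
      finrank_derivedAlg hadm h (by decide +kernel),
      center_eq_bot hadm h (by decide +kernel)⟩
  · exact ⟨isStepSolvable hadm h (by decide +kernel),
      isStepNilpotent hadm h (by decide +kernel),
      finrank_derivedAlg hadm h (by decide +kernel),
      (finrank_center hadm h (m := 1) (by decide +kernel)).trans (one_mul _)⟩
  · exact ⟨isStepSolvable hadm h (by decide +kernel),
      not_isNilpotent hadm h (by decide +kernel) (by decide +kernel),
      finrank_derivedAlg hadm h (by decide +kernel),
      center_eq_bot hadm h (by decide +kernel)⟩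
  · exact ⟨not_isNilpotent hadm h (by decide +kernel) (by decide +kernel),
      not_isSolvable hadm h (by decide +kernel) (by decide +kernel) (by decide +kernel),
      not_isReductive hadm h (by decide +kernel) (by decide +kernel) (by decide +kernel)
        (by decide +kernel),
      finrank_radical hadm h (by decide +kernel) (by decide +kernel) (by decide +kernel),
      exists_isLevi hadm h (by decide +kernel) (by decide +kernel) (by decide +kernel)⟩
  · exact isSimple hadm h rfl
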